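/- Let $(M,\mathcal F)$ be a Finsler manifold of dimension $n$: $M$ is a smooth $n$-manifold and $\mathcal F:TM\to\mathbb R$ is continuous, smooth on $\hat TM=TM\setminus\{0\}$, positively homogeneous of degree $1$ on each $T_xM$, and the form $g_{x,y}(u,v)=\frac12\frac{\partial^2}{\partial s\,\partial t}\mathcal F_x^2(y+su+tv)\big|_{s=t=0}$ is positive definite for every $y\in T_xM\setminus\{0\}$. In induced coordinates $(x^i,y^i)$ of $TM$ put $G^i=\frac14 g^{il}\big(2\frac{\partial g_{jl}}{\partial x^k}-\frac{\partial g_{jk}}{\partial x^l}\big)y^jy^k$ and $G^i_j=\frac{\partial G^i}{\partial y^j}$. The horizontal lift of $X=X^i\frac{\partial}{\partial x^i}$ is $X^h=X^i\big(\frac{\partial}{\partial x^i}-G^k_i\frac{\partial}{\partial y^k}\big)$, and a vector field $V(t)$ along a curve $c(t)$ in $M$ is parallel if $\dot V^i+G^i_j(c,V)\dot c^j=0$. Let $\mathcal I_pM=\{y\in T_pM:\mathcal F(y)=1\}$ be the indicatrix at $p$ and $\mathcal IM=\{v\in TM:\mathcal F(v)=1\}$ the indicatrix bundle, a submanifold of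 $TM$. Let $1\le r\le\infty$. The holonomy group $\mathsf{Hol}(p)$ is the group of transformations of $\mathcal I_pM$ generated by parallel translations along piecewise $C^r$ closed curves starting at $p$. The fibred holonomy group $\mathsf{Hol_f}(M)$ consists of the smooth diffeomorphisms $\Phi$ of $\mathcal IM$ that map each $\mathcal I_pM$ to itself and satisfy $\Phi|_{\mathcal I_pM}\in\mathsf{Hol}(p)$ for all $p\in M$. The fibred holonomy algebra $\mathfrak{hol_f}(M)$ is the smallest real Lie algebra of smooth vector fields on $\mathcal IM$ that contains all curvature vector fields $r(X,Y)=v[X^h,Y^h]|_{\mathcal IM}$ ($X,Y$ smooth vector fields on $M$; $v$ the projection onto the vertical subspace along the horizontal one) and contains, with each $\xi$, its horizontal Berwald covariant derivatives $\nabla_X\xi=[X^h,\xi]$ for all smooth vector fields $X$ on $M$. **Theorem.** If $M$ is diffeomorphic to $\mathbb R^n$, then $\mathfrak{hol_f}(M)$ is tangent to $\mathsf{Hol_f}(M)$: for every $\xi\in\mathfrak{hol_f}(M)$ there are $\varepsilon>0$ and a $C^1$-differentiable family $\{\phi_t\}_{t\in(-\varepsilon,\varepsilon)}$ of elements of $\mathsf{Hol_f}(M)$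 with $\phi_0=\mathrm{Id}$ and $\frac{\partial\phi_t}{\partial t}\big|_{t=0}=\xi$. -/

import Mathlib

open Set
open scoped Manifold ContDiff

-- A model space is always considered with its standard structure of manifold.
attribute [local instance 10000] chartedSpaceSelf

/-- The second directional derivative `∂²/∂s∂t` at `s = t = 0` of `½ f(y + s u + t v)²`. -/
noncomputable def halfSqHessian {V : Type*} [AddCommGroup V] [Module ℝ V] (f : V → ℝ)
    (y u v : V) : ℝ :=
  (1 / 2) * deriv (fun s : ℝ => deriv (fun t : ℝ => f (y + s • u + t • v) ^ 2) 0) 0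

section LocalCoordinates

/-! ### Coordinate expressions

`L (x, y)` is the expression of a Finsler function in induced coordinates `(xⁱ, yⁱ)` of the
tangent bundle. -/

variable {n : ℕ}

/-- The `i`-th coordinate vector of `ℝⁿ`. -/
noncomputable def coordVec (i : Fin n) : EuclideanSpace ℝ (Fin n) := EuclideanSpace.single i 1

/-- The matrix `g_{ij}(x, y)` of the Finsler metric. -/
noncomputable def metricMatrix (L : EuclideanSpace ℝ (Fin n) × EuclideanSpace ℝ (Fin n) → ℝ)
    (x y : EuclideanSpace ℝ (Fin n)) : Matrix (Fin n) (Fin n) ℝ :=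
  fun i j => halfSqHessian (fun z => L (x, z)) y (coordVec i) (coordVec j)

/-- The partial derivative `∂g_{ij}/∂xᵏ (x, y)`. -/
noncomputable def metricMatrixDeriv
    (L : EuclideanSpace ℝ (Fin n) × EuclideanSpace ℝ (Fin n) → ℝ)
    (x y : EuclideanSpace ℝ (Fin n)) (i j k : Fin n) : ℝ :=
  deriv (fun t : ℝ => metricMatrix L (x + t • coordVec k) y i j) 0

/-- The geodesic coefficients
`Gⁱ = ¼ gⁱˡ (2 ∂g_{jl}/∂xᵏ - ∂g_{jk}/∂xˡ) yʲ yᵏ`. -/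
noncomputable def geodesicCoeff (L : EuclideanSpace ℝ (Fin n) × EuclideanSpace ℝ (Fin n) → ℝ)
    (x y : EuclideanSpace ℝ (Fin n)) (i : Fin n) : ℝ :=
  (1 / 4) * ∑ l, ∑ j, ∑ k, (metricMatrix L x y)⁻¹ i l *
    (2 * metricMatrixDeriv L x y j l k - metricMatrixDeriv L x y j k l) * y j * y k

/-- The connection coefficients `Gⁱ_j = ∂Gⁱ/∂yʲ`. -/
noncomputable def connectionCoeff (L : EuclideanSpace ℝ (Fin n) × EuclideanSpace ℝ (Fin n) → ℝ)
    (x y : EuclideanSpace ℝ (Fin n)) (i j : Fin n) : ℝ :=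
  deriv (fun t : ℝ => geodesicCoeff L x (y + t • coordVec j) i) 0

end LocalCoordinates

/-- A Finsler function on an `n`-dimensional smooth manifold `M`. -/
structure FinslerFunction (n : ℕ) (M : Type*) [TopologicalSpace M]
    [ChartedSpace (EuclideanSpace ℝ (Fin n)) M] [IsManifold (𝓡 n) ∞ M] where
  /-- the underlying function on the tangent bundle -/
  toFun : TangentBundle (𝓡 n) M → ℝ
  continuous' : Continuous toFun
  smooth' : ContMDiffOn (𝓡 n).tangent 𝓘(ℝ, ℝ) ∞ toFun {v | v.2 ≠ 0}
  homogeneous' : ∀ (x : M) (y : TangentSpace (𝓡 n) x) (a : ℝ), 0 < a →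
    toFun ⟨x, a • y⟩ = a * toFun ⟨x, y⟩
  posDef' : ∀ (x : M) (y u : TangentSpace (𝓡 n) x), y ≠ 0 → u ≠ 0 →
    0 < halfSqHessian (fun z : TangentSpace (𝓡 n) x => toFun ⟨x, z⟩) y u u

namespace FinslerFunction

variable {n : ℕ} {M : Type*} [TopologicalSpace M]
  [ChartedSpace (EuclideanSpace ℝ (Fin n)) M] [IsManifold (𝓡 n) ∞ M]
  (F : FinslerFunction n M)

/-! ### Horizontal lift, parallel translation -/

/-- The components `(dxⁱ)` of a vector tangent to `M` at `x`, with respect to the preferred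
coordinate system around `x`. -/
def baseComponents (x : M) : TangentSpace (𝓡 n) x ≃L[ℝ] EuclideanSpace ℝ (Fin n) :=
  ContinuousLinearEquiv.refl ℝ (EuclideanSpace ℝ (Fin n))

/-- The components `(dxⁱ, dyⁱ)` of a vector tangent to `TM` at `v`, with respect to the coordinate
system of `TM` around `v` induced by the preferred one of `M` around the foot point of `v`. -/
def bundleComponents (v : TangentBundle (𝓡 n) M) :
    TangentSpace (𝓡 n).tangent v ≃L[ℝ] EuclideanSpace ℝ (Fin n) × EuclideanSpace ℝ (Fin n) :=
  ContinuousLinearEquiv.refl ℝ (EuclideanSpace ℝ (Fin n) × EuclideanSpace ℝ (Fin n))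

/-- The expression of `F` in the induced coordinate system of `TM` around `v`. -/
noncomputable def localExpr (v : TangentBundle (𝓡 n) M) :
    EuclideanSpace ℝ (Fin n) × EuclideanSpace ℝ (Fin n) → ℝ :=
  fun z => F.toFun ((extChartAt (𝓡 n).tangent v).symm z)

/-- The horizontal lift `wʰ = wⁱ (∂/∂xⁱ - Gᵏ_i ∂/∂yᵏ)` at `v ∈ TM` of a vector `w` tangent to `M`
at the foot point of `v`, in the induced coordinate system around `v`. -/
noncomputable def horizontalLift (v : TangentBundle (𝓡 n) M) (w : TangentSpace (𝓡 n) v.proj) :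
    TangentSpace (𝓡 n).tangent v :=
  (bundleComponents v).symm
    (baseComponents v.proj w,
      WithLp.toLp 2 fun k => - ∑ i, connectionCoeff (F.localExpr v)
        (extChartAt (𝓡 n).tangent v v).1 (extChartAt (𝓡 n).tangent v v).2 k i *
          baseComponents v.proj w i)

/-- The horizontal lift `Xʰ` of a vector field `X` on `M`. -/
noncomputable def horizontalField (X : ∀ x : M, TangentSpace (𝓡 n) x)
    (v : TangentBundle (𝓡 n) M) : TangentSpace (𝓡 n).tangent v :=
  F.horizontalLift v (X v.proj)

/-- The projection of a vector tangent to `TM` at `v` onto the vertical subspace, along the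
horizontal subspace. -/
noncomputable def verticalPart (v : TangentBundle (𝓡 n) M)
    (w : TangentSpace (𝓡 n).tangent v) : TangentSpace (𝓡 n).tangent v :=
  w - F.horizontalLift v
    (mfderiv (𝓡 n).tangent (𝓡 n) (fun u : TangentBundle (𝓡 n) M => u.proj) v w)

/-- `V : [0,1] → TM`, a vector field along the curve `c = π ∘ V` of `M`, is parallel: its velocity
is the horizontal lift of the velocity of `c`. In induced coordinates this is
`dVⁱ/dt + Gⁱ_j(c, V) dcʲ/dt = 0`. -/
def IsParallel (V : ℝ → TangentBundle (𝓡 n) M) : Prop :=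
  ∀ t ∈ Icc (0 : ℝ) 1,
    HasMFDerivWithinAt 𝓘(ℝ, ℝ) (𝓡 n).tangent V (Icc 0 1) t
      ((1 : ℝ →L[ℝ] ℝ).smulRight (F.horizontalLift (V t)
        (mfderivWithin 𝓘(ℝ, ℝ) (𝓡 n) (fun s => (V s).proj) (Icc 0 1) t (1 : ℝ))))

/-- The indicatrix `{y ∈ T_pM ; F(y) = 1}`. -/
def indicatrix (p : M) : Set (TangentSpace (𝓡 n) p) := {y | F.toFun ⟨p, y⟩ = 1}

/-- The bijection `τ` of the indicatrix at `p` onto the one at `q` is the parallel translation along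
an arc of class `C^r` from `p` to `q`. -/
def IsArcTranslation (r : ℕ∞) (p q : M) (τ : F.indicatrix p ≃ F.indicatrix q) : Prop :=
  ∃ c : ℝ → M, ContMDiffOn 𝓘(ℝ, ℝ) (𝓡 n) r c (Icc 0 1) ∧ c 0 = p ∧ c 1 = q ∧
    ∀ y : F.indicatrix p, ∃ V : ℝ → TangentBundle (𝓡 n) M,
      (∀ t ∈ Icc (0 : ℝ) 1, (V t).proj = c t) ∧ F.IsParallel V ∧
        V 0 = ⟨p, y.1⟩ ∧ V 1 = ⟨q, (τ y).1⟩

/-- `τ` is the parallel translation along a piecewise `C^r` curve from `p` to `q`, i.e. along a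
finite succession of arcs of class `C^r`. -/
inductive IsParallelTranslation (r : ℕ∞) :
    (p q : M) → (F.indicatrix p ≃ F.indicatrix q) → Prop
  | refl (p : M) : IsParallelTranslation r p p (Equiv.refl _)
  | cons {p q s : M} {τ : F.indicatrix p ≃ F.indicatrix q}
      {σ : F.indicatrix q ≃ F.indicatrix s} :
      F.IsArcTranslation r p q τ → IsParallelTranslation r q s σ →
        IsParallelTranslation r p s (τ.trans σ)

/-- The holonomy group at `p`: the group of transformations of the indicatrix at `p` generated by
the parallel translations along piecewise `C^r` closed curves initiated at `p`. -/
def holonomyGroup (r : ℕ∞) (p : M) : Subgroup (Equiv.Perm (F.indicatrix p)) :=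
  Subgroup.closure {τ | F.IsParallelTranslation r p p τ}

/-! ### Diffeomorphisms and vector fields of the indicatrix bundle

The indicatrix bundle is an embedded submanifold of `TM`. A map defined on it is smooth if it is
smooth as a map on a subset of the manifold `TM`. -/

/-- The indicatrix bundle `{v ∈ TM ; F(v) = 1}`. -/
def indicatrixBundle : Set (TangentBundle (𝓡 n) M) := {v | F.toFun v = 1}

/-- The group of smooth diffeomorphisms of the indicatrix bundle. -/
def diffeomorphismGroup : Subgroup (Equiv.Perm F.indicatrixBundle) where
  carrier := {Φ |
    (∃ f : TangentBundle (𝓡 n) M → TangentBundle (𝓡 n) M,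
      ContMDiffOn (𝓡 n).tangent (𝓡 n).tangent ∞ f F.indicatrixBundle ∧
        ∀ v : F.indicatrixBundle, f v = Φ v) ∧
    (∃ f : TangentBundle (𝓡 n) M → TangentBundle (𝓡 n) M,
      ContMDiffOn (𝓡 n).tangent (𝓡 n).tangent ∞ f F.indicatrixBundle ∧
        ∀ v : F.indicatrixBundle, f v = Φ⁻¹ v)}
  one_mem' := ⟨⟨id, contMDiffOn_id, fun _ => rfl⟩, ⟨id, contMDiffOn_id, fun _ => rfl⟩⟩
  mul_mem' := by
    rintro Φ Ψ ⟨⟨f, hf, hfΦ⟩, ⟨f', hf', hfΦ'⟩⟩ ⟨⟨g, hg, hgΨ⟩, ⟨g', hg', hgΨ'⟩⟩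
    refine ⟨⟨f ∘ g, hf.comp hg fun v hv => ?_, fun v => ?_⟩,
      ⟨g' ∘ f', hg'.comp hf' fun v hv => ?_, fun v => ?_⟩⟩
    · have h := hgΨ ⟨v, hv⟩
      simp only at h
      rw [mem_preimage, h]
      exact (Ψ ⟨v, hv⟩).2
    · rw [Function.comp_apply, hgΨ, hfΦ, Equiv.Perm.mul_apply]
    · have h := hfΦ' ⟨v, hv⟩
      simp only at h
      rw [mem_preimage, h]
      exact (Φ⁻¹ ⟨v, hv⟩).2
    · rw [Function.comp_apply, hfΦ', hgΨ', mul_inv_rev, Equiv.Perm.mul_apply]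
  inv_mem' := by
    rintro Φ ⟨h, h'⟩
    exact ⟨h', by simpa using h⟩

/-- The fibred holonomy group: the diffeomorphisms of the indicatrix bundle that map every
indicatrix to itself, by an element of the holonomy group. -/
def fibredHolonomyGroup (r : ℕ∞) : Subgroup (Equiv.Perm F.indicatrixBundle) where
  carrier := {Φ | Φ ∈ F.diffeomorphismGroup ∧ ∀ p : M, ∃ φ ∈ F.holonomyGroup r p,
    ∀ y : F.indicatrix p,
      (Φ ⟨⟨p, y.1⟩, y.2⟩ : TangentBundle (𝓡 n) M) = ⟨p, (φ y).1⟩}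
  one_mem' := ⟨one_mem _, fun p => ⟨1, one_mem _, fun _ => rfl⟩⟩
  mul_mem' := by
    rintro Φ Ψ ⟨hΦ, hΦ'⟩ ⟨hΨ, hΨ'⟩
    refine ⟨mul_mem hΦ hΨ, fun p => ?_⟩
    obtain ⟨φ, hφ, h⟩ := hΦ' p
    obtain ⟨ψ, hψ, h'⟩ := hΨ' p
    refine ⟨φ * ψ, mul_mem hφ hψ, fun y => ?_⟩
    have e : Ψ ⟨⟨p, y.1⟩, y.2⟩ = ⟨⟨p, (ψ y).1⟩, (ψ y).2⟩ := Subtype.ext (h' y)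
    rw [Equiv.Perm.mul_apply, e, h, Equiv.Perm.mul_apply]
  inv_mem' := by
    rintro Φ ⟨hΦ, hΦ'⟩
    refine ⟨inv_mem hΦ, fun p => ?_⟩
    obtain ⟨φ, hφ, h⟩ := hΦ' p
    refine ⟨φ⁻¹, inv_mem hφ, fun y => ?_⟩
    have e : Φ ⟨⟨p, (φ⁻¹ y).1⟩, (φ⁻¹ y).2⟩ = ⟨⟨p, y.1⟩, y.2⟩ :=
      Subtype.ext (by rw [h]; simp)
    rw [← e]
    simp

/-- Not necessarily smooth or tangent sections of the tangent bundle of `TM` over the indicatrix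
bundle. -/
abbrev FieldAlong : Type _ :=
  ∀ v : F.indicatrixBundle, TangentSpace (𝓡 n).tangent (v : TangentBundle (𝓡 n) M)

/-- The vector space of smooth vector fields on the indicatrix bundle; the tangent space of the
level set `F = 1` at `v` is the kernel of `dF`. -/
def vectorFields : Submodule ℝ F.FieldAlong where
  carrier := {ξ |
    (∃ Z : ∀ v : TangentBundle (𝓡 n) M, TangentSpace (𝓡 n).tangent v,
      ContMDiffOn (𝓡 n).tangent (𝓡 n).tangent.tangent ∞
        (fun v => (⟨v, Z v⟩ : TangentBundle (𝓡 n).tangent (TangentBundle (𝓡 n) M)))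
        F.indicatrixBundle ∧ ∀ v : F.indicatrixBundle, Z v = ξ v) ∧
    ∀ v : F.indicatrixBundle, mfderiv (𝓡 n).tangent 𝓘(ℝ, ℝ) F.toFun v (ξ v) = 0}
  zero_mem' := by
    refine ⟨⟨fun v => 0, ?_, fun v => rfl⟩, fun v => map_zero _⟩
    exact (Bundle.contMDiff_zeroSection ℝ _).contMDiffOn
  add_mem' := by
    rintro ξ η ⟨⟨Z, hZ, hZξ⟩, hξ⟩ ⟨⟨W, hW, hWη⟩, hη⟩
    refine ⟨⟨fun v => Z v + W v, hZ.add_section hW, fun v => ?_⟩, fun v => ?_⟩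
    · simp only [hZξ, hWη, Pi.add_apply]
    · rw [Pi.add_apply, map_add, hξ, hη, add_zero]
  smul_mem' := by
    rintro a ξ ⟨⟨Z, hZ, hZξ⟩, hξ⟩
    refine ⟨⟨fun v => a • Z v, hZ.const_smul_section, fun v => ?_⟩, fun v => ?_⟩
    · simp only [hZξ, Pi.smul_apply]
    · rw [Pi.smul_apply, map_smul, hξ, smul_zero]

open Classical in
/-- The extension of a vector field `ξ` on the indicatrix bundle to a vector field on the open set
`F > 0` of `TM` that is invariant under the dilations `y ↦ a y`, `a > 0`, of the fibres: at `v` it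
is the image of the value of `ξ` at `v / F(v)` under the differential of the dilation by `F(v)`,
which in induced coordinates is `(dx, dy) ↦ (dx, F(v) dy)`. -/
noncomputable def homogeneousExtension (ξ : F.FieldAlong) (v : TangentBundle (𝓡 n) M) :
    TangentSpace (𝓡 n).tangent v :=
  if h : F.toFun ⟨v.proj, (F.toFun v)⁻¹ • v.2⟩ = 1 then
    (bundleComponents v).symm
      ((bundleComponents _ (ξ ⟨⟨v.proj, (F.toFun v)⁻¹ • v.2⟩, h⟩)).1,
        F.toFun v • (bundleComponents _ (ξ ⟨⟨v.proj, (F.toFun v)⁻¹ • v.2⟩, h⟩)).2)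
  else 0

/-- The homogeneous extension does extend. -/
theorem homogeneousExtension_apply (ξ : F.FieldAlong) (v : F.indicatrixBundle) :
    F.homogeneousExtension ξ v = ξ v := by
  obtain ⟨⟨p, y⟩, hv⟩ := v
  have h1 : F.toFun ⟨p, y⟩ = 1 := hv
  have key : ∀ (a : ℝ) (_ : a = 1) (h : F.toFun ⟨p, a⁻¹ • y⟩ = 1),
      (bundleComponents (⟨p, y⟩ : TangentBundle (𝓡 n) M)).symm
        ((bundleComponents _ (ξ ⟨⟨p, a⁻¹ • y⟩, h⟩)).1,
          a • (bundleComponents _ (ξ ⟨⟨p, a⁻¹ • y⟩, h⟩)).2) = ξ ⟨⟨p, y⟩, hv⟩ := by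
    rintro a rfl h
    have key' : ∀ (z : TangentSpace (𝓡 n) p) (hz : F.toFun ⟨p, z⟩ = 1), z = y →
        (bundleComponents (⟨p, y⟩ : TangentBundle (𝓡 n) M)).symm
          (bundleComponents _ (ξ ⟨⟨p, z⟩, hz⟩)) = ξ ⟨⟨p, y⟩, hv⟩ := by
      rintro z hz rfl
      simp
    rw [one_smul, Prod.mk.eta]
    exact key' _ h (by simp)
  have h3 : F.toFun ⟨p, (F.toFun ⟨p, y⟩)⁻¹ • y⟩ = 1 := by simp [h1]
  exact (dif_pos h3).trans (key _ h1 h3)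

/-- The Lie bracket of vector fields on the submanifold `F = 1` of `TM`: the restriction of the
Lie bracket of extensions to an open neighbourhood. -/
noncomputable def bracket (ξ η : F.FieldAlong) : F.FieldAlong := fun v =>
  VectorField.mlieBracket (𝓡 n).tangent (F.homogeneousExtension ξ) (F.homogeneousExtension η) v

/-! ### Curvature, Berwald derivative, fibred holonomy algebra -/

/-- Smoothness of a vector field on `M`. -/
def IsSmoothField (X : ∀ x : M, TangentSpace (𝓡 n) x) : Prop :=
  ContMDiff (𝓡 n) (𝓡 n).tangent ∞ (fun x => (⟨x, X x⟩ : TangentBundle (𝓡 n) M))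

/-- The curvature vector field `r(X, Y) = v[Xʰ, Yʰ]` on the indicatrix bundle. -/
noncomputable def curvatureField (X Y : ∀ x : M, TangentSpace (𝓡 n) x) : F.FieldAlong := fun v =>
  F.verticalPart v
    (VectorField.mlieBracket (𝓡 n).tangent (F.horizontalField X) (F.horizontalField Y) v)

/-- The horizontal Berwald covariant derivative `∇_X ξ = [Xʰ, ξ]`. -/
noncomputable def berwaldDerivative (X : ∀ x : M, TangentSpace (𝓡 n) x) (ξ : F.FieldAlong) :
    F.FieldAlong := fun v =>
  VectorField.mlieBracket (𝓡 n).tangent (F.horizontalField X) (F.homogeneousExtension ξ) v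

/-- `𝔤` is a Lie algebra of vector fields on the indicatrix bundle that contains the curvature
vector fields and is closed under horizontal Berwald covariant derivatives. -/
structure IsBerwaldClosed (𝔤 : Submodule ℝ F.FieldAlong) : Prop where
  le_vectorFields : 𝔤 ≤ F.vectorFields
  bracket_mem : ∀ ξ ∈ 𝔤, ∀ η ∈ 𝔤, F.bracket ξ η ∈ 𝔤
  curvature_mem : ∀ X Y : (∀ x : M, TangentSpace (𝓡 n) x), IsSmoothField X → IsSmoothField Y →
    F.curvatureField X Y ∈ 𝔤
  berwald_mem : ∀ ξ ∈ 𝔤, ∀ X : (∀ x : M, TangentSpace (𝓡 n) x), IsSmoothField X →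
    F.berwaldDerivative X ξ ∈ 𝔤

/-- The fibred holonomy algebra: the smallest Lie algebra of vector fields on the indicatrix bundle
that contains the curvature vector fields and is closed under horizontal Berwald covariant
derivatives. -/
noncomputable def fibredHolonomyAlgebra : Submodule ℝ F.FieldAlong :=
  sInf {𝔤 | F.IsBerwaldClosed 𝔤}

/-! ### Tangency -/

/-- The vector field `ξ` on the indicatrix bundle is tangent to the group `H` of transformations:
there is a family `φ_t ∈ H`, `-ε < t < ε`, of class `C¹` in `(t, v)`, with `φ_0 = id` and
`∂φ_t/∂t = ξ` at `t = 0`. -/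
def IsTangentField (H : Subgroup (Equiv.Perm F.indicatrixBundle)) (ξ : F.FieldAlong) : Prop :=
  ∃ ε : ℝ, 0 < ε ∧ ∃ φ : ℝ → Equiv.Perm F.indicatrixBundle,
    (∀ t ∈ Ioo (-ε) ε, φ t ∈ H) ∧
    (∃ f : ℝ × TangentBundle (𝓡 n) M → TangentBundle (𝓡 n) M,
      ContMDiffOn (𝓘(ℝ, ℝ).prod (𝓡 n).tangent) (𝓡 n).tangent 1 f
        (Ioo (-ε) ε ×ˢ F.indicatrixBundle) ∧
      ∀ t ∈ Ioo (-ε) ε, ∀ v : F.indicatrixBundle, f (t, v) = φ t v) ∧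
    φ 0 = 1 ∧
    ∀ v : F.indicatrixBundle,
      HasMFDerivAt 𝓘(ℝ, ℝ) (𝓡 n).tangent (fun t : ℝ => (φ t v : TangentBundle (𝓡 n) M)) 0
        ((1 : ℝ →L[ℝ] ℝ).smulRight (ξ v))

/-- A Lie algebra of vector fields on the indicatrix bundle is tangent to `H` if all its elements
are. -/
def IsTangentAlgebra (H : Subgroup (Equiv.Perm F.indicatrixBundle))
    (𝔤 : Submodule ℝ F.FieldAlong) : Prop :=
  ∀ ξ ∈ 𝔤, F.IsTangentField H ξ

end FinslerFunction

/-! The diffeomorphism with `ℝⁿ` identifies `TM` with `ℝⁿ × ℝⁿ`, where straight segments and closed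
parallelograms are available over all foot points at once. Parallel translation along segments gives
maps `(x, y) ↦ (x + s a, y')`, smooth in all data off the zero section, whose derivative at `s = 0`
is the horizontal lift of the constant field `a`.

Call `ζ` a holonomy field if it is the leading term of a smooth family `Φ_s` of fibred holonomy
transformations, `Φ_s(z) = z + s^k ζ(z) + o(s^k)` for some `k ≥ 1`. The order `k` is left free,
because the operations of the holonomy algebra change it: - sums: `Φ_{s^l} ∘ Φ'_{s^k}` has order
`kl` and leading term `ζ + ζ'`; multiples come from rescaling `s` and from inverse families; -
brackets: the group commutator of families of orders `k` and `l` has order `k + l` and leading term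
the Lie bracket (`LocalFamily.isLittleO_commutator`); - curvature: translation around the
parallelogram with sides `sX(x)`, `sY(x)` is a commutator of order two. The directions are frozen at
the starting point `x`, so the parallelogram closes; as the vertical part of `[Xʰ, Yʰ]` is tensorial
in `X` and `Y`, freezing does not alter the leading term; - Berwald derivative: the commutator of
`Φ_s` with the translation along `sX(x)` is the product of the inverse of `Φ_s` with a conjugate of
`Φ_s`, hence again fibred holonomy; it has order `k + 1` and leading term `[Xʰ, ζ]`, which is
tensorial in `X` because `ζ` is vertical.

Hence the holonomy fields form a Lie algebra of the kind over which the fibred holonomy algebra is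
minimal (`isBerwaldClosed_holonomyFields`). Each of them is tangent to the group: put `s =
|t|^(1/k)`, with the inverse family for `t < 0`. In `z + t m(|t|^(1/k), z)` the factor `t` absorbs
the singularity of the root, so the family is `C¹` in `(t, z)` with velocity `ζ` at `t = 0`
(`LocalFamily.contDiffOn_rootFamily`).

Two analytic ingredients support this. Smoothness of parallel translation is smooth dependence of a
flow on its initial point, obtained from the implicit function theorem in a space of paths;
completeness comes from homogeneity of the connection. Coordinate independence of the horizontal
lift follows from the Euler-Lagrange form of the geodesic coefficients, which also shows that
translations preserve the Finsler function. -/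

open scoped Topology
set_option linter.unusedSectionVars false

/-! ### Superposition operators on spaces of continuous maps -/

section Nemytskii

variable {K : Type*} [TopologicalSpace K] [CompactSpace K]
  {V W : Type*} [NormedAddCommGroup V] [NormedSpace ℝ V] [NormedAddCommGroup W] [NormedSpace ℝ W]

open Classical in
/-- The Nemytskii (superposition) operator `u ↦ f ∘ u` on continuous maps. -/
noncomputable def nemytskii (K : Type*) [TopologicalSpace K] (f : V → W) (u : C(K, V)) : C(K, W) :=
  if h : Continuous (f ∘ u) then ⟨f ∘ u, h⟩ else 0

theorem nemytskii_apply {f : V → W} {Ω : Set V} (hf : ContinuousOn f Ω) {u : C(K, V)}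
    (hu : ∀ t, u t ∈ Ω) (t : K) : nemytskii K f u t = f (u t) := by
  have h : Continuous (f ∘ u) := hf.comp_continuous u.continuous hu
  rw [nemytskii, dif_pos h]
  rfl

/-- The operator `(a, v) ↦ (t ↦ B (a t) (v t))` on continuous maps induced by a bilinear map. -/
noncomputable def pointwiseBilinear (K : Type*) [TopologicalSpace K] [CompactSpace K]
    {A V W : Type*} [NormedAddCommGroup A] [NormedSpace ℝ A] [NormedAddCommGroup V]
    [NormedSpace ℝ V] [NormedAddCommGroup W] [NormedSpace ℝ W] (B : A →L[ℝ] V →L[ℝ] W) :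
    C(K, A) →L[ℝ] C(K, V) →L[ℝ] C(K, W) :=
  LinearMap.mkContinuous₂
    (LinearMap.mk₂ ℝ (fun (a : C(K, A)) (v : C(K, V)) =>
      (⟨fun t => B (a t) (v t), by fun_prop⟩ : C(K, W)))
      (fun _ _ _ => by ext; simp) (fun _ _ _ => by ext; simp) (fun _ _ _ => by ext; simp)
      (fun _ _ _ => by ext; simp)) ‖B‖ (fun a v => by
      refine (ContinuousMap.norm_le _ (by positivity)).2 fun t => ?_
      exact (B.le_opNorm₂ _ _).trans (by
        gcongr
        exacts [a.norm_coe_le_norm t, v.norm_coe_le_norm t]))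

@[simp]
theorem pointwiseBilinear_apply {A : Type*} [NormedAddCommGroup A] [NormedSpace ℝ A]
    (B : A →L[ℝ] V →L[ℝ] W) (a : C(K, A)) (v : C(K, V)) (t : K) :
    pointwiseBilinear K B a v t = B (a t) (v t) := rfl

theorem contDiffOn_pointwiseBilinear {A X : Type*} [NormedAddCommGroup A] [NormedSpace ℝ A]
    [NormedAddCommGroup X] [NormedSpace ℝ X] (B : A →L[ℝ] V →L[ℝ] W) {g : X → C(K, A)} {S : Set X}
    {m : ℕ∞ω} (hg : ContDiffOn ℝ m g S) : ContDiffOn ℝ m (fun x => pointwiseBilinear K B (g x)) S :=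
  (pointwiseBilinear K B).contDiff.comp_contDiffOn hg

theorem isOpen_setOf_forall_mem {Ω : Set V} (hΩ : IsOpen Ω) :
    IsOpen {u : C(K, V) | ∀ t, u t ∈ Ω} := by
  have := ContinuousMap.isOpen_setOfPred_mapsTo (X := K) (Y := V) isCompact_univ hΩ
  simpa [MapsTo] using this

/-- The range of `u` is compact, so the continuity of `fderiv ℝ f` at its points is uniform. The
mean value inequality on a ball about each `u t` then bounds the remainder by `c * ‖h‖`, with one
radius for all `t`. -/
theorem hasFDerivAt_nemytskii {f : V → W} {Ω : Set V} (hΩ : IsOpen Ω) (hf : ContDiffOn ℝ 1 f Ω)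
    {u : C(K, V)} (hu : ∀ t, u t ∈ Ω) :
    HasFDerivAt (nemytskii K f) (pointwiseBilinear K (ContinuousLinearMap.id ℝ (V →L[ℝ] W)) (nemytskii K (fderiv ℝ f) u)) u := by
  have hf' : ContinuousOn (fderiv ℝ f) Ω := hf.continuousOn_fderiv_of_isOpen hΩ le_rfl
  have hc : IsCompact (range u) := isCompact_range u.continuous
  have hsub : range u ⊆ Ω := by rintro _ ⟨t, rfl⟩; exact hu t
  rw [hasFDerivAt_iff_isLittleO_nhds_zero, Asymptotics.isLittleO_iff]
  intro c hc0
  obtain ⟨δ₁, hδ₁, h1⟩ := Metric.mem_uniformity_dist.1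
    (hc.uniformContinuousAt_of_continuousAt (fderiv ℝ f)
      (fun x hx => hf'.continuousAt (hΩ.mem_nhds (hsub hx))) (Metric.dist_mem_uniformity hc0))
  obtain ⟨δ₂, hδ₂, h2⟩ := hc.exists_thickening_subset_open hΩ hsub
  have hmem : ∀ᶠ h in 𝓝 (0 : C(K, V)), ‖h‖ < min δ₁ δ₂ := by
    have := Metric.ball_mem_nhds (0 : C(K, V)) (lt_min hδ₁ hδ₂)
    filter_upwards [this] with h hh
    simpa using hh
  filter_upwards [hmem] with h hh
  have hball : ∀ t, ∀ x ∈ Metric.ball (u t) (min δ₁ δ₂), x ∈ Ω := fun t x hx =>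
    h2 (Metric.mem_thickening_iff.2 ⟨u t, mem_range_self t,
      (Metric.mem_ball.1 hx).trans_le (min_le_right _ _)⟩)
  have hht : ∀ t, ‖h t‖ < min δ₁ δ₂ := fun t => (h.norm_coe_le_norm t).trans_lt hh
  have hmem2 : ∀ t, u t + h t ∈ Metric.ball (u t) (min δ₁ δ₂) := fun t => by
    simpa using hht t
  rw [ContinuousMap.norm_le _ (by positivity)]
  intro t
  have e1 : nemytskii K f (u + h) t = f (u t + h t) :=
    nemytskii_apply hf.continuousOn (fun t => hball t _ (hmem2 t)) t
  have e2 := nemytskii_apply hf.continuousOn hu t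
  have e3 := nemytskii_apply hf' hu t
  simp only [ContinuousMap.sub_apply, pointwiseBilinear_apply, ContinuousLinearMap.id_apply, e1, e2, e3]
  have hpos : 0 < min δ₁ δ₂ := lt_min hδ₁ hδ₂
  have key := (convex_ball (u t) (min δ₁ δ₂)).norm_image_sub_le_of_norm_hasFDerivWithin_le'
    (f := f) (f' := fderiv ℝ f) (φ := fderiv ℝ f (u t)) (C := c) (x := u t) (y := u t + h t)
    (fun x hx => ((hf.differentiableOn one_ne_zero).differentiableAt
      (hΩ.mem_nhds (hball t x hx))).hasFDerivAt.hasFDerivWithinAt)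
    (fun x hx => by
      have := h1 (a := u t) (b := x) ?_ (mem_range_self t)
      · have h3 : dist (fderiv ℝ f (u t)) (fderiv ℝ f x) < c := this
        rw [dist_comm, dist_eq_norm] at h3
        exact h3.le
      · rw [dist_comm]
        exact (Metric.mem_ball.1 hx).trans_le (min_le_left _ _))
    (Metric.mem_ball_self hpos) (hmem2 t)
  rw [add_sub_cancel_left] at key
  exact key.trans (mul_le_mul_of_nonneg_left (h.norm_coe_le_norm t) hc0.le)

end Nemytskii

section

universe u

variable {K : Type*} [TopologicalSpace K] [CompactSpace K]
  {V : Type u} [NormedAddCommGroup V] [NormedSpace ℝ V]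

/-- The derivative of superposition with `f` is superposition with `fderiv ℝ f` followed by a fixed
bounded linear operator, so differentiability is gained by induction. The induction replaces `W` by
`V →L[ℝ] W`, hence the quantification over `W` inside the statement. -/
theorem contDiffOn_nemytskii_nat {Ω : Set V} (hΩ : IsOpen Ω) (m : ℕ) :
    ∀ {W : Type u} [NormedAddCommGroup W] [NormedSpace ℝ W] {f : V → W},
      ContDiffOn ℝ ∞ f Ω → ContDiffOn ℝ m (nemytskii K f) {u : C(K, V) | ∀ t, u t ∈ Ω} := by
  induction m with
  | zero =>
    intro W _ _ f hf
    refine contDiffOn_zero.2 fun u hu => ?_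
    exact (hasFDerivAt_nemytskii hΩ (hf.of_le (by exact_mod_cast le_top))
      hu).continuousAt.continuousWithinAt
  | succ m ih =>
    intro W _ _ f hf
    have hd : ∀ u ∈ {u : C(K, V) | ∀ t, u t ∈ Ω}, HasFDerivAt (nemytskii K f)
        (pointwiseBilinear K (ContinuousLinearMap.id ℝ (V →L[ℝ] W)) (nemytskii K (fderiv ℝ f) u)) u := fun u hu =>
      hasFDerivAt_nemytskii hΩ (hf.of_le (by exact_mod_cast le_top)) hu
    have hS := isOpen_setOf_forall_mem (K := K) hΩ
    push_cast
    rw [contDiffOn_succ_iff_fderiv_of_isOpen hS]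
    refine ⟨fun u hu => (hd u hu).differentiableAt.differentiableWithinAt, by simp, ?_⟩
    have h2 := contDiffOn_pointwiseBilinear (ContinuousLinearMap.id ℝ (V →L[ℝ] W))
      (ih (W := V →L[ℝ] W) (hf.fderiv_of_isOpen hΩ (by simp)))
    exact h2.congr fun u hu => (hd u hu).fderiv

variable {W : Type u} [NormedAddCommGroup W] [NormedSpace ℝ W]

theorem contDiffOn_nemytskii {Ω : Set V} (hΩ : IsOpen Ω) {f : V → W} (hf : ContDiffOn ℝ ∞ f Ω) :
    ContDiffOn ℝ ∞ (nemytskii K f) {u : C(K, V) | ∀ t, u t ∈ Ω} :=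
  contDiffOn_infty.2 fun m => contDiffOn_nemytskii_nat hΩ m hf

end

/-! ### Integration as an operator on paths -/

section Volterra

open unitInterval

variable {V : Type*} [NormedAddCommGroup V] [NormedSpace ℝ V]

/-- The Volterra operator `g ↦ (t ↦ ∫₀ᵗ g)` on continuous maps of the unit interval. -/
noncomputable def volterra (V : Type*) [NormedAddCommGroup V] [NormedSpace ℝ V] :
    C(I, V) →L[ℝ] C(I, V) :=
  LinearMap.mkContinuous
    { toFun := fun g => ⟨fun t => ∫ τ in (0 : ℝ)..t, Set.IccExtend zero_le_one g τ, by
        have : Continuous fun t : ℝ => ∫ τ in (0 : ℝ)..t, Set.IccExtend zero_le_one g τ :=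
          intervalIntegral.continuous_primitive
            (fun a b => (g.continuous.Icc_extend').intervalIntegrable a b) 0
        exact this.comp continuous_subtype_val⟩
      map_add' := fun f g => by
        ext t
        simp only [ContinuousMap.coe_mk, ContinuousMap.add_apply]
        rw [← intervalIntegral.integral_add (f.continuous.Icc_extend'.intervalIntegrable _ _)
          (g.continuous.Icc_extend'.intervalIntegrable _ _)]
        rfl
      map_smul' := fun c g => by
        ext t
        simp only [ContinuousMap.coe_mk, ContinuousMap.smul_apply, RingHom.id_apply]
        rw [← intervalIntegral.integral_smul]
        rfl } 1 (fun g => by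
      refine (ContinuousMap.norm_le _ (by positivity)).2 fun t => ?_
      have := intervalIntegral.norm_integral_le_of_norm_le_const (a := 0) (b := (t : ℝ))
        (f := Set.IccExtend zero_le_one g) (C := ‖g‖) (fun x _ => g.norm_coe_le_norm _)
      refine this.trans ?_
      rw [mul_comm, sub_zero, abs_of_nonneg t.2.1]
      exact mul_le_mul_of_nonneg_right t.2.2 (norm_nonneg _))

theorem volterra_apply (g : C(I, V)) (t : I) :
    volterra V g t = ∫ τ in (0 : ℝ)..t, Set.IccExtend zero_le_one g τ := rfl

end Volterra

/-! ### Division of smooth functions by powers of the parameter -/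

section Hadamard

open unitInterval

universe u

variable {V W : Type u} [NormedAddCommGroup V] [NormedSpace ℝ V] [NormedAddCommGroup W]
  [NormedSpace ℝ W]

/-- The linear map `(s, z) ↦ (θ ↦ (θ s, z))`. -/
noncomputable def scaledPath (V : Type*) [NormedAddCommGroup V] [NormedSpace ℝ V] :
    ℝ × V →L[ℝ] C(I, ℝ × V) :=
  LinearMap.mkContinuous
    { toFun := fun p => ⟨fun θ => ((θ : ℝ) * p.1, p.2), by fun_prop⟩
      map_add' := fun p q => by ext t <;> simp [mul_add]
      map_smul' := fun c p => by ext t <;> simp [mul_left_comm] } 1 (fun p => by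
      refine (ContinuousMap.norm_le _ (by positivity)).2 fun t => ?_
      rw [one_mul]
      refine max_le ?_ (norm_snd_le p)
      refine le_trans ?_ (norm_fst_le p)
      change ‖(t : ℝ) * p.1‖ ≤ _
      rw [norm_mul, Real.norm_of_nonneg t.2.1]
      exact mul_le_of_le_one_left (norm_nonneg _) t.2.2)

theorem scaledPath_apply (p : ℝ × V) (θ : I) : scaledPath V p θ = ((θ : ℝ) * p.1, p.2) := rfl

variable [CompleteSpace W]

/-- Hadamard's lemma: a smooth function `f (s, z)` vanishing for `s = 0` is divisible by `s`. -/
theorem exists_contDiffOn_smul_eq {Ω : Set V} (hΩ : IsOpen Ω) {f : ℝ × V → W}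
    (hf : ContDiffOn ℝ ∞ f (univ ×ˢ Ω)) (h0 : ∀ z ∈ Ω, f (0, z) = 0) :
    ∃ h : ℝ × V → W, ContDiffOn ℝ ∞ h (univ ×ˢ Ω) ∧ ∀ s, ∀ z ∈ Ω, f (s, z) = s • h (s, z) := by
  have hU : IsOpen ((univ : Set ℝ) ×ˢ Ω) := isOpen_univ.prod hΩ
  -- The quotient is `∫₀¹ ∂ₛf (θ s, z) dθ`. Written as a Volterra operator applied to a
  -- superposition operator and evaluated at time `1`, it is a composition of smooth maps.
  set f' : ℝ × V → W := fun p => fderiv ℝ f p (1, 0) with hf'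
  have hf's : ContDiffOn ℝ ∞ f' (univ ×ˢ Ω) :=
    (hf.fderiv_of_isOpen hU (by simp)).clm_apply contDiffOn_const
  have hmem : ∀ p ∈ (univ : Set ℝ) ×ˢ Ω, ∀ t : I, scaledPath V p t ∈ (univ : Set ℝ) ×ˢ Ω :=
    fun p hp t => ⟨mem_univ _, hp.2⟩
  refine ⟨fun p => volterra W (nemytskii I f' (scaledPath V p)) 1, ?_, fun s z hz => ?_⟩
  · have h1 : ContDiffOn ℝ ∞ (fun p => nemytskii I f' (scaledPath V p)) (univ ×ˢ Ω) :=
      (contDiffOn_nemytskii hU hf's).comp (scaledPath V).contDiff.contDiffOn hmem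
    have h2 : ContDiffOn ℝ ∞ (fun p => volterra W (nemytskii I f' (scaledPath V p)))
      (univ ×ˢ Ω) := (volterra W).contDiff.comp_contDiffOn h1
    exact (ContinuousMap.evalCLM ℝ (1 : I)).contDiff.comp_contDiffOn h2
  · have hd : ∀ θ : ℝ, HasDerivAt (fun θ : ℝ => f (θ * s, z)) (s • f' (θ * s, z)) θ := by
      intro θ
      have h1 : HasFDerivAt f (fderiv ℝ f (θ * s, z)) (θ * s, z) :=
        ((hf.differentiableOn (by simp)).differentiableAt
          (hU.mem_nhds ⟨mem_univ _, hz⟩)).hasFDerivAt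
      have h2 : HasDerivAt (fun θ : ℝ => (θ * s, z)) (s, (0 : V)) θ := by
        simpa using ((hasDerivAt_id θ).mul_const s).prodMk (hasDerivAt_const θ z)
      have h3 := h1.comp_hasDerivAt θ h2
      have h4 : ((s, 0) : ℝ × V) = s • ((1, 0) : ℝ × V) := by simp
      rw [h4, map_smul] at h3
      exact h3
    have hc : Continuous fun θ : ℝ => f' (θ * s, z) :=
      hf's.continuousOn.comp_continuous (by fun_prop) fun θ => ⟨mem_univ _, hz⟩
    have hi := intervalIntegral.integral_eq_sub_of_hasDerivAt (a := 0) (b := 1)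
      (fun θ _ => hd θ) ((hc.const_smul s).intervalIntegrable _ _)
    rw [intervalIntegral.integral_smul] at hi
    simp only [one_mul, zero_mul, h0 z hz, sub_zero] at hi
    rw [← hi]
    change _ = s • (volterra W (nemytskii I f' (scaledPath V (s, z))) 1)
    rw [volterra_apply]
    congr 1
    refine intervalIntegral.integral_congr fun θ hθ => ?_
    rw [uIcc_of_le (by simp)] at hθ
    have hθ' : θ ∈ Icc (0 : ℝ) 1 := by simpa using hθ
    rw [Set.IccExtend_of_mem _ _ hθ', nemytskii_apply hf's.continuousOn (hmem (s, z) ⟨mem_univ _, hz⟩),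
      scaledPath_apply]

/-- The filter `𝓝 0` is not punctured, so the estimate can be read at `s = 0` itself; for `k = 0` it
gives `‖f 0‖ ≤ c` for every `c > 0`. -/
theorem eq_zero_of_isLittleO_pow {E : Type*} [NormedAddCommGroup E] {k : ℕ} {f : ℝ → E}
    (h : f =o[𝓝 0] fun s : ℝ => s ^ k) : f 0 = 0 := by
  refine norm_le_zero_iff.1 (le_of_forall_pos_le_add fun c hc => ?_)
  refine (h.def hc).self_of_nhds.trans ?_
  rcases k.eq_zero_or_pos with rfl | hk
  · simp
  · simp [hk.ne', hc.le]

/-- A smooth function of order `o(s^k)`, pointwise in `z`, is divisible by `s^(k+1)`. -/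
theorem exists_contDiffOn_pow_smul_eq {Ω : Set V} (hΩ : IsOpen Ω) (k : ℕ) {f : ℝ × V → W}
    (hf : ContDiffOn ℝ ∞ f (univ ×ˢ Ω))
    (h0 : ∀ z ∈ Ω, (fun s : ℝ => f (s, z)) =o[𝓝 0] fun s : ℝ => s ^ k) :
    ∃ h : ℝ × V → W, ContDiffOn ℝ ∞ h (univ ×ˢ Ω) ∧
      ∀ s, ∀ z ∈ Ω, f (s, z) = s ^ (k + 1) • h (s, z) := by
  induction k generalizing f with
  | zero =>
    obtain ⟨g, hg, hfg⟩ := exists_contDiffOn_smul_eq hΩ hf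
      fun z hz => eq_zero_of_isLittleO_pow (h0 z hz)
    exact ⟨g, hg, fun s z hz => by simpa using hfg s z hz⟩
  | succ k ih =>
    obtain ⟨g, hg, hfg⟩ := exists_contDiffOn_smul_eq hΩ hf
      fun z hz => eq_zero_of_isLittleO_pow (h0 z hz)
    have h1 : ∀ z ∈ Ω, (fun s : ℝ => g (s, z)) =o[𝓝 0] fun s : ℝ => s ^ k := fun z hz => by
      have hgc : Continuous fun s : ℝ => g (s, z) :=
        hg.continuousOn.comp_continuous (by fun_prop) fun s => ⟨mem_univ _, hz⟩
      refine Asymptotics.isLittleO_iff.2 fun c hc => ?_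
      -- One factor `|s|` cancels only for `s ≠ 0`; the estimate at `s = 0` is recovered by
      -- continuity.
      have h2 : ∀ᶠ s in 𝓝[≠] (0 : ℝ), ‖g (s, z)‖ ≤ c * ‖s ^ k‖ := by
        filter_upwards [((h0 z hz).def hc).filter_mono nhdsWithin_le_nhds,
          self_mem_nhdsWithin] with s hs hs0
        have hs0' : 0 < |s| := abs_pos.2 hs0
        rw [hfg s z hz, norm_smul, pow_succ, norm_mul, Real.norm_eq_abs s, ← mul_assoc,
          mul_comm |s|] at hs
        exact le_of_mul_le_mul_right hs hs0'
      have h3 : ‖g (0, z)‖ ≤ c * ‖(0 : ℝ) ^ k‖ := by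
        refine le_of_tendsto_of_tendsto (b := 𝓝[≠] (0 : ℝ)) ?_ ?_ h2
        · exact hgc.norm.continuousAt.tendsto.mono_left nhdsWithin_le_nhds
        · exact (Continuous.tendsto (by fun_prop) _).mono_left nhdsWithin_le_nhds
      rw [eventually_nhdsWithin_iff] at h2
      filter_upwards [h2] with s hs
      rcases eq_or_ne s 0 with rfl | hs0
      exacts [h3, hs hs0]
    obtain ⟨h, hh, hgh⟩ := ih hg h1
    exact ⟨h, hh, fun s z hz => by rw [hfg s z hz, hgh s z hz, smul_smul, ← pow_succ']⟩

end Hadamard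

/-! ### Uniqueness of integral curves and complete flows -/

section Flow

variable {V : Type*} [NormedAddCommGroup V] [NormedSpace ℝ V]

/-- Two integral curves of a `C¹` vector field with the same initial point agree. -/
theorem eqOn_Icc_of_hasDerivWithinAt {Ω : Set V} (hΩ : IsOpen Ω) {f : V → V}
    (hf : ContDiffOn ℝ 1 f Ω) {a b : ℝ} {γ δ : ℝ → V} (hγc : ContinuousOn γ (Icc a b))
    (hγ : ∀ t ∈ Ico a b, HasDerivWithinAt γ (f (γ t)) (Ici t) t) (hγΩ : ∀ t ∈ Icc a b, γ t ∈ Ω)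
    (hδc : ContinuousOn δ (Icc a b)) (hδ : ∀ t ∈ Ico a b, HasDerivWithinAt δ (f (δ t)) (Ici t) t)
    (hδΩ : ∀ t ∈ Icc a b, δ t ∈ Ω) (h0 : γ a = δ a) : EqOn γ δ (Icc a b) := by
  -- The field is only locally Lipschitz; a single constant is available on the compact union of the
  -- two trajectories.
  set C := γ '' Icc a b ∪ δ '' Icc a b with hC
  have hCc : IsCompact C := (isCompact_Icc.image_of_continuousOn hγc).union
    (isCompact_Icc.image_of_continuousOn hδc)
  have hCΩ : C ⊆ Ω := by
    rintro _ (⟨t, ht, rfl⟩ | ⟨t, ht, rfl⟩)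
    exacts [hγΩ t ht, hδΩ t ht]
  obtain ⟨K, hK⟩ := LocallyLipschitzOn.exists_lipschitzOnWith_of_compact (f := f) hCc
    fun x hx => by
      obtain ⟨K, t, ht, hKt⟩ :=
        (hf.contDiffAt (hΩ.mem_nhds (hCΩ hx))).exists_lipschitzOnWith
      exact ⟨K, t, mem_nhdsWithin_of_mem_nhds ht, hKt⟩
  exact ODE_solution_unique_of_mem_Icc_right (v := fun _ => f) (s := fun _ => C) (K := K)
    (fun t _ => hK) hγc hγ (fun t ht => Or.inl (mem_image_of_mem _ (Ico_subset_Icc_self ht))) hδc hδ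
    (fun t ht => Or.inr (mem_image_of_mem _ (Ico_subset_Icc_self ht))) h0

/-- A complete flow of the vector field `f` on the set `Ω`. -/
structure IsFlowOn (Ω : Set V) (f : V → V) (φ : ℝ → V → V) : Prop where
  mem : ∀ t, ∀ z ∈ Ω, φ t z ∈ Ω
  zero : ∀ z ∈ Ω, φ 0 z = z
  hasDerivAt : ∀ t, ∀ z ∈ Ω, HasDerivAt (fun t => φ t z) (f (φ t z)) t

namespace IsFlowOn

variable {Ω : Set V} {f : V → V} {φ : ℝ → V → V}

theorem continuous (h : IsFlowOn Ω f φ) {z : V} (hz : z ∈ Ω) : Continuous fun t => φ t z :=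
  continuous_iff_continuousAt.2 fun t => (h.hasDerivAt t z hz).continuousAt

/-- The speed `c` may have either sign, so flow times of both signs are reached although the curve
is followed forwards on `[0, T]`. -/
theorem eq_of_hasDerivAt (h : IsFlowOn Ω f φ) (hΩ : IsOpen Ω) (hf : ContDiffOn ℝ 1 f Ω)
    {γ : ℝ → V} {c T : ℝ} (hT : 0 ≤ T)
    (hγ : ∀ t ∈ Icc 0 T, HasDerivAt γ (c • f (γ t)) t) (hγΩ : ∀ t ∈ Icc 0 T, γ t ∈ Ω) :
    γ T = φ (c * T) (γ 0) := by
  have hz := hγΩ 0 ⟨le_rfl, hT⟩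
  have hd : ∀ t, HasDerivAt (fun t => φ (c * t) (γ 0)) (c • f (φ (c * t) (γ 0))) t := fun t => by
    have h1 : HasDerivAt (fun t : ℝ => c * t) c t := by
      simpa using (hasDerivAt_id t).const_mul c
    exact (h.hasDerivAt (c * t) (γ 0) hz).scomp t h1
  exact eqOn_Icc_of_hasDerivWithinAt hΩ (f := fun z => c • f z) (contDiffOn_const.smul hf)
    (fun t ht => (hγ t ht).continuousAt.continuousWithinAt)
    (fun t ht => (hγ t (Ico_subset_Icc_self ht)).hasDerivWithinAt) hγΩ
    (fun t _ => (hd t).continuousAt.continuousWithinAt) (fun t _ => (hd t).hasDerivWithinAt)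
    (fun t _ => h.mem _ _ hz) (by simp [h.zero _ hz]) ⟨hT, le_rfl⟩

theorem add (h : IsFlowOn Ω f φ) (hΩ : IsOpen Ω) (hf : ContDiffOn ℝ 1 f Ω) {s : ℝ} (hs : 0 ≤ s)
    (t : ℝ) {z : V} (hz : z ∈ Ω) : φ (s + t) z = φ s (φ t z) := by
  have h1 := h.eq_of_hasDerivAt hΩ hf (γ := fun σ => φ (σ + t) z) (c := 1) hs
    (fun σ _ => by
      simpa using (h.hasDerivAt (σ + t) z hz).comp_add_const σ t)
    (fun σ _ => h.mem _ _ hz)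
  simpa using h1

end IsFlowOn

end Flow

/-! ### Smooth dependence of a flow on the initial point -/

section SmoothFlow

open unitInterval

universe u

variable {V : Type u} [NormedAddCommGroup V] [NormedSpace ℝ V] [CompleteSpace V]
  {Ω : Set V} {f : V → V} {φ : ℝ → V → V}

/-- For small times the flow of a smooth vector field is of class `C^m`. -/
theorem IsFlowOn.contDiffAt_zero (h : IsFlowOn Ω f φ) (hΩ : IsOpen Ω) (hf : ContDiffOn ℝ ∞ f Ω)
    (m : ℕ) (hm : m ≠ 0) {z₀ : V} (hz₀ : z₀ ∈ Ω) :
    ContDiffAt ℝ m (fun p : V × ℝ => φ p.2 p.1) (z₀, 0) := by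
  have hf1 : ContDiffOn ℝ 1 f Ω := hf.of_le (by exact_mod_cast le_top)
  set c : V →L[ℝ] C(I, V) := ContinuousLinearMap.const ℝ I with hc
  have hc_apply : ∀ z t, c z t = z := fun z t => rfl
  -- Zeros `((z, s), u)` of `F` are solutions of `u t = z + s ∫₀ᵗ f (u τ) dτ`, that is, the paths `t
  -- ↦ φ (s t) z`. The implicit function theorem in `C(I, V)` makes them `C^m` in `(z, s)`.
  set F : (V × ℝ) × C(I, V) → C(I, V) :=
    fun p => p.2 - c p.1.1 - p.1.2 • volterra V (nemytskii I f p.2) with hF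
  set u : (V × ℝ) × C(I, V) := ((z₀, 0), c z₀) with hu
  have hnem : ContDiffAt ℝ m (nemytskii I f) (c z₀) :=
    ((contDiffOn_nemytskii hΩ hf).contDiffAt
      ((isOpen_setOf_forall_mem hΩ).mem_nhds (fun t => hz₀))).of_le (by exact_mod_cast le_top)
  have hFd : ContDiffAt ℝ m F u := by
    have h1 : ContDiffAt ℝ m (fun p : (V × ℝ) × C(I, V) => volterra V (nemytskii I f p.2)) u :=
      (volterra V).contDiff.contDiffAt.comp u
        (ContDiffAt.comp u (f := Prod.snd) hnem contDiffAt_snd)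
    exact (contDiffAt_snd.sub (c.contDiff.contDiffAt.comp u
      (contDiffAt_fst.fst))).sub (contDiffAt_fst.snd.smul h1)
  have hm' : (m : ℕ∞ω) ≠ 0 := by exact_mod_cast hm
  -- At `s = 0` the map `F` is `u ↦ u - z₀`, so its partial derivative in `u` is the identity.
  have hinv : (fderiv ℝ F u ∘L .inr ℝ (V × ℝ) C(I, V)) = ContinuousLinearMap.id ℝ C(I, V) := by
    have h1 : HasFDerivAt (fun v : C(I, V) => F ((z₀, 0), v))
        (fderiv ℝ F u ∘L .inr ℝ (V × ℝ) C(I, V)) (c z₀) :=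
      (hFd.differentiableAt hm').hasFDerivAt.comp (c z₀) (hasFDerivAt_prodMk_right _ _)
    have h2 : HasFDerivAt (fun v : C(I, V) => F ((z₀, 0), v))
        (ContinuousLinearMap.id ℝ C(I, V)) (c z₀) := by
      simp only [hF, zero_smul, sub_zero]
      exact (hasFDerivAt_id _).sub_const _
    exact h1.unique h2
  have hi : (fderiv ℝ F u ∘L .inr ℝ (V × ℝ) C(I, V)).IsInvertible := by
    rw [hinv]
    exact ⟨ContinuousLinearEquiv.refl ℝ _, rfl⟩
  set ψ := hFd.implicitFunction hm' hi with hψ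
  have hψd : ContDiffAt ℝ m ψ (z₀, 0) := hFd.contDiffAt_implicitFunction hm' hi
  have hψ0 : ψ (z₀, 0) = c z₀ := hFd.implicitFunction_apply_self hm' hi
  have hFu : F u = 0 := by simp [hF, hu]
  have hev := hFd.eventually_apply_implicitFunction hm' hi
  have hev2 : ∀ᶠ p in 𝓝 (z₀, (0 : ℝ)), ∀ t, ψ p t ∈ Ω := by
    have := hψd.continuousAt.preimage_mem_nhds (t := {v : C(I, V) | ∀ t, v t ∈ Ω})
      ((isOpen_setOf_forall_mem hΩ).mem_nhds (by rw [hψ0]; exact fun t => hz₀))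
    exact this
  have hgoal : ContDiffAt ℝ m (fun p => ψ p 1) (z₀, 0) :=
    ContDiffAt.comp _ (g := ContinuousMap.evalCLM (M := V) ℝ (1 : I))
      (ContinuousMap.evalCLM (M := V) ℝ (1 : I)).contDiff.contDiffAt hψd
  refine hgoal.congr_of_eventuallyEq ?_
  filter_upwards [hev, hev2] with p hp hpΩ
  rw [hFu] at hp
  have hp' : ψ p = c p.1 + p.2 • volterra V (nemytskii I f (ψ p)) := by
    have : ψ p - c p.1 - p.2 • volterra V (nemytskii I f (ψ p)) = 0 := hp
    rw [sub_sub, sub_eq_zero] at this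
    exact this
  set g : ℝ → V := Set.IccExtend zero_le_one (nemytskii I f (ψ p)) with hg
  have hgc : Continuous g := (nemytskii I f (ψ p)).continuous.Icc_extend'
  set γ : ℝ → V := fun t => p.1 + p.2 • ∫ τ in (0 : ℝ)..t, g τ with hγ
  have hγψ : ∀ t (ht : t ∈ Icc (0 : ℝ) 1), γ t = ψ p ⟨t, ht⟩ := fun t ht => by
    conv_rhs => rw [hp']
    rfl
  have hγd : ∀ t ∈ Icc (0 : ℝ) 1, HasDerivAt γ (p.2 • f (γ t)) t := fun t ht => by
    have h1 : HasDerivAt γ (p.2 • g t) t :=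
      ((hgc.integral_hasStrictDerivAt 0 t).hasDerivAt.const_smul p.2).const_add p.1
    have h2 : g t = f (γ t) := by
      rw [hγψ t ht, hg, Set.IccExtend_of_mem _ _ ht, nemytskii_apply hf.continuousOn hpΩ]
    rwa [h2] at h1
  -- By uniqueness the implicit solution is the flow line run at speed `p.2`, and its value at time
  -- `1` is `φ p.2 p.1`.
  have h1 := h.eq_of_hasDerivAt hΩ hf1 (γ := γ) (c := p.2) zero_le_one hγd
    (fun t ht => by rw [hγψ t ht]; exact hpΩ _)
  rw [mul_one, hγψ 1 ⟨zero_le_one, le_rfl⟩] at h1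
  have h0 : γ 0 = p.1 := by simp [hγ]
  rw [h0] at h1
  exact h1.symm

/-- The time-one map of a complete flow of a smooth vector field is smooth. -/
theorem IsFlowOn.contDiffOn (h : IsFlowOn Ω f φ) (hΩ : IsOpen Ω) (hf : ContDiffOn ℝ ∞ f Ω) :
    ContDiffOn ℝ ∞ (φ 1) Ω := by
  have hf1 : ContDiffOn ℝ 1 f Ω := hf.of_le (by exact_mod_cast le_top)
  refine contDiffOn_infty.2 fun m => ?_
  -- The local statement rests on the implicit function theorem and excludes order zero.
  suffices h' : ContDiffOn ℝ (m + 1 : ℕ) (φ 1) Ω from h'.of_le (by exact_mod_cast m.le_succ)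
  intro z₀ hz₀
  refine ContDiffAt.contDiffWithinAt ?_
  -- The orbit of `z₀` over `[0, 1]` is compact, so one small time works at all its points; `φ 1` is
  -- then an `(N + 1)`-fold composition of `φ (1 / (N + 1))`.
  have hlocal : ∀ᶠ s in 𝓝 (0 : ℝ), ∀ t ∈ Icc (0 : ℝ) 1,
      ContDiffAt ℝ (m + 1 : ℕ) (φ s) (φ t z₀) := by
    refine isCompact_Icc.eventually_forall_of_forall_eventually fun t _ => ?_
    have h1 := (h.contDiffAt_zero hΩ hf (m + 1) m.succ_ne_zero (h.mem t z₀ hz₀)).eventually (by simp)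
    have h2 : Filter.Tendsto (fun p : ℝ × ℝ => (φ p.2 z₀, p.1)) (𝓝 (0, t)) (𝓝 (φ t z₀, 0)) :=
      Continuous.tendsto (f := fun p : ℝ × ℝ => (φ p.2 z₀, p.1))
        (((h.continuous hz₀).comp continuous_snd).prodMk continuous_fst) (0, t)
    filter_upwards [h2.eventually h1] with p hp
    exact ContDiffAt.comp (φ p.2 z₀) (g := fun q : V × ℝ => φ q.2 q.1) (f := fun z => (z, p.1)) hp
      (contDiffAt_id.prodMk contDiffAt_const)
  obtain ⟨ε, hε, hball⟩ := Metric.eventually_nhds_iff.1 hlocal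
  obtain ⟨N, hN⟩ := exists_nat_one_div_lt hε
  set s : ℝ := 1 / (N + 1) with hs
  have hs0 : 0 ≤ s := by positivity
  have hsm := hball (y := s) (by rw [Real.dist_eq, sub_zero, abs_of_nonneg hs0]; exact hN)
  have hind : ∀ j : ℕ, j ≤ N + 1 → ContDiffAt ℝ (m + 1 : ℕ) (φ (j * s)) z₀ := by
    intro j
    induction j with
    | zero =>
      intro _
      refine contDiffAt_id.congr_of_eventuallyEq ?_
      filter_upwards [hΩ.mem_nhds hz₀] with z hz
      simp [h.zero z hz]
    | succ j ih =>
      intro hj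
      have hmem : (j : ℝ) * s ∈ Icc (0 : ℝ) 1 := by
        refine ⟨by positivity, ?_⟩
        rw [hs, mul_one_div, div_le_one (by positivity)]
        exact_mod_cast (Nat.le_succ j).trans hj
      refine ((hsm _ hmem).comp z₀ (ih ((Nat.le_succ j).trans hj))).congr_of_eventuallyEq ?_
      filter_upwards [hΩ.mem_nhds hz₀] with z hz
      rw [Function.comp_apply, ← h.add hΩ hf1 hs0 _ hz]
      congr 1
      push_cast
      ring
  have h1 := hind (N + 1) le_rfl
  have h2 : ((N + 1 : ℕ) : ℝ) * s = 1 := by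
    rw [hs]; push_cast; field_simp
  rwa [h2] at h1

end SmoothFlow

/-! ### Expansions with remainder `o(s^k)` -/

section Asymptotics

open Filter Asymptotics

variable {V W : Type*} [NormedAddCommGroup V] [NormedSpace ℝ V] [NormedAddCommGroup W]
  [NormedSpace ℝ W]

theorem isLittleO_pow_smul_sub {k : ℕ} {m : ℝ → W} {w : W} (hm : Tendsto m (𝓝 0) (𝓝 w)) :
    (fun s : ℝ => s ^ k • m s - s ^ k • w) =o[𝓝 0] fun s : ℝ => s ^ k := by
  have h1 : (fun s => m s - w) =o[𝓝 (0 : ℝ)] fun _ => (1 : ℝ) := by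
    rw [isLittleO_one_iff]
    simpa using hm.sub_const w
  have h2 := (isBigO_refl (fun s : ℝ => s ^ k) (𝓝 0)).smul_isLittleO h1
  simpa [smul_sub] using h2

/-- Both points move with `s`, which is why strict differentiability is assumed: the increment of
`h` is `D (0, p s - q s)` up to `o(‖p s - q s‖)`, and `p s - q s` is `O(s^j)`. -/
theorem isLittleO_comp_sub_comp {h : ℝ × V → W} {D : ℝ × V →L[ℝ] W} {z : V}
    (hD : HasStrictFDerivAt h D (0, z)) {p q : ℝ → V} (hp : Tendsto p (𝓝 0) (𝓝 z))
    (hq : Tendsto q (𝓝 0) (𝓝 z)) {j : ℕ} {ζ : V}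
    (hpq : (fun s => p s - q s - s ^ j • ζ) =o[𝓝 0] fun s : ℝ => s ^ j) :
    (fun s => h (s, p s) - h (s, q s) - s ^ j • D (0, ζ)) =o[𝓝 0] fun s : ℝ => s ^ j := by
  have ht : Tendsto (fun s : ℝ => ((s, p s), (s, q s))) (𝓝 0) (𝓝 ((0, z), (0, z))) :=
    (tendsto_id.prodMk_nhds hp).prodMk_nhds (tendsto_id.prodMk_nhds hq)
  have h1 := hD.isLittleO.comp_tendsto ht
  have hO : (fun s => p s - q s) =O[𝓝 0] fun s : ℝ => s ^ j := by
    have h2 : (fun s : ℝ => s ^ j • ζ) =O[𝓝 0] fun s : ℝ => s ^ j := by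
      simpa using (isBigO_refl (fun s : ℝ => s ^ j) (𝓝 0)).smul
        (isBigO_const_const ζ (one_ne_zero (α := ℝ)) (𝓝 0))
    simpa using hpq.isBigO.add h2
  have hO' : (fun s : ℝ => ((s, p s) : ℝ × V) - (s, q s)) =O[𝓝 0] fun s : ℝ => s ^ j := by
    simp only [Prod.mk_sub_mk, sub_self]
    exact (isBigO_zero _ _).prod_left hO
  have h3 := h1.trans_isBigO hO'
  have h4 : (fun s : ℝ => D ((0 : ℝ), p s - q s - s ^ j • ζ)) =o[𝓝 0] fun s : ℝ => s ^ j :=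
    ((D ∘L ContinuousLinearMap.inr ℝ ℝ V).isBigO_comp _ _).trans_isLittleO hpq
  refine (h3.add h4).congr_left fun s => ?_
  have e1 : ((0 : ℝ), p s - q s - s ^ j • ζ) = ((s, p s) - (s, q s)) - s ^ j • ((0 : ℝ), ζ) := by
    simp
  rw [e1, map_sub, map_smul]
  simp only [Function.comp_apply]
  abel

end Asymptotics

/-! ### Families of diffeomorphisms with a leading term -/

section LocalFamily

open Filter Asymptotics

universe u

variable {V : Type u} [NormedAddCommGroup V] [NormedSpace ℝ V]

/-- A smooth one-parameter family `Φ` of diffeomorphisms of `Ω`, with inverses `Ψ`, such that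
`Φ s z = z + s^k η(z) + o(s^k)`. -/
structure LocalFamily (Ω : Set V) (k : ℕ) (η : V → V) (Φ Ψ : ℝ → V → V) : Prop where
  pos : 0 < k
  smooth : ContDiffOn ℝ ∞ (fun p : ℝ × V => Φ p.1 p.2) (univ ×ˢ Ω)
  smooth_inv : ContDiffOn ℝ ∞ (fun p : ℝ × V => Ψ p.1 p.2) (univ ×ˢ Ω)
  mem : ∀ s, ∀ z ∈ Ω, Φ s z ∈ Ω
  mem_inv : ∀ s, ∀ z ∈ Ω, Ψ s z ∈ Ω
  left_inv : ∀ s, ∀ z ∈ Ω, Ψ s (Φ s z) = z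
  right_inv : ∀ s, ∀ z ∈ Ω, Φ s (Ψ s z) = z
  isLittleO : ∀ z ∈ Ω, (fun s => Φ s z - z - s ^ k • η z) =o[𝓝 0] fun s : ℝ => s ^ k

namespace LocalFamily

variable {Ω : Set V} {k l : ℕ} {η ζ : V → V} {Φ Ψ Φ' Ψ' : ℝ → V → V}

theorem zero (h : LocalFamily Ω k η Φ Ψ) {z : V} (hz : z ∈ Ω) : Φ 0 z = z := by
  have := eq_zero_of_isLittleO_pow (h.isLittleO z hz)
  rw [zero_pow h.pos.ne', zero_smul, sub_zero, sub_eq_zero] at this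
  exact this

theorem zero_inv (h : LocalFamily Ω k η Φ Ψ) {z : V} (hz : z ∈ Ω) : Ψ 0 z = z := by
  have := h.left_inv 0 z hz
  rwa [h.zero hz] at this

theorem continuous (h : LocalFamily Ω k η Φ Ψ) {z : V} (hz : z ∈ Ω) :
    Continuous fun s => Φ s z :=
  h.smooth.continuousOn.comp_continuous (f := fun s : ℝ => (s, z)) (by fun_prop)
    fun s => ⟨mem_univ _, hz⟩

theorem continuous_inv (h : LocalFamily Ω k η Φ Ψ) {z : V} (hz : z ∈ Ω) :
    Continuous fun s => Ψ s z :=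
  h.smooth_inv.continuousOn.comp_continuous (f := fun s : ℝ => (s, z)) (by fun_prop)
    fun s => ⟨mem_univ _, hz⟩

theorem tendsto (h : LocalFamily Ω k η Φ Ψ) {z : V} (hz : z ∈ Ω) :
    Tendsto (fun s => Φ s z) (𝓝 0) (𝓝 z) := by
  simpa [h.zero hz] using (h.continuous hz).tendsto 0

theorem tendsto_inv (h : LocalFamily Ω k η Φ Ψ) {z : V} (hz : z ∈ Ω) :
    Tendsto (fun s => Ψ s z) (𝓝 0) (𝓝 z) := by
  simpa [h.zero_inv hz] using (h.continuous_inv hz).tendsto 0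

/-- Hadamard's lemma upgrades the expansion, assumed only pointwise in `z`, to an exact formula with
a smooth factor. All later expansions are read off from this factor. -/
theorem exists_factor [CompleteSpace V] (h : LocalFamily Ω k η Φ Ψ) (hΩ : IsOpen Ω) :
    ∃ m : ℝ × V → V, ContDiffOn ℝ ∞ m (univ ×ˢ Ω) ∧
      (∀ s, ∀ z ∈ Ω, Φ s z = z + s ^ k • m (s, z)) ∧ ∀ z ∈ Ω, m (0, z) = η z := by
  obtain ⟨j, rfl⟩ : ∃ j, k = j + 1 := ⟨k - 1, (Nat.sub_add_cancel h.pos).symm⟩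
  have hlt : (fun s : ℝ => s ^ (j + 1)) =o[𝓝 0] fun s : ℝ => s ^ j := by
    have h1 : (fun s : ℝ => s) =o[𝓝 0] fun _ => (1 : ℝ) := (isLittleO_one_iff ℝ).2 tendsto_id
    simpa [pow_succ] using (isBigO_refl (fun s : ℝ => s ^ j) (𝓝 0)).mul_isLittleO h1
  obtain ⟨m, hm, hfm⟩ := exists_contDiffOn_pow_smul_eq hΩ j (f := fun p : ℝ × V => Φ p.1 p.2 - p.2)
    (h.smooth.sub contDiffOn_snd) fun z hz => by
      have h2 : (fun s : ℝ => s ^ (j + 1) • η z) =o[𝓝 0] fun s : ℝ => s ^ j := by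
        simpa using hlt.smul_isBigO (isBigO_const_const (η z) (one_ne_zero (α := ℝ)) (𝓝 0))
      simpa using ((h.isLittleO z hz).trans hlt).add h2
  refine ⟨m, hm, fun s z hz => by rw [← hfm s z hz]; simp, fun z hz => ?_⟩
  have hmc : Continuous fun s : ℝ => m (s, z) :=
    hm.continuousOn.comp_continuous (by fun_prop) fun s => ⟨mem_univ _, hz⟩
  -- Both `η z` and `m (0, z)` are leading coefficients of order `j + 1`; a constant multiple of
  -- `s^(j + 1)` that is `o(s^(j + 1))` vanishes.
  have h3 : (fun s : ℝ => s ^ (j + 1) • (m (0, z) - η z)) =o[𝓝 0] fun s : ℝ => s ^ (j + 1) := by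
    have h4 := isLittleO_pow_smul_sub (k := j + 1) (hmc.tendsto 0)
    refine ((h.isLittleO z hz).sub h4).congr_left fun s => ?_
    rw [hfm s z hz]
    module
  by_contra hne
  have h5 : (fun s : ℝ => s ^ (j + 1)) =o[𝓝[≠] 0] fun s : ℝ => s ^ (j + 1) := by
    have h6 := (h3.mono (nhdsWithin_le_nhds (s := {0}ᶜ))).norm_left
    simp only [norm_smul, mul_comm _ ‖m (0, z) - η z‖] at h6
    exact ((isLittleO_const_mul_left_iff
      (norm_ne_zero_iff.2 (sub_ne_zero.2 hne))).1 h6).of_norm_left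
  have h7 : ∀ᶠ s in 𝓝[≠] (0 : ℝ), s ^ (j + 1) ≠ 0 := by
    filter_upwards [self_mem_nhdsWithin] with s hs using pow_ne_zero _ hs
  exact isLittleO_irrefl h7.frequently h5

theorem contDiffOn [CompleteSpace V] (h : LocalFamily Ω k η Φ Ψ) (hΩ : IsOpen Ω) :
    ContDiffOn ℝ ∞ η Ω := by
  obtain ⟨m, hm, -, hm0⟩ := h.exists_factor hΩ
  have h1 : ContDiffOn ℝ ∞ (fun z => m (0, z)) Ω :=
    hm.comp (contDiffOn_const.prodMk contDiffOn_id) fun z hz => ⟨mem_univ _, hz⟩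
  exact h1.congr fun z hz => (hm0 z hz).symm

/-- Putting `w = Ψ s z` into `Φ s w = w + s^k m (s, w)` gives `Ψ s z - z = -s^k m (s, Ψ s z)`, and
`Ψ s z` tends to `z`. -/
theorem inv [CompleteSpace V] (h : LocalFamily Ω k η Φ Ψ) (hΩ : IsOpen Ω) :
    LocalFamily Ω k (fun z => -η z) Ψ Φ where
  pos := h.pos
  smooth := h.smooth_inv
  smooth_inv := h.smooth
  mem := h.mem_inv
  mem_inv := h.mem
  left_inv := h.right_inv
  right_inv := h.left_inv
  isLittleO z hz := by
    obtain ⟨m, hm, hfm, hm0⟩ := h.exists_factor hΩ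
    have h1 : Tendsto (fun s => -m (s, Ψ s z)) (𝓝 0) (𝓝 (-η z)) := by
      rw [← hm0 z hz]
      refine Tendsto.neg ?_
      have h2 : ContinuousAt m (0, z) :=
        hm.continuousOn.continuousAt ((isOpen_univ.prod hΩ).mem_nhds ⟨mem_univ _, hz⟩)
      exact h2.tendsto.comp (tendsto_id.prodMk_nhds (h.tendsto_inv hz))
    refine (isLittleO_pow_smul_sub (k := k) h1).congr_left fun s => ?_
    have h3 := hfm s (Ψ s z) (h.mem_inv s z hz)
    rw [h.right_inv s z hz] at h3
    have h4 : Ψ s z - z = -(s ^ k • m (s, Ψ s z)) := by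
      rw [eq_neg_iff_add_eq_zero, sub_add_eq_add_sub, ← h3, sub_self]
    rw [h4, smul_neg]

theorem contDiffOn_comp {F G : ℝ → V → V} {a b : ℝ → ℝ} (ha : ContDiff ℝ ∞ a)
    (hb : ContDiff ℝ ∞ b) (hF : ContDiffOn ℝ ∞ (fun p : ℝ × V => F p.1 p.2) (univ ×ˢ Ω))
    (hG : ContDiffOn ℝ ∞ (fun p : ℝ × V => G p.1 p.2) (univ ×ˢ Ω))
    (hmem : ∀ s, ∀ z ∈ Ω, G s z ∈ Ω) :
    ContDiffOn ℝ ∞ (fun p : ℝ × V => F (a p.1) (G (b p.1) p.2)) (univ ×ˢ Ω) := by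
  have h1 : ContDiffOn ℝ ∞ (fun p : ℝ × V => (b p.1, p.2)) (univ ×ˢ Ω) :=
    (hb.comp contDiff_fst).contDiffOn.prodMk contDiffOn_snd
  have h2 : ContDiffOn ℝ ∞ (fun p : ℝ × V => (a p.1, G (b p.1) p.2)) (univ ×ˢ Ω) :=
    (ha.comp contDiff_fst).contDiffOn.prodMk (hG.comp h1 fun p hp => ⟨mem_univ _, hp.2⟩)
  exact hF.comp h2 fun p hp => ⟨mem_univ _, hmem _ _ hp.2⟩

/-- The substitutions `s^l` and `s^k` bring the two families to the common order `k * l`, at which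
the leading terms of a composition add. -/
theorem add [CompleteSpace V] (h : LocalFamily Ω k η Φ Ψ) (h' : LocalFamily Ω l ζ Φ' Ψ')
    (hΩ : IsOpen Ω) :
    LocalFamily Ω (k * l) (fun z => η z + ζ z) (fun s z => Φ (s ^ l) (Φ' (s ^ k) z))
      (fun s z => Ψ' (s ^ k) (Ψ (s ^ l) z)) where
  pos := Nat.mul_pos h.pos h'.pos
  smooth := contDiffOn_comp (contDiff_id.pow l) (contDiff_id.pow k) h.smooth h'.smooth h'.mem
  smooth_inv := contDiffOn_comp (contDiff_id.pow k) (contDiff_id.pow l) h'.smooth_inv h.smooth_inv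
    h.mem_inv
  mem s z hz := h.mem _ _ (h'.mem _ _ hz)
  mem_inv s z hz := h'.mem_inv _ _ (h.mem_inv _ _ hz)
  left_inv s z hz := by rw [h.left_inv _ _ (h'.mem _ _ hz), h'.left_inv _ _ hz]
  right_inv s z hz := by rw [h'.right_inv _ _ (h.mem_inv _ _ hz), h.right_inv _ _ hz]
  isLittleO z hz := by
    obtain ⟨m, hm, hfm, hm0⟩ := h.exists_factor hΩ
    obtain ⟨m', hm', hfm', hm0'⟩ := h'.exists_factor hΩ
    have hc : ContinuousAt m (0, z) :=
      hm.continuousOn.continuousAt ((isOpen_univ.prod hΩ).mem_nhds ⟨mem_univ _, hz⟩)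
    have hc' : ContinuousAt m' (0, z) :=
      hm'.continuousOn.continuousAt ((isOpen_univ.prod hΩ).mem_nhds ⟨mem_univ _, hz⟩)
    have hpow : ∀ {j : ℕ}, 0 < j → Tendsto (fun s : ℝ => s ^ j) (𝓝 0) (𝓝 0) := fun {j} hj => by
      simpa [hj.ne'] using (continuous_pow (M := ℝ) j).tendsto 0
    have h1 : Tendsto (fun s => m (s ^ l, Φ' (s ^ k) z) + m' (s ^ k, z)) (𝓝 0)
        (𝓝 (η z + ζ z)) := by
      rw [← hm0 z hz, ← hm0' z hz]
      exact (hc.tendsto.comp ((hpow h'.pos).prodMk_nhds ((h'.tendsto hz).comp (hpow h.pos)))).add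
        (hc'.tendsto.comp ((hpow h.pos).prodMk_nhds tendsto_const_nhds))
    refine (isLittleO_pow_smul_sub (k := k * l) h1).congr_left fun s => ?_
    rw [hfm _ _ (h'.mem _ _ hz)]
    nth_rw 2 [hfm' _ _ hz]
    have e1 : (s ^ l) ^ k = s ^ (k * l) := by rw [← pow_mul, mul_comm]
    have e2 : (s ^ k) ^ l = s ^ (k * l) := by rw [← pow_mul]
    rw [e1, e2]
    module

/-- Through a `k`-th root for `b`, this realizes all nonnegative multiples of the leading term. -/
theorem comp_mul [CompleteSpace V] (h : LocalFamily Ω k η Φ Ψ) (hΩ : IsOpen Ω) (b : ℝ) :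
    LocalFamily Ω k (fun z => b ^ k • η z) (fun s => Φ (b * s)) (fun s => Ψ (b * s)) where
  pos := h.pos
  smooth := h.smooth.comp (f := fun p : ℝ × V => (b * p.1, p.2))
    ((contDiff_const.mul contDiff_fst).prodMk contDiff_snd).contDiffOn fun p hp => ⟨mem_univ _, hp.2⟩
  smooth_inv := h.smooth_inv.comp (f := fun p : ℝ × V => (b * p.1, p.2))
    ((contDiff_const.mul contDiff_fst).prodMk contDiff_snd).contDiffOn fun p hp => ⟨mem_univ _, hp.2⟩
  mem s := h.mem _
  mem_inv s := h.mem_inv _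
  left_inv s := h.left_inv _
  right_inv s := h.right_inv _
  isLittleO z hz := by
    obtain ⟨m, hm, hfm, hm0⟩ := h.exists_factor hΩ
    have hc : ContinuousAt m (0, z) :=
      hm.continuousOn.continuousAt ((isOpen_univ.prod hΩ).mem_nhds ⟨mem_univ _, hz⟩)
    have h1 : Tendsto (fun s => b ^ k • m (b * s, z)) (𝓝 0) (𝓝 (b ^ k • η z)) := by
      rw [← hm0 z hz]
      refine (hc.tendsto.comp (Tendsto.prodMk_nhds ?_ tendsto_const_nhds)).const_smul _
      simpa using (continuous_const_mul b).tendsto (0 : ℝ)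
    refine (isLittleO_pow_smul_sub (k := k) h1).congr_left fun s => ?_
    rw [hfm _ _ hz, mul_pow]
    module

/-- The commutator of families of order `k` and `l` is, to the order `k + l`, given by the Lie
bracket of their leading terms. -/
theorem isLittleO_commutator [CompleteSpace V] (h : LocalFamily Ω k η Φ Ψ)
    (h' : LocalFamily Ω l ζ Φ' Ψ') (hΩ : IsOpen Ω) {z : V} (hz : z ∈ Ω) :
    (fun s => Ψ s (Ψ' s (Φ s (Φ' s z))) - z - s ^ (k + l) • VectorField.lieBracket ℝ ζ η z)
      =o[𝓝 0] fun s : ℝ => s ^ (k + l) := by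
  have hU : IsOpen ((univ : Set ℝ) ×ˢ Ω) := isOpen_univ.prod hΩ
  have hz' : ((0 : ℝ), z) ∈ (univ : Set ℝ) ×ˢ Ω := ⟨mem_univ _, hz⟩
  -- With `Φ s w = w + s^k m (s, w)` the second difference is `s^k (m (s, Φ' s z) - m (s, z))`,
  -- where the displacement `s^l ζ z` contributes `s^(k + l) Dη(ζ)`.
  have key : ∀ {k l : ℕ} {η ζ : V → V} {Φ Ψ Φ' Ψ' : ℝ → V → V}, LocalFamily Ω k η Φ Ψ →
      LocalFamily Ω l ζ Φ' Ψ' → (fun s => Φ s (Φ' s z) - Φ' s z - (Φ s z - z) -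
        s ^ (k + l) • fderiv ℝ η z (ζ z)) =o[𝓝 0] fun s : ℝ => s ^ (k + l) := by
    intro k l η ζ Φ Ψ Φ' Ψ' h h'
    obtain ⟨m, hm, hfm, hm0⟩ := h.exists_factor hΩ
    have hmd : ContDiffAt ℝ ∞ m (0, z) := hm.contDiffAt (hU.mem_nhds hz')
    have hD := hmd.hasStrictFDerivAt (by simp)
    have h1 := isLittleO_comp_sub_comp hD (h'.tendsto hz) tendsto_const_nhds (h'.isLittleO z hz)
    have e1 : fderiv ℝ m (0, z) (0, ζ z) = fderiv ℝ η z (ζ z) := by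
      have h2 : HasFDerivAt (fun z => m (0, z))
          ((fderiv ℝ m (0, z)).comp (ContinuousLinearMap.inr ℝ ℝ V)) z :=
        hD.hasFDerivAt.comp z (hasFDerivAt_prodMk_right _ _)
      have h3 : (fun z => m (0, z)) =ᶠ[𝓝 z] η := by
        filter_upwards [hΩ.mem_nhds hz] with w hw using hm0 w hw
      rw [← h3.fderiv_eq, h2.fderiv]
      rfl
    rw [e1] at h1
    have h4 := (isBigO_refl (fun s : ℝ => s ^ k) (𝓝 0)).smul_isLittleO h1
    simp only [smul_eq_mul, ← pow_add] at h4
    refine h4.congr_left fun s => ?_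
    rw [hfm _ _ (h'.mem _ _ hz), hfm _ _ hz, pow_add]
    module
  -- Exchanging the families and subtracting leaves `Dη(ζ) - Dζ(η)`, the bracket of `ζ` and `η`.
  have hAB : (fun s => Φ s (Φ' s z) - Φ' s (Φ s z) -
      s ^ (k + l) • VectorField.lieBracket ℝ ζ η z) =o[𝓝 0] fun s : ℝ => s ^ (k + l) := by
    have h2 := key h' h
    rw [add_comm l k] at h2
    refine ((key h h').sub h2).congr_left fun s => ?_
    rw [VectorField.lieBracket_eq]
    module
  have hQ : ContDiffAt ℝ ∞ (fun p : ℝ × V => Ψ p.1 (Ψ' p.1 p.2)) (0, z) :=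
    (contDiffOn_comp contDiff_id contDiff_id h.smooth_inv h'.smooth_inv h'.mem_inv).contDiffAt
      (hU.mem_nhds hz')
  have hD := hQ.hasStrictFDerivAt (by simp)
  have hD0 : ∀ v, fderiv ℝ (fun p : ℝ × V => Ψ p.1 (Ψ' p.1 p.2)) (0, z) (0, v) = v := fun v => by
    have h2 : HasFDerivAt (fun z => Ψ 0 (Ψ' 0 z))
        ((fderiv ℝ (fun p : ℝ × V => Ψ p.1 (Ψ' p.1 p.2)) (0, z)).comp
          (ContinuousLinearMap.inr ℝ ℝ V)) z :=
      hD.hasFDerivAt.comp z (hasFDerivAt_prodMk_right _ _)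
    have h3 : (fun z => Ψ 0 (Ψ' 0 z)) =ᶠ[𝓝 z] id := by
      filter_upwards [hΩ.mem_nhds hz] with w hw
      rw [h'.zero_inv hw, h.zero_inv hw, id]
    have h4 := h2.unique ((hasFDerivAt_id z).congr_of_eventuallyEq h3)
    exact congrArg (fun T : V →L[ℝ] V => T v) h4
  have ht : ∀ {F G F' G' : ℝ → V → V} {k l η ζ}, LocalFamily Ω k η F G →
      LocalFamily Ω l ζ F' G' → Tendsto (fun s => F s (F' s z)) (𝓝 0) (𝓝 z) := by
    intro F G F' G' k l η ζ h h'
    have h2 := (h.smooth.continuousOn.continuousAt (hU.mem_nhds hz')).tendsto.comp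
      (tendsto_id.prodMk_nhds (h'.tendsto hz))
    simp only [h.zero hz] at h2
    exact h2
  -- Apply `Ψ s ∘ Ψ' s` to `Φ s (Φ' s z)` and to `Φ' s (Φ s z)`. The latter becomes `z`, and since
  -- this map is the identity at `s = 0`, the difference is unchanged to order `k + l`.
  refine (isLittleO_comp_sub_comp hD (ht h h') (ht h' h) hAB).congr_left fun s => ?_
  simp only [hD0]
  rw [h'.left_inv _ _ (h.mem _ _ hz), h.left_inv _ _ hz]

theorem commutator [CompleteSpace V] (h : LocalFamily Ω k η Φ Ψ)
    (h' : LocalFamily Ω l ζ Φ' Ψ') (hΩ : IsOpen Ω) :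
    LocalFamily Ω (k + l) (VectorField.lieBracket ℝ ζ η) (fun s z => Ψ s (Ψ' s (Φ s (Φ' s z))))
      (fun s z => Ψ' s (Ψ s (Φ' s (Φ s z)))) where
  pos := Nat.add_pos_left h.pos _
  smooth := contDiffOn_comp (G := fun s z => Ψ' s (Φ s (Φ' s z))) contDiff_id contDiff_id
    h.smooth_inv (contDiffOn_comp (G := fun s z => Φ s (Φ' s z)) contDiff_id contDiff_id
      h'.smooth_inv (contDiffOn_comp contDiff_id contDiff_id h.smooth h'.smooth h'.mem)
      fun s z hz => h.mem _ _ (h'.mem _ _ hz))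
    fun s z hz => h'.mem_inv _ _ (h.mem _ _ (h'.mem _ _ hz))
  smooth_inv := contDiffOn_comp (G := fun s z => Ψ s (Φ' s (Φ s z))) contDiff_id contDiff_id
    h'.smooth_inv (contDiffOn_comp (G := fun s z => Φ' s (Φ s z)) contDiff_id contDiff_id
      h.smooth_inv (contDiffOn_comp contDiff_id contDiff_id h'.smooth h.smooth h.mem)
      fun s z hz => h'.mem _ _ (h.mem _ _ hz))
    fun s z hz => h.mem_inv _ _ (h'.mem _ _ (h.mem _ _ hz))
  mem s z hz := h.mem_inv _ _ (h'.mem_inv _ _ (h.mem _ _ (h'.mem _ _ hz)))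
  mem_inv s z hz := h'.mem_inv _ _ (h.mem_inv _ _ (h'.mem _ _ (h.mem _ _ hz)))
  left_inv s z hz := by
    rw [h.right_inv _ _ (h'.mem_inv _ _ (h.mem _ _ (h'.mem _ _ hz))),
      h'.right_inv _ _ (h.mem _ _ (h'.mem _ _ hz)), h.left_inv _ _ (h'.mem _ _ hz),
      h'.left_inv _ _ hz]
  right_inv s z hz := by
    rw [h'.right_inv _ _ (h.mem_inv _ _ (h'.mem _ _ (h.mem _ _ hz))),
      h.right_inv _ _ (h'.mem _ _ (h.mem _ _ hz)), h'.left_inv _ _ (h.mem _ _ hz),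
      h.left_inv _ _ hz]
  isLittleO z hz := h.isLittleO_commutator h' hΩ hz

end LocalFamily

end LocalFamily

/-! ### From families of order `k` to `C¹` families -/

section RootReparametrization

open Filter Asymptotics

universe u

variable {V : Type u} [NormedAddCommGroup V] [NormedSpace ℝ V]

/-- The `k`-th root of the absolute value. -/
noncomputable def absRoot (k : ℕ) (t : ℝ) : ℝ := |t| ^ (1 / (k : ℝ))

variable {k : ℕ}

theorem absRoot_pow (hk : 0 < k) (t : ℝ) : absRoot k t ^ k = |t| := by
  rw [absRoot, ← Real.rpow_natCast, ← Real.rpow_mul (abs_nonneg t),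
    one_div_mul_cancel (by exact_mod_cast hk.ne'), Real.rpow_one]

theorem absRoot_zero (hk : 0 < k) : absRoot k 0 = 0 := by
  rw [absRoot, abs_zero, Real.zero_rpow]
  exact one_div_ne_zero (by exact_mod_cast hk.ne')

theorem continuous_absRoot : Continuous (absRoot k) :=
  continuous_abs.rpow_const fun _ => Or.inr (by positivity)

theorem hasDerivAt_absRoot {t : ℝ} (ht : t ≠ 0) :
    HasDerivAt (absRoot k) (t⁻¹ * (absRoot k t / k)) t := by
  have h1 := (hasDerivAt_abs ht).rpow_const (p := 1 / (k : ℝ)) (Or.inl (abs_ne_zero.2 ht))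
  convert! h1 using 1
  rw [Real.rpow_sub_one (abs_ne_zero.2 ht), absRoot]
  have h2 : (SignType.sign t : ℝ) = t⁻¹ * |t| := by
    rw [eq_inv_mul_iff_mul_eq₀ ht, self_mul_sign]
  rw [h2]
  have : |t| ≠ 0 := abs_ne_zero.2 ht
  field_simp

/-- The derivative of `(t, z) ↦ t • m (|t|^(1/k), z)`. -/
noncomputable def rootDeriv (k : ℕ) (m : ℝ × V → V) (p : ℝ × V) : ℝ × V →L[ℝ] V :=
  (ContinuousLinearMap.fst ℝ ℝ V).smulRight
    (m (absRoot k p.1, p.2) + (absRoot k p.1 / k) • fderiv ℝ m (absRoot k p.1, p.2) (1, 0)) +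
  p.1 • (fderiv ℝ m (absRoot k p.1, p.2)).comp
    ((ContinuousLinearMap.inr ℝ ℝ V).comp (ContinuousLinearMap.snd ℝ ℝ V))

variable {Ω : Set V} {m : ℝ × V → V}

/-- The root is not differentiable at `0`, but it only enters multiplied by `t`: away from `0`, `t`
times its derivative is `|t|^(1/k) / k`, which extends continuously by `0`. At `t = 0` continuity of
`m` is enough. -/
theorem hasFDerivAt_smul_absRoot (hk : 0 < k) (hΩ : IsOpen Ω)
    (hm : ContDiffOn ℝ ∞ m (univ ×ˢ Ω)) {p : ℝ × V} (hp : p.2 ∈ Ω) :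
    HasFDerivAt (fun p : ℝ × V => p.1 • m (absRoot k p.1, p.2)) (rootDeriv k m p) p := by
  obtain ⟨t, z⟩ := p
  have hU : IsOpen ((univ : Set ℝ) ×ˢ Ω) := isOpen_univ.prod hΩ
  rcases eq_or_ne t 0 with rfl | ht
  · have hc : ContinuousAt m (absRoot k 0, z) :=
      hm.continuousOn.continuousAt (hU.mem_nhds ⟨mem_univ _, hp⟩)
    have hcc : Tendsto (fun p : ℝ × V => m (absRoot k p.1, p.2)) (𝓝 (0, z))
        (𝓝 (m (absRoot k 0, z))) :=
      hc.tendsto.comp (Continuous.tendsto (f := fun p : ℝ × V => (absRoot k p.1, p.2))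
        ((continuous_absRoot.comp continuous_fst).prodMk continuous_snd) (0, z))
    rw [hasFDerivAt_iff_isLittleO]
    have h1 : (fun p : ℝ × V => p.1 • (m (absRoot k p.1, p.2) - m (absRoot k 0, z)))
        =o[𝓝 (0, z)] fun p : ℝ × V => p.1 * (1 : ℝ) := by
      refine (isBigO_refl (fun p : ℝ × V => p.1) _).smul_isLittleO ?_
      rw [isLittleO_one_iff]
      simpa using hcc.sub_const (m (absRoot k 0, z))
    have h2 : (fun p : ℝ × V => p.1 * (1 : ℝ)) =O[𝓝 (0, z)] fun p : ℝ × V => p - (0, z) := by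
      refine isBigO_of_le _ fun p => ?_
      rw [mul_one]
      have h : ‖p.1 - 0‖ ≤ ‖p - (0, z)‖ := norm_fst_le (p - (0, z))
      rwa [sub_zero] at h
    refine (h1.trans_isBigO h2).congr_left fun p => ?_
    simp [rootDeriv, absRoot_zero hk, smul_sub]
  · have hmd : HasFDerivAt m (fderiv ℝ m (absRoot k t, z)) (absRoot k t, z) :=
      ((hm.contDiffAt (hU.mem_nhds (x := (absRoot k t, z)) ⟨mem_univ _, hp⟩)).differentiableAt
        (by simp)).hasFDerivAt
    have h1 : HasFDerivAt (fun p : ℝ × V => (absRoot k p.1, p.2))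
        (((t⁻¹ * (absRoot k t / k)) • ContinuousLinearMap.fst ℝ ℝ V).prod
          (ContinuousLinearMap.snd ℝ ℝ V)) (t, z) :=
      (HasDerivAt.comp_hasFDerivAt (t, z) (hasDerivAt_absRoot ht) hasFDerivAt_fst).prodMk
        hasFDerivAt_snd
    have h2 := (hasFDerivAt_fst (𝕜 := ℝ) (p := (t, z))).smul (hmd.comp (t, z) h1)
    refine h2.congr_fderiv ?_
    ext q
    · have e1 : ((t⁻¹ * (absRoot k t / k), 0) : ℝ × V) = (t⁻¹ * (absRoot k t / k)) • (1, 0) := by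
        simp
      simp only [rootDeriv, ContinuousLinearMap.coe_comp, Function.comp_apply,
        add_apply, smul_apply,
        ContinuousLinearMap.prod_apply, ContinuousLinearMap.inl_apply,
        ContinuousLinearMap.coe_fst', ContinuousLinearMap.coe_snd', smul_eq_mul, mul_one, e1,
        map_smul, map_zero, smul_zero, add_zero, ContinuousLinearMap.smulRight_apply, one_smul,
        smul_smul, mul_inv_cancel_left₀ ht]
      exact add_comm _ _
    · simp [rootDeriv]

theorem continuousOn_rootDeriv (hΩ : IsOpen Ω) (hm : ContDiffOn ℝ ∞ m (univ ×ˢ Ω)) :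
    ContinuousOn (rootDeriv k m) (univ ×ˢ Ω) := by
  have hU : IsOpen ((univ : Set ℝ) ×ˢ Ω) := isOpen_univ.prod hΩ
  have h1 : ContinuousOn (fun p : ℝ × V => (absRoot k p.1, p.2)) (univ ×ˢ Ω) :=
    ((continuous_absRoot.comp continuous_fst).prodMk continuous_snd).continuousOn
  have hmaps : MapsTo (fun p : ℝ × V => (absRoot k p.1, p.2)) (univ ×ˢ Ω) (univ ×ˢ Ω) :=
    fun p hp => ⟨mem_univ _, hp.2⟩
  have h2 := hm.continuousOn.comp h1 hmaps
  have h3 := (hm.continuousOn_fderiv_of_isOpen hU (by simp)).comp h1 hmaps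
  have h4 : ContinuousOn (fun p : ℝ × V => absRoot k p.1) (univ ×ˢ Ω) :=
    (continuous_absRoot.comp continuous_fst).continuousOn
  refine ContinuousOn.add ?_ ?_
  · exact (ContinuousLinearMap.smulRightL ℝ (ℝ × V) V
      (ContinuousLinearMap.fst ℝ ℝ V)).continuous.comp_continuousOn
      (h2.add ((h4.div_const _).smul (h3.clm_apply continuousOn_const)))
  · exact continuousOn_fst.smul (h3.clm_comp continuousOn_const)

/-- Gluing of two reparametrizations by the `k`-th root. -/
theorem contDiffOn_ite_smul_absRoot (hk : 0 < k) (hΩ : IsOpen Ω) {m' : ℝ × V → V}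
    (hm : ContDiffOn ℝ ∞ m (univ ×ˢ Ω)) (hm' : ContDiffOn ℝ ∞ m' (univ ×ˢ Ω))
    (h0 : ∀ z ∈ Ω, m (0, z) = m' (0, z)) :
    ContDiffOn ℝ 1 (fun p : ℝ × V => if 0 ≤ p.1 then p.1 • m (absRoot k p.1, p.2)
      else p.1 • m' (absRoot k p.1, p.2)) (univ ×ˢ Ω) := by
  have hU : IsOpen ((univ : Set ℝ) ×ˢ Ω) := isOpen_univ.prod hΩ
  -- On the interface `t = 0` the derivative involves only the value of the factor, not its
  -- derivative, so agreement of `m` and `m'` there suffices for `C¹` gluing.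
  have hD0 : ∀ z ∈ Ω, rootDeriv k m (0, z) = rootDeriv k m' (0, z) := fun z hz => by
    simp [rootDeriv, absRoot_zero hk, h0 z hz]
  have hd : ∀ p ∈ (univ : Set ℝ) ×ˢ Ω, HasFDerivAt
      (fun p : ℝ × V => if 0 ≤ p.1 then p.1 • m (absRoot k p.1, p.2)
      else p.1 • m' (absRoot k p.1, p.2))
      (if 0 ≤ p.1 then rootDeriv k m p else rootDeriv k m' p) p := by
    rintro ⟨t, z⟩ ⟨-, hz⟩
    have h1 := hasFDerivAt_smul_absRoot hk hΩ hm (p := (t, z)) hz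
    have h2 := hasFDerivAt_smul_absRoot hk hΩ hm' (p := (t, z)) hz
    rcases lt_trichotomy t 0 with ht | rfl | ht
    · rw [if_neg (by simpa using ht)]
      refine h2.congr_of_eventuallyEq ?_
      filter_upwards [(isOpen_Iio.preimage continuous_fst).mem_nhds (show (t, z).1 ∈ Iio (0 : ℝ)
        from ht)] with p hp
      rw [if_neg (not_le.2 hp)]
    · rw [if_pos le_rfl, ← hasFDerivWithinAt_univ]
      have hun : (univ : Set (ℝ × V)) = {p | 0 ≤ p.1} ∪ {p | p.1 ≤ 0} := by
        ext p; simp [le_total]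
      rw [hun]
      refine HasFDerivWithinAt.union ?_ ?_
      · refine h1.hasFDerivWithinAt.congr (fun p hp => if_pos hp) (if_pos le_rfl)
      · rw [hD0 z hz]
        refine h2.hasFDerivWithinAt.congr (fun p hp => ?_) (by simp)
        rcases eq_or_lt_of_le (show p.1 ≤ 0 from hp) with h | h
        · simp [h]
        · rw [if_neg (not_le.2 h)]
    · rw [if_pos (by exact ht.le)]
      refine h1.congr_of_eventuallyEq ?_
      filter_upwards [(isOpen_Ioi.preimage continuous_fst).mem_nhds (show (t, z).1 ∈ Ioi (0 : ℝ)
        from ht)] with p hp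
      rw [if_pos (le_of_lt hp)]
  have hcont : ContinuousOn (fun p : ℝ × V => if 0 ≤ p.1 then rootDeriv k m p
      else rootDeriv k m' p) (univ ×ˢ Ω) := by
    refine ContinuousOn.if (fun p hp => ?_) ?_ ?_
    · have h1 : p.1 = 0 := by
        have := frontier_le_subset_eq (continuous_const (y := (0 : ℝ))) continuous_fst hp.2
        exact Eq.symm this
      obtain ⟨t, z⟩ := p
      obtain rfl : t = 0 := h1
      exact hD0 z hp.1.2
    · exact (continuousOn_rootDeriv hΩ hm).mono inter_subset_left
    · exact (continuousOn_rootDeriv hΩ hm').mono inter_subset_left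
  have h1 : (1 : ℕ∞ω) = 0 + 1 := by simp
  rw [h1, contDiffOn_succ_iff_fderiv_of_isOpen hU]
  refine ⟨fun p hp => (hd p hp).differentiableAt.differentiableWithinAt, by simp, ?_⟩
  rw [contDiffOn_zero]
  exact hcont.congr fun p hp => (hd p hp).fderiv

variable [CompleteSpace V] {η : V → V} {Φ Ψ : ℝ → V → V}

open Classical in
/-- The `C¹` family `φ_t` with `∂φ_t/∂t = η` at `t = 0`, obtained from a family of order `k`. -/
noncomputable def rootFamily (k : ℕ) (Φ Ψ : ℝ → V → V) (t : ℝ) : V → V :=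
  if 0 ≤ t then Φ (absRoot k t) else Ψ (absRoot k t)

/-- For `t < 0` the inverse family, with leading term `-η`, is taken at `|t| = -t`; the two signs
cancel, and both halves have a factor with value `η` at parameter `0`. -/
theorem LocalFamily.rootFamily_eq (h : LocalFamily Ω k η Φ Ψ) (hΩ : IsOpen Ω) :
    ∃ m m' : ℝ × V → V, ContDiffOn ℝ ∞ m (univ ×ˢ Ω) ∧ ContDiffOn ℝ ∞ m' (univ ×ˢ Ω) ∧
      (∀ z ∈ Ω, m (0, z) = η z) ∧ (∀ z ∈ Ω, m' (0, z) = η z) ∧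
      ∀ t, ∀ z ∈ Ω, rootFamily k Φ Ψ t z = z + if 0 ≤ t then t • m (absRoot k t, z)
        else t • m' (absRoot k t, z) := by
  obtain ⟨m, hm, hfm, hm0⟩ := h.exists_factor hΩ
  obtain ⟨m', hm', hfm', hm0'⟩ := (h.inv hΩ).exists_factor hΩ
  refine ⟨m, fun p => -m' p, hm, hm'.neg, hm0, fun z hz => by simp [hm0' z hz],
    fun t z hz => ?_⟩
  rw [rootFamily]
  split_ifs with ht
  · rw [hfm _ _ hz, absRoot_pow h.pos, abs_of_nonneg ht]
  · rw [hfm' _ _ hz, absRoot_pow h.pos, abs_of_neg (not_le.1 ht)]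
    simp

theorem LocalFamily.contDiffOn_rootFamily (h : LocalFamily Ω k η Φ Ψ) (hΩ : IsOpen Ω) :
    ContDiffOn ℝ 1 (fun p : ℝ × V => rootFamily k Φ Ψ p.1 p.2) (univ ×ˢ Ω) := by
  obtain ⟨m, m', hm, hm', h0, h0', he⟩ := h.rootFamily_eq hΩ
  refine (contDiffOn_snd.add (contDiffOn_ite_smul_absRoot h.pos hΩ hm hm'
    fun z hz => (h0 z hz).trans (h0' z hz).symm)).congr fun p hp => ?_
  exact he p.1 p.2 hp.2

theorem LocalFamily.hasDerivAt_rootFamily (h : LocalFamily Ω k η Φ Ψ) (hΩ : IsOpen Ω) {z : V}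
    (hz : z ∈ Ω) : HasDerivAt (fun t => rootFamily k Φ Ψ t z) (η z) 0 := by
  obtain ⟨m, m', hm, hm', h0, h0', he⟩ := h.rootFamily_eq hΩ
  have hb : ∀ {m : ℝ × V → V}, ContDiffOn ℝ ∞ m (univ ×ˢ Ω) → m (0, z) = η z →
      HasDerivAt (fun t : ℝ => t • m (absRoot k t, z)) (η z) 0 := fun {m} hm hm0 => by
    have h1 := (hasFDerivAt_smul_absRoot h.pos hΩ hm (p := (0, z)) hz).comp_hasDerivAt (0 : ℝ)
      ((hasDerivAt_id (0 : ℝ)).prodMk (hasDerivAt_const (0 : ℝ) z))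
    simp [rootDeriv, absRoot_zero h.pos, hm0] at h1
    exact h1
  simp only [he _ z hz]
  refine HasDerivAt.const_add z ?_
  rw [← hasDerivWithinAt_univ, show (univ : Set ℝ) = Ici 0 ∪ Iic 0 from (by ext; simp)]
  refine HasDerivWithinAt.union ?_ ?_
  · exact (hb hm (h0 z hz)).hasDerivWithinAt.congr (fun t ht => if_pos ht) (if_pos le_rfl)
  · refine (hb hm' (h0' z hz)).hasDerivWithinAt.congr (fun t ht => ?_) (by simp)
    rcases eq_or_lt_of_le (show t ≤ 0 from ht) with h | h
    · simp [h]
    · rw [if_neg (not_le.2 h)]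

end RootReparametrization

/-! ### Global solutions for vector fields of linear growth -/

section LinearGrowth

variable {E : Type*} [NormedAddCommGroup E] [NormedSpace ℝ E] [CompleteSpace E]

/-- A piecewise linear cutoff function. -/
noncomputable def radialCutoff (R : ℝ) (y : E) : ℝ := max 0 (min 1 (2 - ‖y‖ / R))

theorem radialCutoff_nonneg (R : ℝ) (y : E) : 0 ≤ radialCutoff R y := le_max_left _ _

theorem radialCutoff_le_one (R : ℝ) (y : E) : radialCutoff R y ≤ 1 :=
  max_le zero_le_one (min_le_left _ _)

theorem radialCutoff_eq_one {R : ℝ} (hR : 0 < R) {y : E} (hy : ‖y‖ ≤ R) : radialCutoff R y = 1 := by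
  have h1 : ‖y‖ / R ≤ 1 := (div_le_one hR).2 hy
  rw [radialCutoff, min_eq_left (by linarith), max_eq_right zero_le_one]

theorem radialCutoff_eq_zero {R : ℝ} (hR : 0 < R) {y : E} (hy : 2 * R ≤ ‖y‖) :
    radialCutoff R y = 0 := by
  have h1 : 2 ≤ ‖y‖ / R := (le_div_iff₀ hR).2 hy
  rw [radialCutoff, max_eq_left]
  exact (min_le_right _ _).trans (by linarith)

theorem abs_radialCutoff_sub_le {R : ℝ} (hR : 0 < R) (y z : E) :
    |radialCutoff R y - radialCutoff R z| ≤ ‖y - z‖ / R := by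
  have h1 : |radialCutoff R y - radialCutoff R z| ≤ |(2 - ‖y‖ / R) - (2 - ‖z‖ / R)| := by
    refine (abs_max_sub_max_le_max _ _ _ _).trans ?_
    rw [sub_self, abs_zero]
    refine max_le (abs_nonneg _) ((abs_min_sub_min_le_max _ _ _ _).trans ?_)
    rw [sub_self, abs_zero]
    exact max_le (abs_nonneg _) le_rfl
  refine h1.trans ?_
  have h2 : (2 - ‖y‖ / R) - (2 - ‖z‖ / R) = (‖z‖ - ‖y‖) / R := by ring
  rw [h2, abs_div, abs_of_pos hR]
  gcongr
  rw [norm_sub_rev]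
  exact abs_norm_sub_norm_le z y

variable {A : ℝ → E → E} {T : ℝ} {K : NNReal}

theorem norm_le_of_lipschitz_of_zero {B : E → E} (hA : ∀ y z, ‖B y - B z‖ ≤ K * ‖y - z‖)
    (h0 : B 0 = 0) (y : E) : ‖B y‖ ≤ K * ‖y‖ := by
  simpa [h0] using hA y 0

/-- The constant is `K + 2 K`: the cutoff has slope at most `1 / R`, and where it matters the field
is bounded by `K * (2 * R)`. Ordering the two points by norm puts the smaller one inside the ball of
radius `2 * R`. -/
theorem lipschitzWith_radialCutoff_smul {R : ℝ} (hR : 0 < R) {B : E → E}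
    (hB : ∀ y z, ‖B y - B z‖ ≤ K * ‖y - z‖) (h0 : B 0 = 0) :
    LipschitzWith (3 * K) (fun y => radialCutoff R y • B y) := by
  refine LipschitzWith.of_dist_le_mul fun y z => ?_
  rw [dist_eq_norm, dist_eq_norm]
  push_cast
  wlog hyz : ‖z‖ ≤ ‖y‖ generalizing y z
  · rw [norm_sub_rev, norm_sub_rev y z]
    exact this z y (le_of_not_ge hyz)
  have hK : 0 ≤ (K : ℝ) * ‖y - z‖ := by positivity
  rcases le_total (2 * R) ‖z‖ with h | h
  · rw [radialCutoff_eq_zero hR h, radialCutoff_eq_zero hR (h.trans hyz)]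
    simp only [zero_smul, sub_self, norm_zero]
    linarith
  · have e1 : radialCutoff R y • B y - radialCutoff R z • B z = radialCutoff R y • (B y - B z) +
        (radialCutoff R y - radialCutoff R z) • B z := by module
    rw [e1]
    refine (norm_add_le _ _).trans ?_
    rw [norm_smul, norm_smul, Real.norm_eq_abs, Real.norm_eq_abs,
      abs_of_nonneg (radialCutoff_nonneg R y)]
    have h1 : radialCutoff R y * ‖B y - B z‖ ≤ K * ‖y - z‖ :=
      (mul_le_of_le_one_left (norm_nonneg _) (radialCutoff_le_one R y)).trans (hB y z)
    have h2 : |radialCutoff R y - radialCutoff R z| * ‖B z‖ ≤ ‖y - z‖ / R * (K * (2 * R)) := by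
      gcongr
      · exact abs_radialCutoff_sub_le hR y z
      · exact (norm_le_of_lipschitz_of_zero hB h0 z).trans (by gcongr)
    have h3 : ‖y - z‖ / R * (K * (2 * R)) = 2 * (K * ‖y - z‖) := by field_simp
    linarith

/-- Global existence for a time-dependent vector field of linear growth. -/
theorem exists_hasDerivAt_of_lipschitz (hT : 0 < T)
    (hA : ∀ t ∈ Icc (-T) T, ∀ y z, ‖A t y - A t z‖ ≤ K * ‖y - z‖) (h0 : ∀ t, A t 0 = 0)
    (hc : ∀ y, ContinuousOn (fun t => A t y) (Icc (-T) T)) (y₀ : E) :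
    ∃ Y : ℝ → E, Y 0 = y₀ ∧ ∀ t ∈ Ioo (-T) T, HasDerivAt Y (A t (Y t)) t := by
  -- Gronwall's inequality keeps solutions of the truncated equation inside the ball of radius `R`,
  -- where the cutoff equals one and has no effect.
  set R : ℝ := ‖y₀‖ * Real.exp (K * T) + 1 with hRdef
  have hR : 0 < R := by positivity
  have hRn : 0 ≤ R := hR.le
  set B : ℝ → E → E := fun t y => radialCutoff R y • A t y with hB
  have hAn : ∀ t ∈ Icc (-T) T, ∀ y, ‖A t y‖ ≤ K * ‖y‖ := fun t ht =>
    norm_le_of_lipschitz_of_zero (hA t ht) (h0 t)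
  have hBn : ∀ t ∈ Icc (-T) T, ∀ y, ‖B t y‖ ≤ K * ‖y‖ := fun t ht y => by
    rw [hB, norm_smul, Real.norm_of_nonneg (radialCutoff_nonneg R y)]
    exact (mul_le_of_le_one_left (norm_nonneg _) (radialCutoff_le_one R y)).trans (hAn t ht y)
  set L : NNReal := K * (2 * R.toNNReal) with hL
  have hLe : (L : ℝ) = K * (2 * R) := by simp [hL, Real.coe_toNNReal R hRn]
  have hT0 : (0 : ℝ) ∈ Icc (-T) T := ⟨by linarith, hT.le⟩
  -- The truncated field is bounded by `L = 2 K R`, so the radius `L * T` makes Picard-Lindelöf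
  -- valid on the whole interval instead of a short one.
  have hPL : IsPicardLindelof B (tmin := -T) (tmax := T) ⟨0, hT0⟩ y₀ (L * T.toNNReal) 0 L
      (3 * K) :=
    { lipschitzOnWith := fun t ht =>
        (lipschitzWith_radialCutoff_smul hR (hA t ht) (h0 t)).lipschitzOnWith
      continuousOn := fun y _ => continuousOn_const.smul (hc y)
      norm_le := fun t ht y _ => by
        rw [hLe]
        rcases le_total (2 * R) ‖y‖ with h | h
        · simp only [hB, radialCutoff_eq_zero hR h, zero_smul, norm_zero]
          positivity
        · exact (hBn t ht y).trans (by gcongr)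
      mul_max_le := by simp [Real.coe_toNNReal T hT.le] }
  obtain ⟨Y, hY0, hY⟩ := hPL.exists_eq_forall_mem_Icc_hasDerivWithinAt₀
  have hYd : ∀ t ∈ Ioo (-T) T, HasDerivAt Y (B t (Y t)) t := fun t ht =>
    (hY t (Ioo_subset_Icc_self ht)).hasDerivAt (Icc_mem_nhds ht.1 ht.2)
  have hYc : ContinuousOn Y (Icc (-T) T) := fun t ht => (hY t ht).continuousWithinAt
  have hest : ∀ s ∈ Icc 0 T, ∀ x, x ≤ ‖y₀‖ * Real.exp (K * s) → x ≤ R := fun s hs x hx => by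
    refine hx.trans ?_
    rw [hRdef]
    have : ‖y₀‖ * Real.exp (K * s) ≤ ‖y₀‖ * Real.exp (K * T) := by
      gcongr
      exact hs.2
    linarith
  have hpos : ∀ t ∈ Ico 0 T, ‖Y t‖ ≤ R := fun t ht => by
    have h1 := norm_le_gronwallBound_of_norm_deriv_right_le (f := Y)
      (f' := fun t => B t (Y t)) (δ := ‖y₀‖) (K := K) (ε := 0) (a := 0) (b := t)
      (hYc.mono (Icc_subset_Icc (by linarith) ht.2.le))
      (fun s hs => (hYd s ⟨by linarith [hs.1], hs.2.trans ht.2⟩).hasDerivWithinAt)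
      (by rw [hY0]) (fun s hs => by
        rw [add_zero]
        exact hBn s ⟨by linarith [hs.1], (hs.2.trans ht.2).le⟩ _) t ⟨ht.1, le_rfl⟩
    rw [gronwallBound_ε0, sub_zero] at h1
    exact hest t ⟨ht.1, ht.2.le⟩ _ h1
  have hneg : ∀ t ∈ Ico 0 T, ‖Y (-t)‖ ≤ R := fun t ht => by
    have hd : ∀ s ∈ Ico 0 T, HasDerivAt (fun s => Y (-s)) (-B (-s) (Y (-s))) s := fun s hs => by
      have h2 := (hYd (-s) ⟨by linarith [hs.2], by linarith [hs.1]⟩).scomp s (hasDerivAt_neg s)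
      rw [neg_one_smul] at h2
      exact h2
    have h1 := norm_le_gronwallBound_of_norm_deriv_right_le (f := fun s => Y (-s))
      (f' := fun s => -B (-s) (Y (-s))) (δ := ‖y₀‖) (K := K) (ε := 0) (a := 0) (b := t)
      (fun s hs => (hd s ⟨hs.1, hs.2.trans_lt ht.2⟩).continuousAt.continuousWithinAt)
      (fun s hs => (hd s ⟨hs.1, hs.2.trans ht.2⟩).hasDerivWithinAt)
      (by simp [hY0]) (fun s hs => by
        rw [add_zero, norm_neg]
        exact hBn (-s) ⟨by linarith [hs.2, ht.2], by linarith [hs.1]⟩ _) t ⟨ht.1, le_rfl⟩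
    rw [gronwallBound_ε0, sub_zero] at h1
    exact hest t ⟨ht.1, ht.2.le⟩ _ h1
  refine ⟨Y, hY0, fun t ht => ?_⟩
  have hYR : ‖Y t‖ ≤ R := by
    rcases le_total 0 t with h | h
    · exact hpos t ⟨h, ht.2⟩
    · simpa using hneg (-t) ⟨by linarith, by linarith [ht.1]⟩
  have h1 : B t (Y t) = A t (Y t) := by
    simp only [hB, radialCutoff_eq_one hR hYR, one_smul]
  exact h1 ▸ hYd t ht

/-- The constant `0` is a solution, so by uniqueness a solution that vanishes once vanishes at time
`0` too. -/
theorem ne_zero_of_hasDerivAt_of_lipschitz (hT : 0 < T)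
    (hA : ∀ t ∈ Icc (-T) T, ∀ y z, ‖A t y - A t z‖ ≤ K * ‖y - z‖) (h0 : ∀ t, A t 0 = 0)
    {Y : ℝ → E} (hY0 : Y 0 ≠ 0) (hY : ∀ t ∈ Ioo (-T) T, HasDerivAt Y (A t (Y t)) t) :
    ∀ t ∈ Ioo (-T) T, Y t ≠ 0 := by
  intro t ht hYt
  have h1 := ODE_solution_unique_of_mem_Ioo (v := A) (s := fun _ => univ) (K := K) (f := Y)
    (g := fun _ => 0) (a := -T) (b := T) (t₀ := t)
    (fun s hs => LipschitzWith.lipschitzOnWith (LipschitzWith.of_dist_le_mul fun y z => by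
      simpa [dist_eq_norm] using hA s (Ioo_subset_Icc_self hs) y z)) ht
    (fun s hs => ⟨hY s hs, mem_univ _⟩)
    (fun s hs => ⟨by simpa [h0] using hasDerivAt_const s (0 : E), mem_univ _⟩) hYt
  exact hY0 (h1 ⟨by linarith, hT⟩)

end LinearGrowth

/-! ### Parallel translation of a homogeneous connection along segments -/

section Transport

universe u

variable {E : Type u} [NormedAddCommGroup E] [NormedSpace ℝ E]

/-- The complement of the zero section in `E × E`. -/
def nonzeroVectors (E : Type*) [Zero E] : Set (E × E) := {z | z.2 ≠ 0}

theorem isOpen_nonzeroVectors : IsOpen (nonzeroVectors E) :=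
  isOpen_ne.preimage continuous_snd

/-- A homogeneous nonlinear connection on `E`, given by its coefficients `N (x, y) w`. -/
structure IsHomogeneousConnection (N : E × E → E →L[ℝ] E) : Prop where
  smooth : ContDiffOn ℝ ∞ N (nonzeroVectors E)
  homogeneous : ∀ (x y : E) (c : ℝ), 0 < c → N (x, c • y) = c • N (x, y)

namespace IsHomogeneousConnection

variable {N : E × E → E →L[ℝ] E} (h : IsHomogeneousConnection N)

include h in
theorem hasFDerivAt {z : E × E} (hz : z.2 ≠ 0) : HasFDerivAt N (fderiv ℝ N z) z :=
  ((h.smooth.contDiffAt (isOpen_nonzeroVectors.mem_nhds hz)).differentiableAt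
    (by simp)).hasFDerivAt

include h in
theorem fderiv_smul {x y : E} (hy : y ≠ 0) {c : ℝ} (hc : 0 < c) (v : E) :
    fderiv ℝ N (x, c • y) (0, v) = fderiv ℝ N (x, y) (0, v) := by
  have h1 : HasFDerivAt (fun y => N (x, c • y))
      ((fderiv ℝ N (x, c • y)).comp ((ContinuousLinearMap.inr ℝ E E).comp
        (c • ContinuousLinearMap.id ℝ E))) y :=
    HasFDerivAt.comp y (g := N) (f := fun y => (x, c • y)) (h.hasFDerivAt (smul_ne_zero hc.ne' hy))
      ((hasFDerivAt_prodMk_right x (c • y)).comp y ((hasFDerivAt_id y).const_smul c))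
  have h2 : HasFDerivAt (fun y => N (x, c • y))
      (c • (fderiv ℝ N (x, y)).comp (ContinuousLinearMap.inr ℝ E E)) y := by
    simp only [h.homogeneous x _ c hc]
    exact (HasFDerivAt.comp y (g := N) (f := fun y => (x, y)) (h.hasFDerivAt hy)
      (hasFDerivAt_prodMk_right x y)).const_smul c
  have h3 := congrArg (fun T : E →L[ℝ] (E →L[ℝ] E) => T v) (h1.unique h2)
  simp only [ContinuousLinearMap.comp_apply, smul_apply,
    ContinuousLinearMap.id_apply, ContinuousLinearMap.inr_apply, map_smul] at h3
  exact smul_right_injective _ hc.ne' h3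

variable [FiniteDimensional ℝ E]

include h in
-- `N` is homogeneous of degree one and its vertical derivative of degree zero, so both bounds
-- reduce to the compact set `C` times the unit sphere.
theorem exists_bound {C : Set E} (hC : IsCompact C) : ∃ K : NNReal, ∀ x ∈ C, ∀ y : E, y ≠ 0 →
    ‖N (x, y)‖ ≤ K * ‖y‖ ∧ ∀ v, ‖fderiv ℝ N (x, y) (0, v)‖ ≤ K * ‖v‖ := by
  have hS : IsCompact (C ×ˢ Metric.sphere (0 : E) 1) := hC.prod (isCompact_sphere 0 1)
  have hsub : C ×ˢ Metric.sphere (0 : E) 1 ⊆ nonzeroVectors E := by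
    rintro ⟨x, y⟩ ⟨-, hy⟩ (rfl : y = 0)
    simp at hy
  obtain ⟨K₁, hK₁⟩ := hS.exists_bound_of_continuousOn (h.smooth.continuousOn.mono hsub)
  obtain ⟨K₂, hK₂⟩ := hS.exists_bound_of_continuousOn
    ((h.smooth.continuousOn_fderiv_of_isOpen isOpen_nonzeroVectors (by simp)).mono hsub)
  refine ⟨(max K₁ K₂).toNNReal, fun x hx y hy => ?_⟩
  have hy0 : 0 < ‖y‖ := norm_pos_iff.2 hy
  have hmem : (x, ‖y‖⁻¹ • y) ∈ C ×ˢ Metric.sphere (0 : E) 1 :=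
    ⟨hx, by simp [norm_smul, hy0.ne']⟩
  have hyy : y = ‖y‖ • ‖y‖⁻¹ • y := by rw [smul_smul, mul_inv_cancel₀ hy0.ne', one_smul]
  constructor
  · calc ‖N (x, y)‖ = ‖y‖ * ‖N (x, ‖y‖⁻¹ • y)‖ := by
          conv_lhs => rw [hyy, h.homogeneous _ _ _ hy0, norm_smul, norm_norm]
      _ ≤ ‖y‖ * (max K₁ K₂).toNNReal := by
          gcongr
          exact (hK₁ _ hmem).trans ((le_max_left _ _).trans (Real.le_coe_toNNReal _))
      _ = _ := mul_comm _ _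
  · intro v
    rw [← h.fderiv_smul hy (inv_pos.2 hy0)]
    refine ((fderiv ℝ N (x, ‖y‖⁻¹ • y)).le_opNorm _).trans ?_
    have : ‖((0 : E), v)‖ = ‖v‖ := by simp [Prod.norm_def]
    rw [this]
    gcongr
    exact (hK₂ _ hmem).trans ((le_max_right _ _).trans (Real.le_coe_toNNReal _))

open Classical in
/-- The connection coefficients extended by zero to the zero section. -/
noncomputable def extendByZero (N : E × E → E →L[ℝ] E) (z : E × E) : E →L[ℝ] E :=
  if z.2 = 0 then 0 else N z

theorem extendByZero_of_ne {z : E × E} (hz : z.2 ≠ 0) : extendByZero N z = N z := if_neg hz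

theorem extendByZero_zero (x : E) : extendByZero N (x, 0) = 0 := if_pos rfl

include h in
-- Smoothness fails at the zero section, so the mean value inequality covers only segments avoiding
-- `0`. If `0` lies on the segment from `y` to `z`, then `‖y‖ + ‖z‖ = ‖y - z‖` and linear growth
-- suffices.
theorem exists_lipschitz {C : Set E} (hC : IsCompact C) : ∃ K : NNReal, ∀ x ∈ C, ∀ y z : E,
    ‖extendByZero N (x, y) - extendByZero N (x, z)‖ ≤ K * ‖y - z‖ := by
  obtain ⟨K, hK⟩ := h.exists_bound hC
  have hn : ∀ x ∈ C, ∀ y, ‖extendByZero N (x, y)‖ ≤ K * ‖y‖ := fun x hx y => by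
    rcases eq_or_ne y 0 with rfl | hy
    · simp [extendByZero_zero]
    · rw [extendByZero_of_ne hy]
      exact (hK x hx y hy).1
  refine ⟨K, fun x hx y z => ?_⟩
  by_cases hseg : (0 : E) ∈ segment ℝ y z
  · have h1 := dist_add_dist_of_mem_segment hseg
    rw [dist_zero_right, dist_zero_left, dist_eq_norm] at h1
    refine (norm_sub_le _ _).trans ((add_le_add (hn x hx y) (hn x hx z)).trans ?_)
    rw [← mul_add, h1]
  · have hne : ∀ v ∈ segment ℝ y z, v ≠ 0 := fun v hv h0 => hseg (h0 ▸ hv)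
    rw [extendByZero_of_ne (hne y (left_mem_segment ℝ y z)),
      extendByZero_of_ne (hne z (right_mem_segment ℝ y z))]
    refine (convex_segment y z).norm_image_sub_le_of_norm_hasFDerivWithin_le
      (f := fun y => N (x, y))
      (f' := fun y => (fderiv ℝ N (x, y)).comp (ContinuousLinearMap.inr ℝ E E)) (fun v hv => ?_)
      (fun v hv => ?_) (right_mem_segment ℝ y z) (left_mem_segment ℝ y z)
    · exact (HasFDerivAt.comp v (g := N) (f := fun y => (x, y)) (h.hasFDerivAt (hne v hv))
        (hasFDerivAt_prodMk_right x v)).hasFDerivWithinAt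
    · exact ContinuousLinearMap.opNorm_le_bound _ K.2 fun u => (hK x hx v (hne v hv)).2 u

include h in
-- The interval `(-2, 2)` contains `[0, 1]` in its interior, which makes two-sided derivatives
-- available at both ends.
theorem exists_parallel (w x : E) {y : E} (hy : y ≠ 0) : ∃ Y : ℝ → E, Y 0 = y ∧
    ∀ t ∈ Ioo (-2 : ℝ) 2, HasDerivAt Y (-N (x + t • w, Y t) w) t ∧ Y t ≠ 0 := by
  have hC : IsCompact ((fun t : ℝ => x + t • w) '' Icc (-2) 2) :=
    isCompact_Icc.image (by fun_prop)
  obtain ⟨K, hK⟩ := h.exists_lipschitz hC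
  set A : ℝ → E → E := fun t y => -extendByZero N (x + t • w, y) w with hA
  have hAl : ∀ t ∈ Icc (-2 : ℝ) 2, ∀ y z, ‖A t y - A t z‖ ≤ (K * ‖w‖₊ : NNReal) * ‖y - z‖ := by
    intro t ht y z
    have h1 := hK _ (mem_image_of_mem _ ht) y z
    have e : A t y - A t z =
        -((extendByZero N (x + t • w, y) - extendByZero N (x + t • w, z)) w) := by
      simp [hA]; abel
    rw [e, norm_neg]
    refine (ContinuousLinearMap.le_opNorm _ _).trans ?_
    calc _ ≤ (K * ‖y - z‖) * ‖w‖ := by gcongr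
      _ = _ := by push_cast; ring
  have hA0 : ∀ t, A t 0 = 0 := fun t => by simp [hA, extendByZero_zero]
  have hc : ∀ y, ContinuousOn (fun t => A t y) (Icc (-2 : ℝ) 2) := fun y => by
    rcases eq_or_ne y 0 with rfl | hy
    · simp only [hA0]; exact continuousOn_const
    · have e : ∀ t, A t y = -N (x + t • w, y) w := fun t => by
        simp only [hA, extendByZero_of_ne (z := (x + t • w, y)) hy]
      simp only [e]
      have h1 : Continuous fun t : ℝ => N (x + t • w, y) :=
        h.smooth.continuousOn.comp_continuous (by fun_prop) fun t => hy
      exact ((h1.clm_apply continuous_const).neg).continuousOn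
  obtain ⟨Y, hY0, hY⟩ := exists_hasDerivAt_of_lipschitz two_pos hAl hA0 hc y
  have hne := ne_zero_of_hasDerivAt_of_lipschitz two_pos hAl hA0 (hY0 ▸ hy) hY
  refine ⟨Y, hY0, fun t ht => ⟨?_, hne t ht⟩⟩
  have h1 := hY t ht
  simp only [hA, extendByZero_of_ne (z := (x + t • w, Y t)) (hne t ht)] at h1
  exact h1

end IsHomogeneousConnection

open Classical in
/-- `transport N w x y` is the parallel translate of `y` along the segment from `x` to `x + w`. -/
noncomputable def transport (N : E × E → E →L[ℝ] E) (w x y : E) : E :=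
  if h : ∃ Y : ℝ → E, Y 0 = y ∧
    ∀ t ∈ Ioo (-2 : ℝ) 2, HasDerivAt Y (-N (x + t • w, Y t) w) t ∧ Y t ≠ 0 then
  h.choose 1 else 0

/-- The vector field on `E × E × E` whose flow is `t ↦ (w, x + t w, transport N (t w) x y)`. -/
noncomputable def transportField (N : E × E → E →L[ℝ] E) (p : E × E × E) : E × E × E :=
  (0, p.1, -N p.2 p.1)

namespace IsHomogeneousConnection

variable {N : E × E → E →L[ℝ] E} (h : IsHomogeneousConnection N)

theorem isOpen_preimage_nonzeroVectors :
    IsOpen {p : E × E × E | p.2.2 ≠ 0} := isOpen_ne.preimage (continuous_snd.comp continuous_snd)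

include h in
theorem contDiffOn_transportField :
    ContDiffOn ℝ ∞ (transportField N) {p : E × E × E | p.2.2 ≠ 0} := by
  have h1 : ContDiffOn ℝ ∞ (fun p : E × E × E => N p.2) {p : E × E × E | p.2.2 ≠ 0} :=
    h.smooth.comp contDiffOn_snd fun p hp => hp
  exact contDiffOn_const.prodMk (contDiffOn_fst.prodMk (h1.clm_apply contDiffOn_fst).neg)

theorem hasDerivAt_lift {w x : E} {c : ℝ} {γ : ℝ → E} {t : ℝ}
    (hγ : HasDerivAt γ (-N (x + (t * c) • w, γ t) (c • w)) t) :
    HasDerivAt (fun t => (w, x + (t * c) • w, γ t))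
      (c • transportField N (w, x + (t * c) • w, γ t)) t := by
  have h1 : HasDerivAt (fun t : ℝ => x + (t * c) • w) (c • w) t := by
    simpa using (((hasDerivAt_id t).mul_const c).smul_const w).const_add x
  have h2 := (hasDerivAt_const t w).prodMk (h1.prodMk hγ)
  convert! h2 using 1
  simp [transportField]

variable [FiniteDimensional ℝ E]

include h in
-- Adjoining `w` and the moving foot point as unknowns makes the equation autonomous, and uniqueness
-- of integral curves applies. In particular the value of `transport` does not depend on the choice
-- made in its definition.
theorem transport_eq {w x : E} {γ : ℝ → E} (hγ0 : γ 0 ≠ 0)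
    (hγ : ∀ t ∈ Icc (0 : ℝ) 1, HasDerivAt γ (-N (x + t • w, γ t) w) t ∧ γ t ≠ 0) :
    γ 1 = transport N w x (γ 0) := by
  have hex := h.exists_parallel w x hγ0
  rw [transport, dif_pos hex]
  obtain ⟨hY0, hY⟩ := hex.choose_spec
  set Y := hex.choose
  have hsub : ∀ t ∈ Icc (0 : ℝ) 1, t ∈ Ioo (-2 : ℝ) 2 := fun t ht =>
    ⟨by linarith [ht.1], by linarith [ht.2]⟩
  have hl : ∀ {γ : ℝ → E} {t : ℝ}, HasDerivAt γ (-N (x + t • w, γ t) w) t →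
      HasDerivAt (fun t => (w, x + t • w, γ t)) (transportField N (w, x + t • w, γ t)) t :=
    fun {γ t} hγ => by
      have h1 := hasDerivAt_lift (N := N) (w := w) (x := x) (c := 1) (γ := γ) (t := t)
        (by simpa using hγ)
      simpa using h1
  have h1 := eqOn_Icc_of_hasDerivWithinAt isOpen_preimage_nonzeroVectors
    (h.contDiffOn_transportField.of_le (by exact_mod_cast le_top)) (a := 0) (b := 1)
    (γ := fun t => (w, x + t • w, γ t)) (δ := fun t => (w, x + t • w, Y t))
    (fun t ht => (hl (hγ t ht).1).continuousAt.continuousWithinAt)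
    (fun t ht => (hl (hγ t (Ico_subset_Icc_self ht)).1).hasDerivWithinAt)
    (fun t ht => (hγ t ht).2)
    (fun t ht => (hl (hY t (hsub t ht)).1).continuousAt.continuousWithinAt)
    (fun t ht => (hl (hY t (hsub t (Ico_subset_Icc_self ht))).1).hasDerivWithinAt)
    (fun t ht => (hY t (hsub t ht)).2) (by simp [hY0]) (right_mem_Icc.2 zero_le_one)
  exact congrArg (fun p : E × E × E => p.2.2) h1

include h in
-- Translation along `t • w` follows the parallel field of `w` at speed `t`, so a single curve gives
-- all these translates.
theorem exists_transport_smul_eq (w x : E) {y : E} (hy : y ≠ 0) : ∃ Y : ℝ → E,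
    (∀ t ∈ Ioo (-2 : ℝ) 2, HasDerivAt Y (-N (x + t • w, Y t) w) t ∧ Y t ≠ 0) ∧
      ∀ t ∈ Ioo (-2 : ℝ) 2, transport N (t • w) x y = Y t := by
  obtain ⟨Y, hY0, hY⟩ := h.exists_parallel w x hy
  refine ⟨Y, hY, fun t ht => ?_⟩
  have hst : ∀ s ∈ Icc (0 : ℝ) 1, t * s ∈ Ioo (-2 : ℝ) 2 := fun s hs => by
    have h1 : |t * s| < 2 := by
      rw [abs_mul, abs_of_nonneg hs.1]
      exact (mul_le_of_le_one_right (abs_nonneg _) hs.2).trans_lt (abs_lt.2 ht)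
    exact abs_lt.1 h1
  have h1 := h.transport_eq (w := t • w) (x := x) (γ := fun s => Y (t * s)) (by simpa [hY0] using hy)
    fun s hs => ⟨?_, (hY _ (hst s hs)).2⟩
  · simpa [hY0] using h1.symm
  · have h2 := (hY _ (hst s hs)).1.scomp s (h := fun s => t * s)
      (by simpa using (hasDerivAt_id s).const_mul t)
    convert! h2 using 1
    rw [smul_smul, mul_comm s t, map_smul, smul_neg]

include h in
theorem transport_zero (x : E) {y : E} (hy : y ≠ 0) : transport N 0 x y = y := by
  have := h.transport_eq (w := 0) (x := x) (γ := fun _ => y) hy fun t _ =>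
    ⟨by simpa using hasDerivAt_const t y, hy⟩
  exact this.symm

include h in
theorem transport_ne_zero (w x : E) {y : E} (hy : y ≠ 0) : transport N w x y ≠ 0 := by
  obtain ⟨Y, hY, hYt⟩ := h.exists_transport_smul_eq w x hy
  have h1 := hYt 1 (by norm_num)
  rw [one_smul] at h1
  rw [h1]
  exact (hY 1 (by norm_num)).2

include h in
theorem hasDerivAt_transport (w x : E) {y : E} (hy : y ≠ 0) (t : ℝ) :
    HasDerivAt (fun t : ℝ => transport N (t • w) x y)
      (-N (x + t • w, transport N (t • w) x y) w) t := by
  -- Solutions are only known for times in `(-2, 2)`; replacing `w` by `c • w` with `c > |t|` brings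
  -- the time `t` to `c⁻¹ * t`, within that range.
  set c : ℝ := |t| + 1 with hc
  have hc0 : 0 < c := by positivity
  have hct : ∀ t : ℝ, (c⁻¹ * t) • c • w = t • w := fun t => by
    rw [smul_smul, mul_comm c⁻¹, mul_assoc, inv_mul_cancel₀ hc0.ne', mul_one]
  have htc : c⁻¹ * t ∈ Ioo (-2 : ℝ) 2 := by
    refine abs_lt.1 ?_
    rw [abs_mul, abs_inv, abs_of_pos hc0, inv_mul_lt_iff₀ hc0]
    linarith [abs_nonneg t]
  obtain ⟨Y, hY, hYt⟩ := h.exists_transport_smul_eq (c • w) x hy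
  have h1 := (hY _ htc).1.scomp t (h := fun t => c⁻¹ * t)
      (by simpa using (hasDerivAt_id t).const_mul c⁻¹)
  have h2 : (fun t : ℝ => transport N (t • w) x y) =ᶠ[𝓝 t] fun t => Y (c⁻¹ * t) := by
    have hev : ∀ᶠ s in 𝓝 t, c⁻¹ * s ∈ Ioo (-2 : ℝ) 2 :=
      (continuous_const_mul c⁻¹).continuousAt.eventually (isOpen_Ioo.mem_nhds htc)
    filter_upwards [hev] with s hs
    rw [← hYt _ hs, hct]
  have h3 := h1.congr_of_eventuallyEq h2
  convert! h3 using 1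
  rw [show transport N (t • w) x y = Y (c⁻¹ * t) from h2.self_of_nhds, hct, map_smul, smul_neg, smul_smul, inv_mul_cancel₀ hc0.ne', one_smul]

include h in
-- With direction and foot point part of the state, dependence on all data becomes dependence on the
-- initial point, and the time-one map contains `transport`.
theorem isFlowOn_transport : IsFlowOn {p : E × E × E | p.2.2 ≠ 0} (transportField N)
    fun t p => (p.1, p.2.1 + t • p.1, transport N (t • p.1) p.2.1 p.2.2) where
  mem t p hp := h.transport_ne_zero _ _ hp
  zero p hp := by simp [h.transport_zero _ hp]
  hasDerivAt t p hp := by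
    have h1 := hasDerivAt_lift (N := N) (w := p.1) (x := p.2.1) (c := 1) (t := t)
      (γ := fun t => transport N (t • p.1) p.2.1 p.2.2)
      (by simpa using h.hasDerivAt_transport p.1 p.2.1 hp t)
    simpa using h1

include h in
/-- Parallel translation depends smoothly on all its data. -/
theorem contDiffOn_transport : ContDiffOn ℝ ∞
    (fun p : E × E × E => transport N p.1 p.2.1 p.2.2) {p : E × E × E | p.2.2 ≠ 0} := by
  have h1 := h.isFlowOn_transport.contDiffOn isOpen_preimage_nonzeroVectors
    h.contDiffOn_transportField
  simp only [one_smul] at h1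
  exact h1.snd.snd

include h in
-- The parallel field run backwards, `t ↦ transport N ((1 - t) • w) x y`, is parallel in the
-- direction `-w`.
theorem transport_neg (w x : E) {y : E} (hy : y ≠ 0) :
    transport N (-w) (x + w) (transport N w x y) = y := by
  have h1 := h.transport_eq (w := -w) (x := x + w)
    (γ := fun t => transport N ((1 - t) • w) x y) (h.transport_ne_zero _ _ hy) fun t _ =>
      ⟨?_, h.transport_ne_zero _ _ hy⟩
  · simpa [h.transport_zero x hy] using h1.symm
  · have h2 := (h.hasDerivAt_transport w x hy (1 - t)).scomp t (h := fun t => 1 - t)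
      (by simpa using (hasDerivAt_id t).const_sub 1)
    convert! h2 using 1
    have e : x + w + t • -w = x + (1 - t) • w := by module
    rw [e, map_neg, neg_smul, one_smul]

include h in
theorem transport_smul (w x : E) {y : E} (hy : y ≠ 0) {c : ℝ} (hc : 0 < c) :
    transport N w x (c • y) = c • transport N w x y := by
  have hne : ∀ t : ℝ, c • transport N (t • w) x y ≠ 0 := fun t =>
    smul_ne_zero hc.ne' (h.transport_ne_zero _ _ hy)
  have h1 := h.transport_eq (w := w) (x := x)
    (γ := fun t => c • transport N (t • w) x y) (hne 0) fun t _ => ⟨?_, hne t⟩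
  · simpa [h.transport_zero x hy] using h1.symm
  · convert! (h.hasDerivAt_transport w x hy t).const_smul c using 1
    rw [h.homogeneous _ _ c hc, smul_apply, smul_neg]

include h in
/-- Parallel translation preserves the functions that are constant along the horizontal lifts. -/
theorem apply_transport {L : E × E → ℝ} (hL : DifferentiableOn ℝ L (nonzeroVectors E))
    (hLN : ∀ z ∈ nonzeroVectors E, ∀ w, fderiv ℝ L z (w, -N z w) = 0) (w x : E) {y : E}
    (hy : y ≠ 0) : L (x + w, transport N w x y) = L (x, y) := by
  have hd : ∀ t : ℝ, HasDerivAt (fun t : ℝ => L (x + t • w, transport N (t • w) x y)) 0 t := by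
    intro t
    have hne := h.transport_ne_zero (t • w) x hy
    have h1 : HasDerivAt (fun t : ℝ => x + t • w) w t := by
      simpa using ((hasDerivAt_id t).smul_const w).const_add x
    have h2 := ((hL.differentiableAt (isOpen_nonzeroVectors.mem_nhds hne)).hasFDerivAt
      (x := (x + t • w, transport N (t • w) x y))).comp_hasDerivAt t
        (h1.prodMk (h.hasDerivAt_transport w x hy t))
    rw [hLN _ hne] at h2
    exact h2
  have h3 := is_const_of_deriv_eq_zero (fun t => (hd t).differentiableAt) (fun t => (hd t).deriv) 1 0
  simpa [h.transport_zero x hy] using h3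

/-- The horizontal lift of the constant vector field `a`. -/
def constantLift (N : E × E → E →L[ℝ] E) (a : E) (z : E × E) : E × E := (a, -N z a)

/-- Parallel translation in the direction `a`. -/
noncomputable def translation (N : E × E → E →L[ℝ] E) (a : E) (s : ℝ) (z : E × E) : E × E :=
  (z.1 + s • a, transport N (s • a) z.1 z.2)

include h in
theorem contDiffOn_translation {G : Type*} [NormedAddCommGroup G] [NormedSpace ℝ G] {a : G → E}
    {s : G → ℝ} {z : G → E × E} {S : Set G} (ha : ContDiffOn ℝ ∞ a S) (hs : ContDiffOn ℝ ∞ s S)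
    (hz : ContDiffOn ℝ ∞ z S) (hmem : ∀ g ∈ S, z g ∈ nonzeroVectors E) :
    ContDiffOn ℝ ∞ (fun g => translation N (a g) (s g) (z g)) S := by
  refine (hz.fst.add (hs.smul ha)).prodMk ?_
  exact h.contDiffOn_transport.comp ((hs.smul ha).prodMk (hz.fst.prodMk hz.snd)) hmem

include h in
-- Translations move the foot points, so they are not fibred holonomy themselves; they are the
-- order-one families from which commutators are formed.
theorem localFamily_translation (a : E) : LocalFamily (nonzeroVectors E) 1 (constantLift N a)
    (translation N a) (translation N (-a)) where
  pos := one_pos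
  smooth := h.contDiffOn_translation contDiffOn_const contDiffOn_fst contDiffOn_snd fun p hp => hp.2
  smooth_inv := h.contDiffOn_translation contDiffOn_const contDiffOn_fst contDiffOn_snd
    fun p hp => hp.2
  mem s z hz := h.transport_ne_zero _ _ hz
  mem_inv s z hz := h.transport_ne_zero _ _ hz
  left_inv s z hz := by
    simp only [translation, smul_neg, h.transport_neg _ _ hz, add_neg_cancel_right]
  right_inv s z hz := by
    have h1 := h.transport_neg (s • -a) z.1 hz
    rw [smul_neg, neg_neg] at h1
    simp only [translation, smul_neg, h1, neg_add_cancel_right]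
  isLittleO z hz := by
    have h1 : HasDerivAt (fun t : ℝ => z.1 + t • a) a 0 := by
      simpa using ((hasDerivAt_id (0 : ℝ)).smul_const a).const_add z.1
    have h2 := h1.prodMk (h.hasDerivAt_transport a z.1 hz 0)
    rw [hasDerivAt_iff_isLittleO] at h2
    simp only [zero_smul, add_zero, h.transport_zero _ hz, sub_zero] at h2
    simp only [pow_one]
    exact h2

end IsHomogeneousConnection

end Transport

/-! ### Energies, sprays and horizontal directions -/

section Energy

universe u

variable {E : Type u} [NormedAddCommGroup E] [NormedSpace ℝ E]

/-- The nonzero vectors with foot point in `W`. -/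
def nonzeroVectorsOver (W : Set E) : Set (E × E) := {z | z.1 ∈ W ∧ z.2 ≠ 0}

/-- The energy `e = L²/2` of a Finsler function over an open set `W`. -/
structure IsEnergy (W : Set E) (e : E × E → ℝ) : Prop where
  isOpen : IsOpen W
  smooth : ContDiffOn ℝ ∞ e (nonzeroVectorsOver W)
  homogeneous : ∀ z ∈ nonzeroVectorsOver W, ∀ c : ℝ, 0 < c → e (z.1, c • z.2) = c ^ 2 * e z
  nondegenerate : ∀ z ∈ nonzeroVectorsOver W, ∀ u,
    (∀ v, fderiv ℝ (fderiv ℝ e) z (0, u) (0, v) = 0) → u = 0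

/-- The Euler-Lagrange equations for the geodesic coefficients `G` of the energy `e`. -/
def IsSpray (W : Set E) (e : E × E → ℝ) (G : E × E → E) : Prop :=
  ∀ z ∈ nonzeroVectorsOver W, ∀ v, fderiv ℝ (fderiv ℝ e) z (0, (2 : ℝ) • G z) (0, v) =
    fderiv ℝ (fderiv ℝ e) z (z.2, 0) (0, v) - fderiv ℝ e z (v, 0)

theorem isOpen_nonzeroVectorsOver {W : Set E} (hW : IsOpen W) : IsOpen (nonzeroVectorsOver W) :=
  (hW.preimage continuous_fst).inter (isOpen_ne.preimage continuous_snd)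

namespace IsEnergy

variable {W : Set E} {e : E × E → ℝ} {G : E × E → E} (h : IsEnergy W e)

include h in
theorem mem_nhds {z : E × E} (hz : z ∈ nonzeroVectorsOver W) : nonzeroVectorsOver W ∈ 𝓝 z :=
  (isOpen_nonzeroVectorsOver h.isOpen).mem_nhds hz

include h in
theorem contDiffAt {z : E × E} (hz : z ∈ nonzeroVectorsOver W) : ContDiffAt ℝ ∞ e z :=
  h.smooth.contDiffAt (h.mem_nhds hz)

include h in
theorem contDiffOn_fderiv : ContDiffOn ℝ ∞ (fderiv ℝ e) (nonzeroVectorsOver W) :=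
  h.smooth.fderiv_of_isOpen (isOpen_nonzeroVectorsOver h.isOpen) (by simp)

include h in
theorem contDiffOn_fderiv_fderiv :
    ContDiffOn ℝ ∞ (fderiv ℝ (fderiv ℝ e)) (nonzeroVectorsOver W) :=
  h.contDiffOn_fderiv.fderiv_of_isOpen (isOpen_nonzeroVectorsOver h.isOpen) (by simp)

include h in
theorem hasFDerivAt {z : E × E} (hz : z ∈ nonzeroVectorsOver W) :
    HasFDerivAt e (fderiv ℝ e z) z :=
  ((h.contDiffAt hz).differentiableAt (by simp)).hasFDerivAt

include h in
theorem hasFDerivAt_fderiv {z : E × E} (hz : z ∈ nonzeroVectorsOver W) :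
    HasFDerivAt (fderiv ℝ e) (fderiv ℝ (fderiv ℝ e) z) z :=
  ((h.contDiffOn_fderiv.contDiffAt (h.mem_nhds hz)).differentiableAt (by simp)).hasFDerivAt

include h in
theorem hasFDerivAt_fderiv_fderiv {z : E × E} (hz : z ∈ nonzeroVectorsOver W) :
    HasFDerivAt (fderiv ℝ (fderiv ℝ e)) (fderiv ℝ (fderiv ℝ (fderiv ℝ e)) z) z :=
  ((h.contDiffOn_fderiv_fderiv.contDiffAt (h.mem_nhds hz)).differentiableAt (by simp)).hasFDerivAt

include h in
theorem symm {z : E × E} (hz : z ∈ nonzeroVectorsOver W) (a b : E × E) :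
    fderiv ℝ (fderiv ℝ e) z a b = fderiv ℝ (fderiv ℝ e) z b a :=
  ((h.contDiffAt hz).isSymmSndFDerivAt
    (by simpa using ENat.LEInfty.out)) a b

include h in
theorem smul_mem {z : E × E} (hz : z ∈ nonzeroVectorsOver W) {c : ℝ} (hc : 0 < c) :
    (z.1, c • z.2) ∈ nonzeroVectorsOver W := ⟨hz.1, smul_ne_zero hc.ne' hz.2⟩

include h in
/-- Euler's identity for `e`. -/
theorem fderiv_self {z : E × E} (hz : z ∈ nonzeroVectorsOver W) :
    fderiv ℝ e z (0, z.2) = 2 * e z := by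
  have h1 : HasDerivAt (fun c : ℝ => (z.1, c • z.2)) (0, z.2) 1 := by
    simpa using (hasDerivAt_const (1 : ℝ) z.1).prodMk ((hasDerivAt_id (1 : ℝ)).smul_const z.2)
  have h2 : HasDerivAt (fun c : ℝ => e (z.1, c • z.2)) (fderiv ℝ e z (0, z.2)) 1 :=
    HasFDerivAt.comp_hasDerivAt (f := fun c : ℝ => (z.1, c • z.2)) (1 : ℝ)
      (by simpa using h.hasFDerivAt hz) h1
  have h3 : HasDerivAt (fun c : ℝ => c ^ 2 * e z) (2 * e z) 1 := by
    simpa using (hasDerivAt_pow 2 (1 : ℝ)).mul_const (e z)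
  refine h2.unique (h3.congr_of_eventuallyEq ?_)
  filter_upwards [lt_mem_nhds one_pos] with c hc using h.homogeneous z hz c hc

include h in
/-- Euler's identity for the derivative of `e`. -/
theorem fderiv_fderiv_self {z : E × E} (hz : z ∈ nonzeroVectorsOver W) (w v : E) :
    fderiv ℝ (fderiv ℝ e) z (w, v) (0, z.2) = 2 * fderiv ℝ e z (w, v) - fderiv ℝ e z (0, v) := by
  have h1 : HasFDerivAt (fun z : E × E => ((0 : E), z.2))
      ((ContinuousLinearMap.inr ℝ E E).comp (ContinuousLinearMap.snd ℝ E E)) z :=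
    ((ContinuousLinearMap.inr ℝ E E).comp (ContinuousLinearMap.snd ℝ E E)).hasFDerivAt
  have h2 := (h.hasFDerivAt_fderiv hz).clm_apply h1
  have h3 := (h.hasFDerivAt hz).const_mul (2 : ℝ)
  have h4 : (fun z => fderiv ℝ e z (0, z.2)) =ᶠ[𝓝 z] fun z => 2 * e z := by
    filter_upwards [h.mem_nhds hz] with z hz using h.fderiv_self hz
  have h5 := congrArg (fun T : E × E →L[ℝ] ℝ => T (w, v))
    (h2.unique (h3.congr_of_eventuallyEq h4))
  simp at h5
  linarith

include h in
theorem fderiv_fderiv_snd_self {z : E × E} (hz : z ∈ nonzeroVectorsOver W) (v : E) :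
    fderiv ℝ (fderiv ℝ e) z (0, v) (0, z.2) = fderiv ℝ e z (0, v) := by
  rw [h.fderiv_fderiv_self hz]; ring

include h in
theorem fderiv_fderiv_fst_self {z : E × E} (hz : z ∈ nonzeroVectorsOver W) (w : E) :
    fderiv ℝ (fderiv ℝ e) z (w, 0) (0, z.2) = 2 * fderiv ℝ e z (w, 0) := by
  rw [h.fderiv_fderiv_self hz, show ((0 : E), (0 : E)) = 0 from rfl, map_zero, sub_zero]

include h in
theorem fderiv_fderiv_fderiv_self {z : E × E} (hz : z ∈ nonzeroVectorsOver W) (w v : E) :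
    fderiv ℝ (fderiv ℝ (fderiv ℝ e)) z (w, 0) (0, v) (0, z.2) =
      fderiv ℝ (fderiv ℝ e) z (w, 0) (0, v) := by
  have h1 : HasFDerivAt (fun z : E × E => ((0 : E), z.2))
      ((ContinuousLinearMap.inr ℝ E E).comp (ContinuousLinearMap.snd ℝ E E)) z :=
    ((ContinuousLinearMap.inr ℝ E E).comp (ContinuousLinearMap.snd ℝ E E)).hasFDerivAt
  have h2 := ((h.hasFDerivAt_fderiv_fderiv hz).clm_apply
    (hasFDerivAt_const ((0 : E), v) z)).clm_apply h1
  have h3 := (h.hasFDerivAt_fderiv hz).clm_apply (hasFDerivAt_const ((0 : E), v) z)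
  have h4 : (fun z => fderiv ℝ (fderiv ℝ e) z (0, v) (0, z.2)) =ᶠ[𝓝 z]
      fun z => fderiv ℝ e z (0, v) := by
    filter_upwards [h.mem_nhds hz] with z hz using h.fderiv_fderiv_snd_self hz v
  have h5 := congrArg (fun T : E × E →L[ℝ] ℝ => T (w, 0))
    (h2.unique (h3.congr_of_eventuallyEq h4))
  have h6 : ((0 : E), (0 : E)) = 0 := rfl
  simpa [h6] using h5

/-! ### The spray -/

include h in
theorem eq_of_forall_fderiv_fderiv {z : E × E} (hz : z ∈ nonzeroVectorsOver W) {a b : E}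
    (hab : ∀ v, fderiv ℝ (fderiv ℝ e) z (0, a) (0, v) = fderiv ℝ (fderiv ℝ e) z (0, b) (0, v)) :
    a = b := by
  refine sub_eq_zero.1 (h.nondegenerate z hz _ fun v => ?_)
  have : ((0 : E), a - b) = (0, a) - (0, b) := by simp
  rw [this, map_sub, sub_apply, hab v, sub_self]

include h in
-- Put `v = y` in the Euler-Lagrange equations and simplify with Euler's identities.
theorem fderiv_spray (hG : IsSpray W e G) {z : E × E} (hz : z ∈ nonzeroVectorsOver W) :
    fderiv ℝ e z (0, (2 : ℝ) • G z) = fderiv ℝ e z (z.2, 0) := by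
  have h1 := hG z hz z.2
  rw [h.fderiv_fderiv_snd_self hz, h.fderiv_fderiv_fst_self hz] at h1
  linarith

include h in
/-- The energy is constant along the horizontal directions. -/
theorem fderiv_horizontal (hG : IsSpray W e G) {z : E × E} (hz : z ∈ nonzeroVectorsOver W)
    (hGd : DifferentiableAt ℝ G z) (w : E) : fderiv ℝ e z (w, -fderiv ℝ G z (0, w)) = 0 := by
  have h1 : HasFDerivAt (fun z : E × E => ((0 : E), (2 : ℝ) • G z))
      ((ContinuousLinearMap.inr ℝ E E).comp ((2 : ℝ) • fderiv ℝ G z)) z :=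
    (ContinuousLinearMap.inr ℝ E E).hasFDerivAt.comp z (hGd.hasFDerivAt.const_smul (2 : ℝ))
  have h2 := (h.hasFDerivAt_fderiv hz).clm_apply h1
  have h3 : HasFDerivAt (fun z : E × E => (z.2, (0 : E)))
      ((ContinuousLinearMap.inl ℝ E E).comp (ContinuousLinearMap.snd ℝ E E)) z :=
    ((ContinuousLinearMap.inl ℝ E E).comp (ContinuousLinearMap.snd ℝ E E)).hasFDerivAt
  have h4 := (h.hasFDerivAt_fderiv hz).clm_apply h3
  -- Differentiating this identity in the vertical direction `w` and subtracting the Euler-Lagrange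
  -- equations for `w` leaves twice the claim.
  have h5 : (fun z => fderiv ℝ e z (0, (2 : ℝ) • G z)) =ᶠ[𝓝 z] fun z => fderiv ℝ e z (z.2, 0) := by
    filter_upwards [h.mem_nhds hz] with z hz using h.fderiv_spray hG hz
  have h6 := congrArg (fun T : E × E →L[ℝ] ℝ => T (0, w))
    (h2.unique (h4.congr_of_eventuallyEq h5))
  have h7 := hG z hz w
  rw [h.symm hz, h.symm hz (z.2, 0)] at h7
  simp only [add_apply, ContinuousLinearMap.comp_apply, ContinuousLinearMap.flip_apply,
    ContinuousLinearMap.inr_apply, ContinuousLinearMap.inl_apply, smul_apply,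
    ContinuousLinearMap.coe_snd'] at h6
  have e1 : ((0 : E), (2 : ℝ) • fderiv ℝ G z (0, w)) = (2 : ℝ) • ((0 : E), fderiv ℝ G z (0, w)) := by
    simp
  have e2 : (w, -fderiv ℝ G z (0, w)) = (w, 0) - ((0 : E), fderiv ℝ G z (0, w)) := by simp
  rw [e1, map_smul, smul_eq_mul] at h6
  rw [e2, map_sub]
  linarith

variable [FiniteDimensional ℝ E]

/-- The vertical Hessian as a map `E → E*`. -/
noncomputable def verticalHessian (e : E × E → ℝ) (z : E × E) : E →L[ℝ] E →L[ℝ] ℝ :=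
  ((ContinuousLinearMap.compL ℝ E (E × E) ℝ).flip (ContinuousLinearMap.inr ℝ E E)).comp
    ((fderiv ℝ (fderiv ℝ e) z).comp (ContinuousLinearMap.inr ℝ E E))

theorem verticalHessian_apply (z : E × E) (u v : E) :
    verticalHessian e z u v = fderiv ℝ (fderiv ℝ e) z (0, u) (0, v) := rfl

include h in
theorem exists_equiv {z : E × E} (hz : z ∈ nonzeroVectorsOver W) :
    ∃ T : E ≃L[ℝ] (E →L[ℝ] ℝ), (T : E →L[ℝ] E →L[ℝ] ℝ) = verticalHessian e z := by
  have hinj : Function.Injective (verticalHessian e z) := by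
    rw [injective_iff_map_eq_zero]
    intro u hu
    refine h.nondegenerate z hz u fun v => ?_
    rw [← verticalHessian_apply, hu]
    rfl
  have hdim : Module.finrank ℝ E = Module.finrank ℝ (E →L[ℝ] ℝ) := by
    rw [← (LinearMap.toContinuousLinearMap : (E →ₗ[ℝ] ℝ) ≃ₗ[ℝ] E →L[ℝ] ℝ).finrank_eq]
    exact (Subspace.dual_finrank_eq (K := ℝ) (V := E)).symm
  refine ⟨(LinearEquiv.ofInjectiveOfFinrankEq (verticalHessian e z).toLinearMap hinj
    hdim).toContinuousLinearEquiv, ?_⟩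
  ext u v
  rfl

include h in
-- Nondegeneracy determines `G` as `½ H⁻¹ β`, with `H` the vertical Hessian and `β` the right-hand
-- side of the Euler-Lagrange equations; inversion of linear maps is smooth.
theorem contDiffOn_spray (hG : IsSpray W e G) : ContDiffOn ℝ ∞ G (nonzeroVectorsOver W) := by
  set β : E × E → E →L[ℝ] ℝ := fun z =>
    (fderiv ℝ (fderiv ℝ e) z (z.2, 0)).comp (ContinuousLinearMap.inr ℝ E E) -
      (fderiv ℝ e z).comp (ContinuousLinearMap.inl ℝ E E) with hβ
  have hβs : ContDiffOn ℝ ∞ β (nonzeroVectorsOver W) :=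
    ((h.contDiffOn_fderiv_fderiv.clm_apply (contDiffOn_snd.prodMk contDiffOn_const)).clm_comp
      contDiffOn_const).sub (h.contDiffOn_fderiv.clm_comp contDiffOn_const)
  have hHs : ContDiffOn ℝ ∞ (verticalHessian e) (nonzeroVectorsOver W) :=
    contDiffOn_const.clm_comp (h.contDiffOn_fderiv_fderiv.clm_comp contDiffOn_const)
  have hGe : ∀ z ∈ nonzeroVectorsOver W,
      G z = (1 / 2 : ℝ) • (verticalHessian e z).inverse (β z) := fun z hz => by
    obtain ⟨T, hT⟩ := h.exists_equiv hz
    have h1 : verticalHessian e z ((2 : ℝ) • G z) = β z := by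
      ext v
      rw [verticalHessian_apply, hG z hz v]
      rfl
    rw [← h1, ← hT, ContinuousLinearMap.inverse_equiv]
    simp
  refine ContDiffOn.congr (fun z hz => ContDiffAt.contDiffWithinAt ?_) hGe
  obtain ⟨T, hT⟩ := h.exists_equiv hz
  have h2 : ContDiffAt ℝ ∞ ContinuousLinearMap.inverse (verticalHessian e z) := by
    rw [← hT]
    exact contDiffAt_map_inverse T
  exact contDiffAt_const.smul ((ContDiffAt.comp z h2 (hHs.contDiffAt (h.mem_nhds hz))).clm_apply
    (hβs.contDiffAt (h.mem_nhds hz)))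

end IsEnergy

/-! ### Change of coordinates -/

/-- The tangent map `(x, y) ↦ (θ x, Dθ_x y)`. -/
noncomputable def flatTangentMap (θ : E → E) (z : E × E) : E × E := (θ z.1, fderiv ℝ θ z.1 z.2)

theorem hasFDerivAt_flatTangentMap {W : Set E} (hW : IsOpen W) {θ : E → E}
    (hθ : ContDiffOn ℝ ∞ θ W) {z : E × E} (hz : z.1 ∈ W) :
    ∃ T : E × E →L[ℝ] E × E, HasFDerivAt (flatTangentMap θ) T z ∧ ∀ w v, T (w, v) =
      (fderiv ℝ θ z.1 w, fderiv ℝ (fderiv ℝ θ) z.1 w z.2 + fderiv ℝ θ z.1 v) := by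
  have h1 : HasFDerivAt θ (fderiv ℝ θ z.1) z.1 :=
    ((hθ.contDiffAt (hW.mem_nhds hz)).differentiableAt (by simp)).hasFDerivAt
  have h2 : HasFDerivAt (fderiv ℝ θ) (fderiv ℝ (fderiv ℝ θ) z.1) z.1 :=
    (((hθ.fderiv_of_isOpen (m := ∞) hW (by simp)).contDiffAt (hW.mem_nhds hz)).differentiableAt
      (by simp)).hasFDerivAt
  refine ⟨_, (h1.comp z hasFDerivAt_fst).prodMk ((h2.comp z hasFDerivAt_fst).clm_apply
    hasFDerivAt_snd), fun w v => ?_⟩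
  simp [add_comm]

section ChangeOfCoordinates

variable {W W' : Set E} {e e' : E × E → ℝ} {θ : E → E} {G G' : E × E → E}
  [FiniteDimensional ℝ E]

/-- The transformation law of the horizontal lift under a change of coordinates. -/
theorem fderiv_flatTangentMap_horizontal (h : IsEnergy W e) (h' : IsEnergy W' e')
    (hθ : ContDiffOn ℝ ∞ θ W) (hmaps : MapsTo θ W W')
    (hbij : ∀ x ∈ W, Function.Bijective (fderiv ℝ θ x))
    (he : ∀ z ∈ nonzeroVectorsOver W, e z = e' (flatTangentMap θ z))
    (hG : IsSpray W e G) (hG' : IsSpray W' e' G') {z : E × E} (hz : z ∈ nonzeroVectorsOver W)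
    (w : E) : fderiv ℝ (flatTangentMap θ) z (w, -fderiv ℝ G z (0, w)) =
      (fderiv ℝ θ z.1 w, -fderiv ℝ G' (flatTangentMap θ z) (0, fderiv ℝ θ z.1 w)) := by
  have hW := h.isOpen
  have hθ1 : ∀ x ∈ W, HasFDerivAt (fderiv ℝ θ) (fderiv ℝ (fderiv ℝ θ) x) x := fun x hx =>
    (((hθ.fderiv_of_isOpen (m := ∞) hW (by simp)).contDiffAt (hW.mem_nhds hx)).differentiableAt
      (by simp)).hasFDerivAt
  have hθ2 : ∀ x ∈ W, HasFDerivAt (fderiv ℝ (fderiv ℝ θ)) (fderiv ℝ (fderiv ℝ (fderiv ℝ θ)) x) x :=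
    fun x hx => ((((hθ.fderiv_of_isOpen (m := ∞) hW (by simp)).fderiv_of_isOpen (m := ∞) hW
      (by simp)).contDiffAt (hW.mem_nhds hx)).differentiableAt (by simp)).hasFDerivAt
  have hsymm : ∀ x ∈ W, ∀ a b, fderiv ℝ (fderiv ℝ θ) x a b = fderiv ℝ (fderiv ℝ θ) x b a :=
    fun x hx a b => ((hθ.contDiffAt (hW.mem_nhds hx)).isSymmSndFDerivAt
    (by simpa using ENat.LEInfty.out)) a b
  have hTm : ∀ z ∈ nonzeroVectorsOver W, flatTangentMap θ z ∈ nonzeroVectorsOver W' := fun z hz =>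
    ⟨hmaps hz.1, fun h0 => hz.2 ((hbij _ hz.1).1 (h0.trans (map_zero _).symm))⟩
  -- the first derivative
  have hd1 : ∀ z ∈ nonzeroVectorsOver W, ∀ w v, fderiv ℝ e z (w, v) =
      fderiv ℝ e' (flatTangentMap θ z)
        (fderiv ℝ θ z.1 w, fderiv ℝ (fderiv ℝ θ) z.1 w z.2 + fderiv ℝ θ z.1 v) := by
    intro z hz w v
    obtain ⟨T, hT, hTe⟩ := hasFDerivAt_flatTangentMap hW hθ hz.1
    have h1 := (h'.hasFDerivAt (hTm z hz)).comp z hT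
    have h2 : e =ᶠ[𝓝 z] e' ∘ flatTangentMap θ := by
      filter_upwards [h.mem_nhds hz] with z hz using he z hz
    rw [(h1.congr_of_eventuallyEq h2).fderiv, ContinuousLinearMap.comp_apply, hTe]
  -- the second derivative, the last argument being vertical
  have hd2 : ∀ z ∈ nonzeroVectorsOver W, ∀ w u v, fderiv ℝ (fderiv ℝ e) z (w, u) (0, v) =
      fderiv ℝ (fderiv ℝ e') (flatTangentMap θ z)
        (fderiv ℝ θ z.1 w, fderiv ℝ (fderiv ℝ θ) z.1 w z.2 + fderiv ℝ θ z.1 u)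
        (0, fderiv ℝ θ z.1 v) +
      fderiv ℝ e' (flatTangentMap θ z) (0, fderiv ℝ (fderiv ℝ θ) z.1 w v) := by
    intro z hz w u v
    obtain ⟨T, hT, hTe⟩ := hasFDerivAt_flatTangentMap hW hθ hz.1
    have h1 := (h'.hasFDerivAt_fderiv (hTm z hz)).comp z hT
    have h3 : HasFDerivAt (fun z : E × E => ((0 : E), fderiv ℝ θ z.1 v))
        ((ContinuousLinearMap.inr ℝ E E).comp (((fderiv ℝ (fderiv ℝ θ) z.1).flip v).comp
          (ContinuousLinearMap.fst ℝ E E))) z := by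
      refine (ContinuousLinearMap.inr ℝ E E).hasFDerivAt.comp z ?_
      have := ((hθ1 z.1 hz.1).clm_apply (hasFDerivAt_const v z.1)).comp z hasFDerivAt_fst
      refine this.congr_fderiv ?_
      ext <;> simp
    have h4 := h1.clm_apply h3
    have h5 : (fun z => fderiv ℝ e z (0, v)) =ᶠ[𝓝 z]
        fun z => (fderiv ℝ e' ∘ flatTangentMap θ) z (0, fderiv ℝ θ z.1 v) := by
      filter_upwards [h.mem_nhds hz] with z hz
      rw [hd1 z hz]
      simp
    have h6 := (h.hasFDerivAt_fderiv hz).clm_apply (hasFDerivAt_const ((0 : E), v) z)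
    have h7 := congrArg (fun T : E × E →L[ℝ] ℝ => T (w, u))
      (h6.unique (h4.congr_of_eventuallyEq h5))
    simp [hTe] at h7
    rw [h7, add_comm]
  -- the transformation law of the spray
  have hspray : ∀ z ∈ nonzeroVectorsOver W, fderiv ℝ θ z.1 ((2 : ℝ) • G z) =
      (2 : ℝ) • G' (flatTangentMap θ z) + fderiv ℝ (fderiv ℝ θ) z.1 z.2 z.2 := by
    intro z hz
    refine h'.eq_of_forall_fderiv_fderiv (hTm z hz) fun v' => ?_
    obtain ⟨v, rfl⟩ := (hbij z.1 hz.1).2 v'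
    have h1 := hG z hz v
    rw [hd2 z hz, hd2 z hz, hd1 z hz] at h1
    have h2 := hG' _ (hTm z hz) (fderiv ℝ θ z.1 v)
    have e1 : ((0 : E), (2 : ℝ) • G' (flatTangentMap θ z) + fderiv ℝ (fderiv ℝ θ) z.1 z.2 z.2) =
      (0, (2 : ℝ) • G' (flatTangentMap θ z)) + (0, fderiv ℝ (fderiv ℝ θ) z.1 z.2 z.2) := by simp
    have e2 : (fderiv ℝ θ z.1 z.2, fderiv ℝ (fderiv ℝ θ) z.1 z.2 z.2 + fderiv ℝ θ z.1 0) =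
      (fderiv ℝ θ z.1 z.2, 0) + (0, fderiv ℝ (fderiv ℝ θ) z.1 z.2 z.2) := by simp
    have e3 : (fderiv ℝ θ z.1 v, fderiv ℝ (fderiv ℝ θ) z.1 v z.2 + fderiv ℝ θ z.1 0) =
      (fderiv ℝ θ z.1 v, 0) + (0, fderiv ℝ (fderiv ℝ θ) z.1 z.2 v) := by
        simp [hsymm z.1 hz.1 v z.2]
    have e4 : (flatTangentMap θ z).2 = fderiv ℝ θ z.1 z.2 := rfl
    rw [e4] at h2
    rw [e1, map_add, add_apply, h2]
    -- The two terms in which the first derivative of `e'` meets the second derivative of `θ`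
    -- cancel, by symmetry of the latter.
    rw [e2, e3, map_add, map_add, add_apply] at h1
    simp only [map_zero, zero_apply, zero_add, Prod.mk_zero_zero, add_zero] at h1
    linarith
  -- its derivative in the vertical directions
  obtain ⟨T, hT, hTe⟩ := hasFDerivAt_flatTangentMap hW hθ hz.1
  have hGd : HasFDerivAt G (fderiv ℝ G z) z :=
    (((h.contDiffOn_spray hG).contDiffAt (h.mem_nhds hz)).differentiableAt (by simp)).hasFDerivAt
  have hGd' : HasFDerivAt G' (fderiv ℝ G' (flatTangentMap θ z)) (flatTangentMap θ z) :=
    (((h'.contDiffOn_spray hG').contDiffAt (h'.mem_nhds (hTm z hz))).differentiableAt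
      (by simp)).hasFDerivAt
  have h1 := ((hθ1 z.1 hz.1).comp z hasFDerivAt_fst).clm_apply (hGd.const_smul (2 : ℝ))
  have h2 := (hGd'.comp z hT).const_smul (2 : ℝ)
  have h3 := (((hθ2 z.1 hz.1).comp z hasFDerivAt_fst).clm_apply
    (hasFDerivAt_snd (p := z))).clm_apply (hasFDerivAt_snd (p := z))
  have h4 := h2.add h3
  have h5 : (fun z => fderiv ℝ θ z.1 ((2 : ℝ) • G z)) =ᶠ[𝓝 z] fun z =>
      (2 : ℝ) • G' (flatTangentMap θ z) + fderiv ℝ (fderiv ℝ θ) z.1 z.2 z.2 := by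
    filter_upwards [h.mem_nhds hz] with z hz using hspray z hz
  -- The vertical derivative of `D²θ(y, y)` is `2 D²θ(w, y)`; halved, it cancels the inhomogeneous
  -- term in the derivative of the tangent map.
  have h6 := congrArg (fun T : E × E →L[ℝ] E => T (0, w))
    (h1.unique (h4.congr_of_eventuallyEq h5))
  simp [hTe, hsymm z.1 hz.1 z.2 w] at h6
  rw [hT.fderiv, hTe, map_neg]
  refine Prod.ext rfl ?_
  simp only
  have h7 : (2 : ℝ) • fderiv ℝ θ z.1 (fderiv ℝ G z (0, w)) = (2 : ℝ) •
      (fderiv ℝ G' (flatTangentMap θ z) (0, fderiv ℝ θ z.1 w) +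
        fderiv ℝ (fderiv ℝ θ) z.1 w z.2) := by
    rw [h6]; module
  rw [smul_right_injective E (two_ne_zero (α := ℝ)) h7]
  abel

end ChangeOfCoordinates

end Energy

/-! ### Coordinate expressions of Finsler functions -/

section LocalFinsler

theorem HasFDerivAt.hasDerivAt_apply_apply {E F : Type*} [NormedAddCommGroup E] [NormedSpace ℝ E]
    [NormedAddCommGroup F] [NormedSpace ℝ F] {B : E × E → F →L[ℝ] F →L[ℝ] ℝ}
    {B' : E × E →L[ℝ] F →L[ℝ] F →L[ℝ] ℝ} {z : E × E} (h : HasFDerivAt B B' z) (w : E) (a b : F) :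
    HasDerivAt (fun t : ℝ => B (z.1 + t • w, z.2) a b) (B' (w, 0) a b) 0 := by
  have h1 : HasDerivAt (fun t : ℝ => (z.1 + t • w, z.2)) (w, 0) 0 := by
    simpa using (((hasDerivAt_id (0 : ℝ)).smul_const w).const_add z.1).prodMk
      (hasDerivAt_const (0 : ℝ) z.2)
  obtain ⟨T, hT, hTe⟩ : ∃ T : E × E →L[ℝ] ℝ, HasFDerivAt (fun z => B z a b) T z ∧
      ∀ u, T u = B' u a b :=
    ⟨_, (h.clm_apply (hasFDerivAt_const a z)).clm_apply (hasFDerivAt_const b z), fun u => by simp⟩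
  have h2 : HasFDerivAt (fun z => B z a b) T (z.1 + (0 : ℝ) • w, z.2) := by
    rwa [zero_smul, add_zero]
  rw [← hTe]
  exact h2.comp_hasDerivAt (f := fun t : ℝ => (z.1 + t • w, z.2)) (0 : ℝ) h1

variable {n : ℕ}

theorem sum_smul_coordVec (v : EuclideanSpace ℝ (Fin n)) : ∑ i, v i • coordVec i = v := by
  simpa [coordVec] using (EuclideanSpace.basisFun (Fin n) ℝ).sum_repr v

theorem prodMk_zero_sum (c : Fin n → ℝ) :
    ((0 : EuclideanSpace ℝ (Fin n)), ∑ i, c i • coordVec i) =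
      ∑ i, c i • ((0 : EuclideanSpace ℝ (Fin n)), (coordVec i : EuclideanSpace ℝ (Fin n))) := by
  refine Prod.ext ?_ ?_
  · simp [Prod.fst_sum]
  · simp [Prod.snd_sum]

theorem prodMk_sum_zero (c : Fin n → ℝ) :
    ((∑ i, c i • coordVec i), (0 : EuclideanSpace ℝ (Fin n))) =
      ∑ i, c i • ((coordVec i : EuclideanSpace ℝ (Fin n)), (0 : EuclideanSpace ℝ (Fin n))) := by
  refine Prod.ext ?_ ?_
  · simp [Prod.fst_sum]
  · simp [Prod.snd_sum]

/-- `L` is the coordinate expression of a Finsler function over the open set `W`. -/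
structure IsLocalFinsler (W : Set (EuclideanSpace ℝ (Fin n)))
    (L : EuclideanSpace ℝ (Fin n) × EuclideanSpace ℝ (Fin n) → ℝ) : Prop where
  isOpen : IsOpen W
  smooth : ContDiffOn ℝ ∞ L (nonzeroVectorsOver W)
  homogeneous : ∀ z ∈ nonzeroVectorsOver W, ∀ c : ℝ, 0 < c → L (z.1, c • z.2) = c * L z
  posDef : ∀ z ∈ nonzeroVectorsOver W, ∀ u, u ≠ 0 →
    0 < halfSqHessian (fun y => L (z.1, y)) z.2 u u

/-- The energy of a Finsler function. -/
noncomputable def energy {V : Type*} (L : V → ℝ) (z : V) : ℝ := L z ^ 2 / 2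

/-- The geodesic coefficients as a map into `ℝⁿ`. -/
noncomputable def geodesicSpray (L : EuclideanSpace ℝ (Fin n) × EuclideanSpace ℝ (Fin n) → ℝ)
    (z : EuclideanSpace ℝ (Fin n) × EuclideanSpace ℝ (Fin n)) : EuclideanSpace ℝ (Fin n) :=
  WithLp.toLp 2 (geodesicCoeff L z.1 z.2)

open Classical in
/-- The coefficients of the horizontal distribution. -/
noncomputable def finslerConnection
    (L : EuclideanSpace ℝ (Fin n) × EuclideanSpace ℝ (Fin n) → ℝ)
    (z : EuclideanSpace ℝ (Fin n) × EuclideanSpace ℝ (Fin n)) :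
    EuclideanSpace ℝ (Fin n) →L[ℝ] EuclideanSpace ℝ (Fin n) :=
  if z.2 = 0 then 0 else (fderiv ℝ (geodesicSpray L) z).comp (ContinuousLinearMap.inr ℝ _ _)

theorem finslerConnection_apply
    {L : EuclideanSpace ℝ (Fin n) × EuclideanSpace ℝ (Fin n) → ℝ}
    {z : EuclideanSpace ℝ (Fin n) × EuclideanSpace ℝ (Fin n)} (hz : z.2 ≠ 0)
    (w : EuclideanSpace ℝ (Fin n)) :
    finslerConnection L z w = fderiv ℝ (geodesicSpray L) z (0, w) := by
  rw [finslerConnection, if_neg hz]; rfl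

namespace IsLocalFinsler

variable {W : Set (EuclideanSpace ℝ (Fin n))}
  {L : EuclideanSpace ℝ (Fin n) × EuclideanSpace ℝ (Fin n) → ℝ} (h : IsLocalFinsler W L)

include h in
theorem halfSqHessian_eq {z : EuclideanSpace ℝ (Fin n) × EuclideanSpace ℝ (Fin n)}
    (hz : z ∈ nonzeroVectorsOver W) (u v : EuclideanSpace ℝ (Fin n)) :
    halfSqHessian (fun y => L (z.1, y)) z.2 u v =
      fderiv ℝ (fderiv ℝ (energy L)) z (0, u) (0, v) := by
  have hO := isOpen_nonzeroVectorsOver h.isOpen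
  have hs : ContDiffOn ℝ ∞ (energy L) (nonzeroVectorsOver W) := (h.smooth.pow 2).div_const 2
  have hline : ∀ y w : EuclideanSpace ℝ (Fin n),
      HasDerivAt (fun t : ℝ => (z.1, y + t • w)) (0, w) 0 := fun y w => by
    simpa using (hasDerivAt_const (0 : ℝ) z.1).prodMk
      (((hasDerivAt_id (0 : ℝ)).smul_const w).const_add y)
  have h1 : ∀ y : EuclideanSpace ℝ (Fin n), (z.1, y) ∈ nonzeroVectorsOver W →
      deriv (fun t : ℝ => L (z.1, y + t • v) ^ 2) 0 = 2 * fderiv ℝ (energy L) (z.1, y) (0, v) := by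
    intro y hy
    have h2 : HasFDerivAt (energy L) (fderiv ℝ (energy L) (z.1, y)) (z.1, y + (0 : ℝ) • v) := by
      rw [zero_smul, add_zero]
      exact ((hs.contDiffAt (hO.mem_nhds hy)).differentiableAt (by simp)).hasFDerivAt
    have h3 := ((h2.comp_hasDerivAt (f := fun t : ℝ => (z.1, y + t • v)) (0 : ℝ)
      (hline y v)).const_mul (2 : ℝ)).deriv
    rw [← h3]
    congr 1
    ext t
    simp [energy]
    ring
  have h4 : HasFDerivAt (fderiv ℝ (energy L)) (fderiv ℝ (fderiv ℝ (energy L)) z)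
      (z.1, z.2 + (0 : ℝ) • u) := by
    rw [zero_smul, add_zero]
    exact (((hs.fderiv_of_isOpen (m := ∞) hO (by simp)).contDiffAt (hO.mem_nhds hz)).differentiableAt
      (by simp)).hasFDerivAt
  have h5 := (h4.comp_hasDerivAt (f := fun t : ℝ => (z.1, z.2 + t • u)) (0 : ℝ)
      (hline z.2 u)).clm_apply (hasDerivAt_const (0 : ℝ) ((0 : EuclideanSpace ℝ (Fin n)), v))
  have h6 : (fun s : ℝ => deriv (fun t : ℝ => L (z.1, z.2 + s • u + t • v) ^ 2) 0) =ᶠ[𝓝 0]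
      fun s => 2 * fderiv ℝ (energy L) (z.1, z.2 + s • u) (0, v) := by
    have : ∀ᶠ s : ℝ in 𝓝 0, (z.1, z.2 + s • u) ∈ nonzeroVectorsOver W :=
      (hline z.2 u).continuousAt.eventually_mem (hO.mem_nhds (by simpa using hz))
    filter_upwards [this] with s hs using h1 _ hs
  unfold halfSqHessian
  rw [h6.deriv_eq]
  refine (congrArg (1 / 2 * ·) (h5.const_mul (2 : ℝ)).deriv).trans ?_
  simp

include h in
theorem isEnergy : IsEnergy W (energy L) where
  isOpen := h.isOpen
  smooth := (h.smooth.pow 2).div_const 2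
  homogeneous z hz c hc := by
    simp only [energy, h.homogeneous z hz c hc]; ring
  nondegenerate z hz u hu := by
    by_contra h0
    have := h.posDef z hz u h0
    rw [h.halfSqHessian_eq hz, hu] at this
    exact this.false

include h in
-- Euler's identities give `g(y, y) = L²`, which positive definiteness makes nonzero.
theorem ne_zero {z : EuclideanSpace ℝ (Fin n) × EuclideanSpace ℝ (Fin n)}
    (hz : z ∈ nonzeroVectorsOver W) : L z ≠ 0 := by
  intro h0
  have := h.posDef z hz z.2 hz.2
  rw [h.halfSqHessian_eq hz, h.isEnergy.fderiv_fderiv_snd_self hz, h.isEnergy.fderiv_self hz] at this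
  simp [energy, h0] at this

include h in
theorem hasFDerivAt {z : EuclideanSpace ℝ (Fin n) × EuclideanSpace ℝ (Fin n)}
    (hz : z ∈ nonzeroVectorsOver W) : HasFDerivAt L (fderiv ℝ L z) z :=
  ((h.smooth.contDiffAt ((isOpen_nonzeroVectorsOver h.isOpen).mem_nhds hz)).differentiableAt
    (by simp)).hasFDerivAt

include h in
theorem fderiv_energy {z : EuclideanSpace ℝ (Fin n) × EuclideanSpace ℝ (Fin n)}
    (hz : z ∈ nonzeroVectorsOver W) : fderiv ℝ (energy L) z = L z • fderiv ℝ L z := by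
  have h1 := ((h.hasFDerivAt hz).pow 2).mul_const (1 / 2 : ℝ)
  have h2 : (fun z => L z ^ 2 * (1 / 2)) = energy L := by
    ext z; simp [energy]; ring
  rw [h2] at h1
  rw [h1.fderiv, smul_smul]
  congr 1
  simp

include h in
theorem metricMatrix_eq {z : EuclideanSpace ℝ (Fin n) × EuclideanSpace ℝ (Fin n)}
    (hz : z ∈ nonzeroVectorsOver W) (i j : Fin n) : metricMatrix L z.1 z.2 i j =
      fderiv ℝ (fderiv ℝ (energy L)) z (0, coordVec i) (0, coordVec j) :=
  h.halfSqHessian_eq hz _ _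

include h in
theorem metricMatrixDeriv_eq {z : EuclideanSpace ℝ (Fin n) × EuclideanSpace ℝ (Fin n)}
    (hz : z ∈ nonzeroVectorsOver W) (i j k : Fin n) : metricMatrixDeriv L z.1 z.2 i j k =
      fderiv ℝ (fderiv ℝ (fderiv ℝ (energy L))) z (coordVec k, 0) (0, coordVec i)
        (0, coordVec j) := by
  have hO := isOpen_nonzeroVectorsOver h.isOpen
  have h1 : HasDerivAt (fun t : ℝ => (z.1 + t • coordVec k, z.2)) (coordVec k, 0) 0 := by
    simpa using (((hasDerivAt_id (0 : ℝ)).smul_const (coordVec k)).const_add z.1).prodMk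
      (hasDerivAt_const (0 : ℝ) z.2)
  have h3 := (h.isEnergy.hasFDerivAt_fderiv_fderiv hz).hasDerivAt_apply_apply (coordVec k)
    (0, coordVec i) (0, coordVec j)
  have h4 : (fun t : ℝ => metricMatrix L (z.1 + t • coordVec k) z.2 i j) =ᶠ[𝓝 0]
      fun t => fderiv ℝ (fderiv ℝ (energy L)) (z.1 + t • coordVec k, z.2) (0, coordVec i)
        (0, coordVec j) := by
    have : ∀ᶠ t : ℝ in 𝓝 0, (z.1 + t • coordVec k, z.2) ∈ nonzeroVectorsOver W :=
      h1.continuousAt.eventually_mem (hO.mem_nhds (by simpa using hz))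
    filter_upwards [this] with t ht using h.metricMatrix_eq ht i j
  unfold metricMatrixDeriv
  rw [h4.deriv_eq]
  exact h3.deriv

include h in
theorem fderiv_fderiv_fderiv_symm {z : EuclideanSpace ℝ (Fin n) × EuclideanSpace ℝ (Fin n)}
    (hz : z ∈ nonzeroVectorsOver W) (a b c : EuclideanSpace ℝ (Fin n) × EuclideanSpace ℝ (Fin n)) :
    fderiv ℝ (fderiv ℝ (fderiv ℝ (energy L))) z a b c =
      fderiv ℝ (fderiv ℝ (fderiv ℝ (energy L))) z a c b := by
  have h1 := ((h.isEnergy.hasFDerivAt_fderiv_fderiv hz).clm_apply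
    (hasFDerivAt_const b z)).clm_apply (hasFDerivAt_const c z)
  have h2 := ((h.isEnergy.hasFDerivAt_fderiv_fderiv hz).clm_apply
    (hasFDerivAt_const c z)).clm_apply (hasFDerivAt_const b z)
  have h3 : (fun z => fderiv ℝ (fderiv ℝ (energy L)) z b c) =ᶠ[𝓝 z]
      fun z => fderiv ℝ (fderiv ℝ (energy L)) z c b := by
    filter_upwards [h.isEnergy.mem_nhds hz] with z hz using h.isEnergy.symm hz b c
  simpa using congrArg (fun T : _ →L[ℝ] ℝ => T a) (h1.unique (h2.congr_of_eventuallyEq h3))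

include h in
theorem isUnit_metricMatrix {z : EuclideanSpace ℝ (Fin n) × EuclideanSpace ℝ (Fin n)}
    (hz : z ∈ nonzeroVectorsOver W) : IsUnit (metricMatrix L z.1 z.2) := by
  rw [← Matrix.vecMul_injective_iff_isUnit]
  intro a b hab
  have h1 := h.isEnergy.eq_of_forall_fderiv_fderiv hz (a := WithLp.toLp 2 a)
    (b := WithLp.toLp 2 b) (fun v => ?_)
  · exact (WithLp.toLp_injective 2) h1
  have key : ∀ a : Fin n → ℝ, ∀ v : EuclideanSpace ℝ (Fin n),
      fderiv ℝ (fderiv ℝ (energy L)) z (0, WithLp.toLp 2 a) (0, v) =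
        ∑ j, v j * Matrix.vecMul a (metricMatrix L z.1 z.2) j := by
    intro a v
    conv_lhs => rw [← sum_smul_coordVec v, ← sum_smul_coordVec (WithLp.toLp 2 a)]
    simp only [Matrix.vecMul, dotProduct, h.metricMatrix_eq hz]
    rw [prodMk_zero_sum, prodMk_zero_sum]
    simp only [map_sum, map_smul, sum_apply, smul_apply, smul_eq_mul]
  have h2 : Matrix.vecMul a (metricMatrix L z.1 z.2) = Matrix.vecMul b (metricMatrix L z.1 z.2) :=
    hab
  rw [key, key, h2]

include h in
-- Homogeneity contracts the derivatives of the metric: `∂g_{jl}/∂xᵏ yʲ yᵏ` is a mixed second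
-- derivative of the energy `e`, and `∂g_{jk}/∂xˡ yʲ yᵏ` is `2 ∂e/∂xˡ`. The coordinate formula thus
-- reads `G = ½ g⁻¹ b`, with `b` the right-hand side of the Euler-Lagrange equations.
theorem isSpray_geodesicSpray : IsSpray W (energy L) (geodesicSpray L) := by
  intro z hz v
  have hE := h.isEnergy
  have f1 : (z.2, (0 : EuclideanSpace ℝ (Fin n))) = ∑ i, z.2 i • (coordVec i, 0) := by
    rw [← prodMk_sum_zero, sum_smul_coordVec]
  have f2 : ((0 : EuclideanSpace ℝ (Fin n)), z.2) = ∑ i, z.2 i • (0, coordVec i) := by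
    rw [← prodMk_zero_sum, sum_smul_coordVec]
  set b : Fin n → ℝ := fun l => fderiv ℝ (fderiv ℝ (energy L)) z (z.2, 0) (0, coordVec l) -
    fderiv ℝ (energy L) z (coordVec l, 0) with hb
  have hG : geodesicCoeff L z.1 z.2 =
      (1 / 2 : ℝ) • Matrix.mulVec (metricMatrix L z.1 z.2)⁻¹ b := by
    ext i
    simp only [geodesicCoeff, h.metricMatrixDeriv_eq hz, Pi.smul_apply, Matrix.mulVec, dotProduct,
      Finset.mul_sum, smul_eq_mul]
    refine Finset.sum_congr rfl fun l _ => ?_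
    have h1 : ∑ j, ∑ k, z.2 j * z.2 k * fderiv ℝ (fderiv ℝ (fderiv ℝ (energy L))) z
        (coordVec k, 0) (0, coordVec j) (0, coordVec l) =
          fderiv ℝ (fderiv ℝ (energy L)) z (z.2, 0) (0, coordVec l) := by
      rw [← hE.fderiv_fderiv_fderiv_self hz, h.fderiv_fderiv_fderiv_symm hz]
      rw [f1, f2]
      simp only [map_sum, map_smul, sum_apply, smul_apply, smul_eq_mul, Finset.mul_sum, mul_assoc]
    have h2 : ∑ j, ∑ k, z.2 j * z.2 k * fderiv ℝ (fderiv ℝ (fderiv ℝ (energy L))) z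
        (coordVec l, 0) (0, coordVec j) (0, coordVec k) =
          2 * fderiv ℝ (energy L) z (coordVec l, 0) := by
      rw [← hE.fderiv_fderiv_fst_self hz, ← hE.fderiv_fderiv_fderiv_self hz]
      rw [f2]
      simp only [map_sum, map_smul, sum_apply, smul_apply, smul_eq_mul, Finset.mul_sum, mul_assoc]
      rw [Finset.sum_comm]
      refine Finset.sum_congr rfl fun j _ => Finset.sum_congr rfl fun k _ => by ring
    have h3 : b l = fderiv ℝ (fderiv ℝ (energy L)) z (z.2, 0) (0, coordVec l) -
      (1 / 2) * (2 * fderiv ℝ (energy L) z (coordVec l, 0)) := by rw [hb]; ring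
    rw [h3, ← h1, ← h2]
    simp only [mul_sub, Finset.mul_sum, ← Finset.sum_sub_distrib, sub_mul]
    refine Finset.sum_congr rfl fun j _ => Finset.sum_congr rfl fun k _ => by ring
  have hdet : IsUnit (metricMatrix L z.1 z.2).det :=
    (Matrix.isUnit_iff_isUnit_det _).1 (h.isUnit_metricMatrix hz)
  have hgG : Matrix.mulVec (metricMatrix L z.1 z.2) ((2 : ℝ) • geodesicCoeff L z.1 z.2) = b := by
    rw [hG, smul_smul, Matrix.mulVec_smul, Matrix.mulVec_mulVec, Matrix.mul_nonsing_inv _ hdet]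
    simp
  have h4 : ∀ l, fderiv ℝ (fderiv ℝ (energy L)) z (0, (2 : ℝ) • geodesicSpray L z)
      (0, coordVec l) = b l := by
    intro l
    rw [← hgG, hE.symm hz]
    conv_lhs => rw [← sum_smul_coordVec ((2 : ℝ) • geodesicSpray L z), prodMk_zero_sum]
    simp only [map_sum, map_smul, Matrix.mulVec, dotProduct, h.metricMatrix_eq hz, smul_eq_mul]
    refine Finset.sum_congr rfl fun i _ => ?_
    rw [mul_comm]
    rfl
  rw [← sum_smul_coordVec v, prodMk_zero_sum, prodMk_sum_zero]
  simp only [map_sum, map_smul, h4, smul_eq_mul, hb, mul_sub, Finset.sum_sub_distrib]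

include h in
theorem contDiffOn_geodesicSpray : ContDiffOn ℝ ∞ (geodesicSpray L) (nonzeroVectorsOver W) :=
  h.isEnergy.contDiffOn_spray h.isSpray_geodesicSpray

include h in
theorem hasFDerivAt_geodesicSpray {z : EuclideanSpace ℝ (Fin n) × EuclideanSpace ℝ (Fin n)}
    (hz : z ∈ nonzeroVectorsOver W) :
    HasFDerivAt (geodesicSpray L) (fderiv ℝ (geodesicSpray L) z) z :=
  ((h.contDiffOn_geodesicSpray.contDiffAt (h.isEnergy.mem_nhds hz)).differentiableAt
    (by simp)).hasFDerivAt

include h in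
theorem connectionCoeff_eq {z : EuclideanSpace ℝ (Fin n) × EuclideanSpace ℝ (Fin n)}
    (hz : z ∈ nonzeroVectorsOver W) (i j : Fin n) :
    connectionCoeff L z.1 z.2 i j = fderiv ℝ (geodesicSpray L) z (0, coordVec j) i := by
  have h1 : HasDerivAt (fun t : ℝ => (z.1, z.2 + t • coordVec j)) (0, coordVec j) 0 := by
    simpa using (hasDerivAt_const (0 : ℝ) z.1).prodMk
      (((hasDerivAt_id (0 : ℝ)).smul_const (coordVec j)).const_add z.2)
  have h2 : HasFDerivAt (geodesicSpray L) (fderiv ℝ (geodesicSpray L) z)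
      (z.1, z.2 + (0 : ℝ) • coordVec j) := by
    rw [zero_smul, add_zero]
    exact h.hasFDerivAt_geodesicSpray hz
  have h3 := (EuclideanSpace.proj (𝕜 := ℝ) i).hasFDerivAt.comp_hasDerivAt (0 : ℝ)
    (h2.comp_hasDerivAt (f := fun t : ℝ => (z.1, z.2 + t • coordVec j)) (0 : ℝ) h1)
  exact h3.deriv

include h in
theorem sum_connectionCoeff {z : EuclideanSpace ℝ (Fin n) × EuclideanSpace ℝ (Fin n)}
    (hz : z ∈ nonzeroVectorsOver W) (w : EuclideanSpace ℝ (Fin n)) :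
    (WithLp.toLp 2 fun k => -∑ i, connectionCoeff L z.1 z.2 k i * w i) =
      -fderiv ℝ (geodesicSpray L) z (0, w) := by
  ext k
  conv_rhs => rw [← sum_smul_coordVec w, prodMk_zero_sum]
  simp only [h.connectionCoeff_eq hz, map_sum, map_smul, PiLp.neg_apply, WithLp.ofLp_sum,
    Finset.sum_apply, PiLp.smul_apply, smul_eq_mul, mul_comm]

include h in
-- The derivative of the energy is `L` times that of `L`, and `L` does not vanish, so constancy
-- passes from the energy to `L`.
theorem fderiv_horizontal {z : EuclideanSpace ℝ (Fin n) × EuclideanSpace ℝ (Fin n)}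
    (hz : z ∈ nonzeroVectorsOver W) (w : EuclideanSpace ℝ (Fin n)) :
    fderiv ℝ L z (w, -finslerConnection L z w) = 0 := by
  have h1 := h.isEnergy.fderiv_horizontal h.isSpray_geodesicSpray hz
    (h.hasFDerivAt_geodesicSpray hz).differentiableAt w
  rw [← finslerConnection_apply hz.2, h.fderiv_energy hz] at h1
  exact (mul_eq_zero.1 h1).resolve_left (h.ne_zero hz)

include h in
-- Both sides solve the same nondegenerate linear equation at `(x, c y)`: pulling back by the
-- dilation `σ` multiplies first and second derivatives of the energy by `c²`.
theorem geodesicSpray_smul {z : EuclideanSpace ℝ (Fin n) × EuclideanSpace ℝ (Fin n)}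
    (hz : z ∈ nonzeroVectorsOver W) {c : ℝ} (hc : 0 < c) :
    geodesicSpray L (z.1, c • z.2) = c ^ 2 • geodesicSpray L z := by
  have hE := h.isEnergy
  set σ : EuclideanSpace ℝ (Fin n) × EuclideanSpace ℝ (Fin n) →L[ℝ]
    EuclideanSpace ℝ (Fin n) × EuclideanSpace ℝ (Fin n) :=
    (ContinuousLinearMap.fst ℝ _ _).prod (c • ContinuousLinearMap.snd ℝ _ _) with hσ
  have hσa : ∀ z, σ z = (z.1, c • z.2) := fun z => rfl
  have hm : ∀ z ∈ nonzeroVectorsOver W, σ z ∈ nonzeroVectorsOver W := fun z hz => hE.smul_mem hz hc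
  have hd1 : ∀ z ∈ nonzeroVectorsOver W, ∀ a, fderiv ℝ (energy L) (σ z) (σ a) =
      c ^ 2 * fderiv ℝ (energy L) z a := by
    intro z hz a
    have h1 := (hE.hasFDerivAt (hm z hz)).comp z σ.hasFDerivAt
    have h2 := (hE.hasFDerivAt hz).const_mul (c ^ 2)
    have h3 : energy L ∘ σ =ᶠ[𝓝 z] fun z => c ^ 2 * energy L z := by
      filter_upwards [hE.mem_nhds hz] with z hz using hE.homogeneous z hz c hc
    exact congrArg (fun T : _ →L[ℝ] ℝ => T a) (h1.unique (h2.congr_of_eventuallyEq h3))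
  have hd2 : ∀ a b, fderiv ℝ (fderiv ℝ (energy L)) (σ z) (σ a) (σ b) =
      c ^ 2 * fderiv ℝ (fderiv ℝ (energy L)) z a b := by
    intro a b
    have h1 := ((hE.hasFDerivAt_fderiv (hm z hz)).comp z σ.hasFDerivAt).clm_apply
      (hasFDerivAt_const (σ b) z)
    have h2 := ((hE.hasFDerivAt_fderiv hz).clm_apply (hasFDerivAt_const b z)).const_mul (c ^ 2)
    have h3 : (fun z => (fderiv ℝ (energy L) ∘ σ) z (σ b)) =ᶠ[𝓝 z]
        fun z => c ^ 2 * fderiv ℝ (energy L) z b := by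
      filter_upwards [hE.mem_nhds hz] with z hz using hd1 z hz b
    simpa using congrArg (fun T : _ →L[ℝ] ℝ => T a) (h1.unique (h2.congr_of_eventuallyEq h3))
  refine hE.eq_of_forall_fderiv_fderiv (hm z hz) fun v' => ?_
  obtain ⟨v, rfl⟩ : ∃ v, c • v = v' := ⟨c⁻¹ • v', by rw [smul_smul, mul_inv_cancel₀ hc.ne', one_smul]⟩
  have h1 := h.isSpray_geodesicSpray (σ z) (hm z hz) (c • v)
  have h2 := h.isSpray_geodesicSpray z hz v
  have e1 : ∀ v : EuclideanSpace ℝ (Fin n), ((0 : EuclideanSpace ℝ (Fin n)), c • v) = σ (0, v) :=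
    fun v => rfl
  have e2 : ((σ z).2, (0 : EuclideanSpace ℝ (Fin n))) = c • σ (z.2, 0) := by simp [hσa]
  have e3 : (c • v, (0 : EuclideanSpace ℝ (Fin n))) = c • σ (v, 0) := by simp [hσa]
  have e4 : ((0 : EuclideanSpace ℝ (Fin n)), (2 : ℝ) • geodesicSpray L (σ z)) =
    (2 : ℝ) • (0, geodesicSpray L (σ z)) := by simp
  have e5 : ((0 : EuclideanSpace ℝ (Fin n)), (2 : ℝ) • geodesicSpray L z) =
    (2 : ℝ) • (0, geodesicSpray L z) := by simp
  have e6 : ((0 : EuclideanSpace ℝ (Fin n)), c ^ 2 • geodesicSpray L z) =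
    c • σ (0, geodesicSpray L z) := by simp [hσa, smul_smul, pow_two]
  rw [e1, e2, e3, e4] at h1
  rw [e5] at h2
  simp only [map_smul, smul_apply, hd2, hd1 z hz, smul_eq_mul] at h1 h2
  rw [e1, e6, ← hσa z]
  simp only [map_smul, smul_apply, hd2, smul_eq_mul]
  linear_combination (1 / 2 : ℝ) * h1 - (c ^ 3 / 2 : ℝ) * h2

end IsLocalFinsler

theorem nonzeroVectorsOver_univ {E : Type*} [NormedAddCommGroup E] :
    nonzeroVectorsOver (univ : Set E) = nonzeroVectors E := by
  ext z; simp [nonzeroVectorsOver, nonzeroVectors]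

theorem IsLocalFinsler.isHomogeneousConnection
    {L : EuclideanSpace ℝ (Fin n) × EuclideanSpace ℝ (Fin n) → ℝ} (h : IsLocalFinsler univ L) :
    IsHomogeneousConnection (finslerConnection L) where
  smooth := by
    have h1 := h.contDiffOn_geodesicSpray
    rw [nonzeroVectorsOver_univ] at h1
    refine ContDiffOn.congr (f := fun z =>
      (fderiv ℝ (geodesicSpray L) z).comp (ContinuousLinearMap.inr ℝ _ _)) ?_ fun z hz => ?_
    · exact (h1.fderiv_of_isOpen (m := ∞) isOpen_nonzeroVectors (by simp)).clm_comp contDiffOn_const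
    · exact if_neg hz
  homogeneous x y c hc := by
    by_cases hy : y = 0
    · simp [finslerConnection, hy]
    have hz : ∀ y : EuclideanSpace ℝ (Fin n), y ≠ 0 → (x, y) ∈ nonzeroVectorsOver univ :=
      fun y hy => ⟨mem_univ _, hy⟩
    ext1 w
    rw [finslerConnection_apply (z := (x, c • y)) (smul_ne_zero hc.ne' hy), smul_apply,
      finslerConnection_apply (z := (x, y)) hy]
    have h1 : HasFDerivAt (fun y => geodesicSpray L (x, c • y))
        ((fderiv ℝ (geodesicSpray L) (x, c • y)).comp ((ContinuousLinearMap.inr ℝ _ _).comp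
          (c • ContinuousLinearMap.id ℝ _))) y :=
      HasFDerivAt.comp y (g := geodesicSpray L) (f := fun y => (x, c • y))
        (h.hasFDerivAt_geodesicSpray (hz _ (smul_ne_zero hc.ne' hy)))
        ((hasFDerivAt_prodMk_right x (c • y)).comp y ((hasFDerivAt_id y).const_smul c))
    have h2 := (HasFDerivAt.comp y (g := geodesicSpray L) (f := fun y => (x, y))
      (h.hasFDerivAt_geodesicSpray (hz y hy)) (hasFDerivAt_prodMk_right x y)).const_smul (c ^ 2)
    have h3 : (fun y => geodesicSpray L (x, c • y)) =ᶠ[𝓝 y]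
        fun y => c ^ 2 • geodesicSpray L (x, y) := by
      filter_upwards [isOpen_ne.mem_nhds hy] with y hy using h.geodesicSpray_smul (hz y hy) hc
    have h4 := congrArg (fun T : _ →L[ℝ] _ => T w) (h1.unique (h2.congr_of_eventuallyEq h3))
    simp only [ContinuousLinearMap.comp_apply, smul_apply, ContinuousLinearMap.id_apply,
      ContinuousLinearMap.inr_apply, map_smul, pow_two, mul_smul] at h4
    exact smul_right_injective _ hc.ne' h4

end LocalFinsler

/-! ### Holonomy fields and their closure properties -/

section FlatClosure

open Filter Asymptotics IsHomogeneousConnection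

universe u

variable {E : Type u} [NormedAddCommGroup E] [NormedSpace ℝ E] [FiniteDimensional ℝ E]

/-- Properties of the relation "`T` coincides with an element of the holonomy group at `x`". -/
structure IsHolonomySystem (N : E × E → E →L[ℝ] E) (Hol : E → (E → E) → Prop) : Prop where
  refl : ∀ x : E, Hol x fun y => y
  congr : ∀ {x : E} {T T' : E → E}, Hol x T → (∀ y, y ≠ 0 → T y = T' y) → Hol x T'
  comp : ∀ {x : E} {T T' : E → E}, Hol x T → Hol x T' → Hol x (fun y => T (T' y))
  inverse : ∀ {x : E} {T T' : E → E}, Hol x T → (∀ y, y ≠ 0 → T' (T y) = y) → Hol x T'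
  parallelogram : ∀ x a b : E, Hol x fun y => transport N (-b) (x + b)
    (transport N (-a) (x + a + b) (transport N b (x + a) (transport N a x y)))
  conj : ∀ {x a : E} {T : E → E}, Hol (x + a) T →
    Hol x (fun y => transport N (-a) (x + a) (T (transport N a x y)))

/-- A map of `E × E` that preserves the fibres, the dilations and the function `L`, and is given by
an element of the holonomy group in every fibre. -/
structure IsFibredHolonomy (L : E × E → ℝ) (Hol : E → (E → E) → Prop) (T : E × E → E × E) :
    Prop where
  mem : ∀ z ∈ nonzeroVectors E, T z ∈ nonzeroVectors E
  fst : ∀ z ∈ nonzeroVectors E, (T z).1 = z.1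
  smul : ∀ z ∈ nonzeroVectors E, ∀ c : ℝ, 0 < c → T (z.1, c • z.2) = (z.1, c • (T z).2)
  apply_eq : ∀ z ∈ nonzeroVectors E, L (T z) = L z
  holonomy : ∀ x, Hol x fun y => (T (x, y)).2

/-- The leading terms of the families of fibred holonomy transformations. -/
def IsHolonomyField (L : E × E → ℝ) (Hol : E → (E → E) → Prop) (ζ : E × E → E × E) : Prop :=
  ∃ k Φ Ψ, LocalFamily (nonzeroVectors E) k ζ Φ Ψ ∧ ∀ s, IsFibredHolonomy L Hol (Φ s)

namespace IsFibredHolonomy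

variable {N : E × E → E →L[ℝ] E} {L : E × E → ℝ} {Hol : E → (E → E) → Prop} {T T' : E × E → E × E}

theorem comp (hH : IsHolonomySystem N Hol) (h : IsFibredHolonomy L Hol T)
    (h' : IsFibredHolonomy L Hol T') : IsFibredHolonomy L Hol fun z => T (T' z) where
  mem z hz := h.mem _ (h'.mem z hz)
  fst z hz := (h.fst _ (h'.mem z hz)).trans (h'.fst z hz)
  smul z hz c hc := by
    have h1 := h.smul _ (h'.mem z hz) c hc
    rw [h'.fst z hz] at h1
    rw [h'.smul z hz c hc, h1]
  apply_eq z hz := (h.apply_eq _ (h'.mem z hz)).trans (h'.apply_eq z hz)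
  holonomy x := hH.congr (hH.comp (h.holonomy x) (h'.holonomy x)) fun y hy => by
    have : (x, (T' (x, y)).2) = T' (x, y) := Prod.ext (h'.fst (x, y) hy).symm rfl
    rw [this]

theorem refl (hH : IsHolonomySystem N Hol) : IsFibredHolonomy L Hol fun z => z where
  mem _ hz := hz
  fst _ _ := rfl
  smul _ _ _ _ := rfl
  apply_eq _ _ := rfl
  holonomy x := hH.refl x

theorem inverse (hH : IsHolonomySystem N Hol) (h : IsFibredHolonomy L Hol T)
    (hmem : ∀ z ∈ nonzeroVectors E, T' z ∈ nonzeroVectors E)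
    (hl : ∀ z ∈ nonzeroVectors E, T' (T z) = z) (hr : ∀ z ∈ nonzeroVectors E, T (T' z) = z) :
    IsFibredHolonomy L Hol T' := by
  have hfst : ∀ z ∈ nonzeroVectors E, (T' z).1 = z.1 := fun z hz => by
    have h1 := h.fst _ (hmem z hz)
    rw [hr z hz] at h1
    exact h1.symm
  refine ⟨hmem, hfst, fun z hz c hc => ?_, fun z hz => ?_, fun x => ?_⟩
  · have h1 := h.smul _ (hmem z hz) c hc
    rw [hr z hz, hfst z hz] at h1
    rw [← h1, hl]
    exact smul_ne_zero hc.ne' (hmem z hz)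
  · have h1 := h.apply_eq _ (hmem z hz)
    rw [hr z hz] at h1
    exact h1.symm
  · refine hH.inverse (h.holonomy x) fun y hy => ?_
    have : (x, (T (x, y)).2) = T (x, y) := Prod.ext (h.fst (x, y) hy).symm rfl
    rw [this, hl (x, y) hy]

variable (hN : IsHomogeneousConnection N)

include hN in
theorem translation_smul {a : E} {s : ℝ} {z : E × E} (hz : z ∈ nonzeroVectors E) {c : ℝ}
    (hc : 0 < c) : translation N a s (z.1, c • z.2) =
      ((translation N a s z).1, c • (translation N a s z).2) := by
  simp only [translation, hN.transport_smul _ _ hz hc]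

variable (hL : DifferentiableOn ℝ L (nonzeroVectors E))
  (hLN : ∀ z ∈ nonzeroVectors E, ∀ w, fderiv ℝ L z (w, -N z w) = 0)

include hN hL hLN in
-- The direction is frozen at the initial foot point also on the way back, and `T` preserves fibres,
-- so the return segment ends where the path began.
theorem conj (hH : IsHolonomySystem N Hol) (h : IsFibredHolonomy L Hol T) (a : E → E) (s : ℝ) :
    IsFibredHolonomy L Hol
      fun z => translation N (-a z.1) s (T (translation N (a z.1) s z)) := by
  have hm : ∀ (a : E), ∀ z ∈ nonzeroVectors E, translation N a s z ∈ nonzeroVectors E :=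
    fun a z hz => (hN.localFamily_translation a).mem s z hz
  have hLT : ∀ (a : E), ∀ z ∈ nonzeroVectors E, L (translation N a s z) = L z :=
    fun a z hz => hN.apply_transport hL hLN _ _ hz
  have hfst : ∀ z ∈ nonzeroVectors E, (T (translation N (a z.1) s z)).1 = z.1 + s • a z.1 :=
    fun z hz => h.fst _ (hm _ z hz)
  have hfst' : ∀ z ∈ nonzeroVectors E,
      (translation N (-a z.1) s (T (translation N (a z.1) s z))).1 = z.1 := fun z hz => by
    rw [translation, hfst z hz]
    simp
  refine ⟨fun z hz => hm _ _ (h.mem _ (hm _ z hz)), hfst', fun z hz c hc => ?_, fun z hz => ?_,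
    fun x => ?_⟩
  · rw [translation_smul hN hz hc, h.smul _ (hm _ z hz) c hc, ← h.fst _ (hm _ z hz),
      translation_smul hN (h.mem _ (hm _ z hz)) hc, hfst' z hz]
  · rw [hLT _ _ (h.mem _ (hm _ z hz)), h.apply_eq _ (hm _ z hz), hLT _ _ hz]
  · refine hH.congr (hH.conj (x := x) (a := s • a x) (h.holonomy _)) fun y hy => ?_
    have h1 := hfst (x, y) hy
    simp only [translation] at h1
    simp only [translation, h1, smul_neg]

include hN hL hLN in
theorem parallelogram (hH : IsHolonomySystem N Hol) (a b : E → E) (s : ℝ) :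
    IsFibredHolonomy L Hol fun z => translation N (-b z.1) s
      (translation N (-a z.1) s (translation N (b z.1) s (translation N (a z.1) s z))) := by
  have hm : ∀ (a : E), ∀ z ∈ nonzeroVectors E, translation N a s z ∈ nonzeroVectors E :=
    fun a z hz => (hN.localFamily_translation a).mem s z hz
  have hLT : ∀ (a : E), ∀ z ∈ nonzeroVectors E, L (translation N a s z) = L z :=
    fun a z hz => hN.apply_transport hL hLN _ _ hz
  have hfst' : ∀ z ∈ nonzeroVectors E, (translation N (-b z.1) s
      (translation N (-a z.1) s (translation N (b z.1) s (translation N (a z.1) s z)))).1 = z.1 :=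
    fun z hz => by simp only [translation, smul_neg]; abel
  refine ⟨fun z hz => hm _ _ (hm _ _ (hm _ _ (hm _ z hz))), hfst', fun z hz c hc => ?_,
    fun z hz => ?_, fun x => ?_⟩
  · rw [translation_smul hN hz hc, translation_smul hN (hm _ _ hz) hc,
      translation_smul hN (hm _ _ (hm _ _ hz)) hc,
      translation_smul hN (hm _ _ (hm _ _ (hm _ _ hz))) hc, hfst' z hz]
  · rw [hLT _ _ (hm _ _ (hm _ _ (hm _ z hz))), hLT _ _ (hm _ _ (hm _ z hz)), hLT _ _ (hm _ z hz),
      hLT _ _ hz]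
  · refine hH.congr (hH.parallelogram x (s • a x) (s • b x)) fun y hy => ?_
    have h1 : x + s • a x + s • b x + -(s • a x) = x + s • b x := by abel
    simp only [translation, smul_neg, h1]

end IsFibredHolonomy

/-! ### Families depending on the foot point -/

/-- The parameter may be made a function of the foot point because the families preserve foot points
there: the inverse sees the same frozen value. The expansion is pointwise and hence unaffected,
whereas smoothness has to be supplied anew. -/
theorem LocalFamily.freeze {G : Type*} {X : E → G} {k : ℕ} {η : G → E × E → E × E}
    {K K' : G → ℝ → E × E → E × E} {Ω : Set (E × E)} (h : ∀ a, LocalFamily Ω k (η a) (K a) (K' a))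
    (hK : ∀ s, ∀ z ∈ Ω, (K (X z.1) s z).1 = z.1) (hK' : ∀ s, ∀ z ∈ Ω, (K' (X z.1) s z).1 = z.1)
    (hs : ContDiffOn ℝ ∞ (fun p : ℝ × E × E => K (X p.2.1) p.1 p.2) (univ ×ˢ Ω))
    (hs' : ContDiffOn ℝ ∞ (fun p : ℝ × E × E => K' (X p.2.1) p.1 p.2) (univ ×ˢ Ω))
    (hk : 0 < k) :
    LocalFamily Ω k (fun z => η (X z.1) z) (fun s z => K (X z.1) s z)
      (fun s z => K' (X z.1) s z) where
  pos := hk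
  smooth := hs
  smooth_inv := hs'
  mem s z hz := (h _).mem s z hz
  mem_inv s z hz := (h _).mem_inv s z hz
  left_inv s z hz := by rw [hK s z hz]; exact (h _).left_inv s z hz
  right_inv s z hz := by rw [hK' s z hz]; exact (h _).right_inv s z hz
  isLittleO z hz := (h _).isLittleO z hz

/-- As a limit of difference quotients the leading term inherits the linear properties of the
family: verticality and compatibility with dilations. -/
theorem LocalFamily.tendsto_smul {V : Type*} [NormedAddCommGroup V] [NormedSpace ℝ V] {Ω : Set V}
    {k : ℕ} {η : V → V} {Φ Ψ : ℝ → V → V} (h : LocalFamily Ω k η Φ Ψ) {z : V} (hz : z ∈ Ω) :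
    Tendsto (fun s : ℝ => (s ^ k)⁻¹ • (Φ s z - z)) (𝓝[≠] 0) (𝓝 (η z)) := by
  have h1 := ((h.isLittleO z hz).mono (nhdsWithin_le_nhds (s := {0}ᶜ))).tendsto_inv_smul_nhds_zero
  have h2 := h1.add_const (η z)
  rw [zero_add] at h2
  refine h2.congr' ?_
  filter_upwards [self_mem_nhdsWithin] with s hs
  rw [smul_sub (s ^ k)⁻¹ (Φ s z - z), inv_smul_smul₀ (pow_ne_zero k hs), sub_add_cancel]

namespace IsHolonomyField

variable {N : E × E → E →L[ℝ] E} {L : E × E → ℝ} {Hol : E → (E → E) → Prop} {ζ ζ' : E × E → E × E}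

theorem contDiffOn (h : IsHolonomyField L Hol ζ) : ContDiffOn ℝ ∞ ζ (nonzeroVectors E) := by
  obtain ⟨k, Φ, Ψ, hF, -⟩ := h
  exact hF.contDiffOn isOpen_nonzeroVectors

theorem fst_eq_zero (h : IsHolonomyField L Hol ζ) {z : E × E} (hz : z ∈ nonzeroVectors E) :
    (ζ z).1 = 0 := by
  obtain ⟨k, Φ, Ψ, hF, hfib⟩ := h
  have h1 := ((continuous_fst.tendsto _).comp (hF.tendsto_smul hz))
  refine tendsto_nhds_unique h1 ((tendsto_const_nhds (x := (0 : E))).congr fun s => ?_)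
  simp [(hfib s).fst z hz]

theorem apply_smul (h : IsHolonomyField L Hol ζ) {z : E × E} (hz : z ∈ nonzeroVectors E) {c : ℝ}
    (hc : 0 < c) : ζ (z.1, c • z.2) = (0, c • (ζ z).2) := by
  have hz' : (z.1, c • z.2) ∈ nonzeroVectors E := smul_ne_zero hc.ne' hz
  refine Prod.ext (h.fst_eq_zero hz') ?_
  obtain ⟨k, Φ, Ψ, hF, hfib⟩ := h
  have h1 := ((continuous_snd.tendsto _).comp (hF.tendsto_smul hz))
  have h2 := ((continuous_snd.tendsto _).comp (hF.tendsto_smul hz'))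
  refine tendsto_nhds_unique h2 ((h1.const_smul c).congr fun s => ?_)
  simp only [Function.comp_apply, (hfib s).smul z hz c hc, Prod.smul_snd, Prod.snd_sub, ← smul_sub]
  rw [smul_comm]

/-- The reparametrized family yields a curve through `z` with velocity `ζ z`, along which `L` is
constant. -/
theorem fderiv_eq_zero (h : IsHolonomyField L Hol ζ) {z : E × E} (hz : z ∈ nonzeroVectors E)
    (hL : DifferentiableOn ℝ L (nonzeroVectors E)) : fderiv ℝ L z (ζ z) = 0 := by
  obtain ⟨k, Φ, Ψ, hF, hfib⟩ := h
  have h1 := hF.hasDerivAt_rootFamily isOpen_nonzeroVectors hz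
  have h0 : rootFamily k Φ Ψ 0 z = z := by
    simp [rootFamily, absRoot_zero hF.pos, hF.zero hz]
  have h2 : HasFDerivAt L (fderiv ℝ L z) (rootFamily k Φ Ψ 0 z) := by
    rw [h0]
    exact (hL.differentiableAt (isOpen_nonzeroVectors.mem_nhds hz)).hasFDerivAt
  refine (h2.comp_hasDerivAt (0 : ℝ) h1).unique ((hasDerivAt_const (0 : ℝ) (L z)).congr_of_eventuallyEq
    (Eventually.of_forall fun t => ?_))
  simp only [Function.comp_apply, rootFamily]
  split_ifs
  · exact (hfib _).apply_eq z hz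
  · have := (hfib (absRoot k t)).apply_eq _ (hF.mem_inv (absRoot k t) z hz)
    rw [hF.right_inv _ z hz] at this
    exact this.symm

variable (hH : IsHolonomySystem N Hol)

include hH in
theorem inverse_family {k : ℕ} {Φ Ψ : ℝ → E × E → E × E}
    (hF : LocalFamily (nonzeroVectors E) k ζ Φ Ψ) (h : ∀ s, IsFibredHolonomy L Hol (Φ s)) (s : ℝ) :
    IsFibredHolonomy L Hol (Ψ s) :=
  (h s).inverse hH (hF.mem_inv s) (hF.left_inv s) (hF.right_inv s)

include hH in
theorem zero : IsHolonomyField L Hol fun _ : E × E => (0 : E × E) :=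
  ⟨1, fun _ z => z, fun _ z => z,
    { pos := one_pos
      smooth := contDiffOn_snd
      smooth_inv := contDiffOn_snd
      mem := fun _ _ hz => hz
      mem_inv := fun _ _ hz => hz
      left_inv := fun _ _ _ => rfl
      right_inv := fun _ _ _ => rfl
      isLittleO := fun z _ => by simp }, fun _ => IsFibredHolonomy.refl hH⟩

include hH in
theorem add (h : IsHolonomyField L Hol ζ) (h' : IsHolonomyField L Hol ζ') :
    IsHolonomyField L Hol fun z => ζ z + ζ' z := by
  obtain ⟨k, Φ, Ψ, hF, hfib⟩ := h
  obtain ⟨l, Φ', Ψ', hF', hfib'⟩ := h'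
  exact ⟨_, _, _, hF.add hF' isOpen_nonzeroVectors, fun s => (hfib _).comp hH (hfib' _)⟩

include hH in
theorem neg (h : IsHolonomyField L Hol ζ) : IsHolonomyField L Hol fun z => -ζ z := by
  obtain ⟨k, Φ, Ψ, hF, hfib⟩ := h
  exact ⟨_, _, _, hF.inv isOpen_nonzeroVectors, inverse_family hH hF hfib⟩

include hH in
-- Rescaling the parameter by `|c|^(1/k)` gives the factor `|c|`; for even `k` no rescaling changes
-- the sign, which is left to the inverse family.
theorem smul (h : IsHolonomyField L Hol ζ) (c : ℝ) : IsHolonomyField L Hol fun z => c • ζ z := by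
  have key : IsHolonomyField L Hol fun z => |c| • ζ z := by
    obtain ⟨k, Φ, Ψ, hF, hfib⟩ := h
    have h1 := hF.comp_mul isOpen_nonzeroVectors (absRoot k c)
    rw [absRoot_pow hF.pos] at h1
    exact ⟨_, _, _, h1, fun s => hfib _⟩
  rcases abs_choice c with hc | hc
  · rwa [hc] at key
  · have := key.neg hH
    rw [hc] at this
    simpa using this

include hH in
-- The families enter the commutator in reverse order, matching its sign convention.
theorem lieBracket (h : IsHolonomyField L Hol ζ) (h' : IsHolonomyField L Hol ζ') :
    IsHolonomyField L Hol (VectorField.lieBracket ℝ ζ ζ') := by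
  obtain ⟨k, Φ, Ψ, hF, hfib⟩ := h
  obtain ⟨l, Φ', Ψ', hF', hfib'⟩ := h'
  exact ⟨_, _, _, hF'.commutator hF isOpen_nonzeroVectors, fun s =>
    (inverse_family hH hF' hfib' s).comp hH ((inverse_family hH hF hfib s).comp hH
      ((hfib' s).comp hH (hfib s)))⟩

variable (hN : IsHomogeneousConnection N) (hL : DifferentiableOn ℝ L (nonzeroVectors E))
  (hLN : ∀ z ∈ nonzeroVectors E, ∀ w, fderiv ℝ L z (w, -N z w) = 0)

include hH hN hL hLN in
-- The commutator of two translations is translation around a parallelogram, of order `1 + 1`. The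
-- directions are frozen at `(X x, Y x)`.
theorem curvature {X Y : E → E} (hX : ContDiff ℝ ∞ X) (hY : ContDiff ℝ ∞ Y) :
    IsHolonomyField L Hol fun z =>
      VectorField.lieBracket ℝ (constantLift N (X z.1)) (constantLift N (Y z.1)) z := by
  have hm : ∀ (a : E) (s : ℝ), ∀ z ∈ nonzeroVectors E, translation N a s z ∈ nonzeroVectors E :=
    fun a s z hz => (hN.localFamily_translation a).mem s z hz
  have hs : ContDiffOn ℝ ∞ (fun p : ℝ × E × E => p.1) (univ ×ˢ nonzeroVectors E) := contDiffOn_fst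
  have hX' : ContDiffOn ℝ ∞ (fun p : ℝ × E × E => X p.2.1) (univ ×ˢ nonzeroVectors E) :=
    (hX.comp (contDiff_fst.comp contDiff_snd)).contDiffOn
  have hY' : ContDiffOn ℝ ∞ (fun p : ℝ × E × E => Y p.2.1) (univ ×ˢ nonzeroVectors E) :=
    (hY.comp (contDiff_fst.comp contDiff_snd)).contDiffOn
  have h0 := LocalFamily.freeze (X := fun x => (X x, Y x)) (Ω := nonzeroVectors E) (k := 1 + 1)
    (fun a : E × E => (hN.localFamily_translation a.2).commutator (hN.localFamily_translation a.1)
      isOpen_nonzeroVectors) (fun s z hz => by simp only [translation, smul_neg]; abel)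
    (fun s z hz => by simp only [translation, smul_neg]; abel)
    (hN.contDiffOn_translation hY'.neg hs (hN.contDiffOn_translation hX'.neg hs
      (hN.contDiffOn_translation hY' hs (hN.contDiffOn_translation hX' hs contDiffOn_snd
        fun p hp => hp.2) fun p hp => hm _ _ _ hp.2) fun p hp => hm _ _ _ (hm _ _ _ hp.2))
        fun p hp => hm _ _ _ (hm _ _ _ (hm _ _ _ hp.2)))
    (hN.contDiffOn_translation hX'.neg hs (hN.contDiffOn_translation hY'.neg hs
      (hN.contDiffOn_translation hX' hs (hN.contDiffOn_translation hY' hs contDiffOn_snd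
        fun p hp => hp.2) fun p hp => hm _ _ _ hp.2) fun p hp => hm _ _ _ (hm _ _ _ hp.2))
        fun p hp => hm _ _ _ (hm _ _ _ (hm _ _ _ hp.2))) two_pos
  exact ⟨_, _, _, h0, fun s => IsFibredHolonomy.parallelogram hN hL hLN hH X Y s⟩

include hH hN hL hLN in
-- The commutator with a translation is `Ψ s` composed with the conjugate of `Φ s` by that
-- translation; both are fibred holonomy, though the translation is not.
theorem berwald (h : IsHolonomyField L Hol ζ) {X : E → E} (hX : ContDiff ℝ ∞ X) :
    IsHolonomyField L Hol fun z => VectorField.lieBracket ℝ (constantLift N (X z.1)) ζ z := by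
  obtain ⟨k, Φ, Ψ, hF, hfib⟩ := h
  have hfib' := inverse_family hH hF hfib
  have hm : ∀ (a : E) (s : ℝ), ∀ z ∈ nonzeroVectors E, translation N a s z ∈ nonzeroVectors E :=
    fun a s z hz => (hN.localFamily_translation a).mem s z hz
  have hs : ContDiffOn ℝ ∞ (fun p : ℝ × E × E => p.1) (univ ×ˢ nonzeroVectors E) := contDiffOn_fst
  have hX' : ContDiffOn ℝ ∞ (fun p : ℝ × E × E => X p.2.1) (univ ×ˢ nonzeroVectors E) :=
    (hX.comp (contDiff_fst.comp contDiff_snd)).contDiffOn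
  have hc := fun s => (hfib' s).comp hH ((hfib s).conj hN hL hLN hH X s)
  have hc' : ∀ s, ∀ z ∈ nonzeroVectors E, (translation N (-X z.1) s
      (Ψ s (translation N (X z.1) s (Φ s z)))).1 = z.1 := fun s z hz => by
    have h1 := ((hfib' s).conj hN hL hLN hH X s).fst _ (hF.mem s z hz)
    rw [(hfib s).fst z hz] at h1
    exact h1
  have h0 := LocalFamily.freeze (X := X) (Ω := nonzeroVectors E) (k := k + 1)
    (fun a : E => hF.commutator (hN.localFamily_translation a) isOpen_nonzeroVectors)
    (fun s z hz => (hc s).fst z hz) hc'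
    (hF.smooth_inv.comp (hs.prodMk (hN.contDiffOn_translation hX'.neg hs (hF.smooth.comp
      (hs.prodMk (hN.contDiffOn_translation hX' hs contDiffOn_snd fun p hp => hp.2))
        fun p hp => ⟨mem_univ _, hm _ _ _ hp.2⟩) fun p hp => hF.mem _ _ (hm _ _ _ hp.2)))
        fun p hp => ⟨mem_univ _, hm _ _ _ (hF.mem _ _ (hm _ _ _ hp.2))⟩)
    (hN.contDiffOn_translation hX'.neg hs (hF.smooth_inv.comp
      (hs.prodMk (hN.contDiffOn_translation hX' hs hF.smooth fun p hp => hF.mem _ _ hp.2))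
        fun p hp => ⟨mem_univ _, hm _ _ _ (hF.mem _ _ hp.2)⟩)
        fun p hp => hF.mem_inv _ _ (hm _ _ _ (hF.mem _ _ hp.2))) (Nat.succ_pos k)
  exact ⟨_, _, _, h0, hc⟩

end IsHolonomyField

/-! ### Horizontal lifts of non-constant vector fields -/

/-- The horizontal lift of the vector field `X`. -/
def flatLift (N : E × E → E →L[ℝ] E) (X : E → E) (z : E × E) : E × E := (X z.1, -N z (X z.1))

section HorizontalLift

variable {N : E × E → E →L[ℝ] E} (hN : IsHomogeneousConnection N) {X Y : E → E}

include hN in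
theorem contDiffOn_flatLift (hX : ContDiff ℝ ∞ X) :
    ContDiffOn ℝ ∞ (flatLift N X) (nonzeroVectors E) :=
  (hX.comp contDiff_fst).contDiffOn.prodMk
    (hN.smooth.clm_apply (hX.comp contDiff_fst).contDiffOn).neg

include hN in
theorem fderiv_constantLift {z : E × E} (hz : z ∈ nonzeroVectors E) (a : E) (u : E × E) :
    fderiv ℝ (constantLift N a) z u = (0, -fderiv ℝ N z u a) := by
  have h1 := (hasFDerivAt_const a z).prodMk ((hN.hasFDerivAt hz).clm_apply (hasFDerivAt_const a z)).neg
  have h2 : HasFDerivAt (constantLift N a) _ z := h1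
  rw [h2.fderiv]
  simp

include hN in
theorem fderiv_flatLift (hX : Differentiable ℝ X) {z : E × E} (hz : z ∈ nonzeroVectors E)
    (u : E × E) : fderiv ℝ (flatLift N X) z u =
      fderiv ℝ (constantLift N (X z.1)) z u + (fderiv ℝ X z.1 u.1, -N z (fderiv ℝ X z.1 u.1)) := by
  have h0 : HasFDerivAt (fun z : E × E => X z.1)
      ((fderiv ℝ X z.1).comp (ContinuousLinearMap.fst ℝ E E)) z :=
    (hX z.1).hasFDerivAt.comp z hasFDerivAt_fst
  have h2 : HasFDerivAt (flatLift N X) _ z := h0.prodMk ((hN.hasFDerivAt hz).clm_apply h0).neg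
  rw [h2.fderiv, fderiv_constantLift hN hz]
  simp

include hN in
theorem lieBracket_constantLift_fst {z : E × E} (hz : z ∈ nonzeroVectors E) (a b : E) :
    (VectorField.lieBracket ℝ (constantLift N a) (constantLift N b) z).1 = 0 := by
  rw [VectorField.lieBracket, fderiv_constantLift hN hz, fderiv_constantLift hN hz]
  simp

include hN in
/-- The vertical part of the bracket of horizontal lifts is tensorial. -/
theorem lieBracket_flatLift (hX : Differentiable ℝ X) (hY : Differentiable ℝ Y) {z : E × E}
    (hz : z ∈ nonzeroVectors E) :
    ∃ c, VectorField.lieBracket ℝ (flatLift N X) (flatLift N Y) z =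
      VectorField.lieBracket ℝ (constantLift N (X z.1)) (constantLift N (Y z.1)) z + (c, -N z c) := by
  refine ⟨fderiv ℝ Y z.1 (X z.1) - fderiv ℝ X z.1 (Y z.1), ?_⟩
  rw [VectorField.lieBracket, VectorField.lieBracket, fderiv_flatLift hN hX hz,
    fderiv_flatLift hN hY hz]
  have h1 : ∀ X : E → E, flatLift N X z = constantLift N (X z.1) z := fun X => rfl
  rw [h1, h1]
  refine Prod.ext ?_ ?_
  · simp [constantLift]; abel
  · simp [constantLift]; abel

include hN in
-- The derivative of `X` is only applied to the base component of `ζ`, which is zero.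
theorem lieBracket_flatLift_vertical (hX : Differentiable ℝ X) {ζ : E × E → E × E} {z : E × E}
    (hz : z ∈ nonzeroVectors E) (hζ : (ζ z).1 = 0) :
    VectorField.lieBracket ℝ (flatLift N X) ζ z =
      VectorField.lieBracket ℝ (constantLift N (X z.1)) ζ z := by
  rw [VectorField.lieBracket, VectorField.lieBracket, fderiv_flatLift hN hX hz, hζ]
  have h1 : flatLift N X z = constantLift N (X z.1) z := rfl
  rw [h1]
  simp

end HorizontalLift

end FlatClosure

/-! ### Global coordinates on the tangent bundle -/

section GlobalChart

variable {n : ℕ} {M : Type*} [TopologicalSpace M]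
  [ChartedSpace (EuclideanSpace ℝ (Fin n)) M] [IsManifold (𝓡 n) ∞ M]
  (D : M ≃ₘ⟮𝓡 n, 𝓡 n⟯ EuclideanSpace ℝ (Fin n))

/-- The identification `TM → ℝⁿ × ℝⁿ` induced by a diffeomorphism `M → ℝⁿ`. -/
noncomputable def globalChart (v : TangentBundle (𝓡 n) M) :
    EuclideanSpace ℝ (Fin n) × EuclideanSpace ℝ (Fin n) :=
  (D v.proj, mfderiv (𝓡 n) (𝓡 n) D v.proj v.2)

/-- The inverse of `globalChart`. -/
noncomputable def globalChartSymm (z : EuclideanSpace ℝ (Fin n) × EuclideanSpace ℝ (Fin n)) :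
    TangentBundle (𝓡 n) M :=
  ⟨D.symm z.1, mfderiv (𝓡 n) (𝓡 n) D.symm z.1 z.2⟩

theorem contMDiff_globalChart : ContMDiff (𝓡 n).tangent
    𝓘(ℝ, EuclideanSpace ℝ (Fin n) × EuclideanSpace ℝ (Fin n)) ∞ (globalChart D) := by
  have h1 : ContMDiff (𝓡 n).tangent (𝓡 n).tangent ∞ (tangentMap (𝓡 n) (𝓡 n) D) :=
    D.contMDiff.contMDiff_tangentMap (by simp)
  have h2 : ContMDiff (𝓡 n).tangent 𝓘(ℝ, EuclideanSpace ℝ (Fin n)) ∞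
      (fun v => (tangentMap (𝓡 n) (𝓡 n) D v).2) :=
    (contMDiff_snd_tangentBundle_modelSpace (EuclideanSpace ℝ (Fin n)) (𝓡 n)).comp h1
  have h3 : ContMDiff (𝓡 n).tangent 𝓘(ℝ, EuclideanSpace ℝ (Fin n)) ∞
      (fun v : TangentBundle (𝓡 n) M => D v.proj) :=
    D.contMDiff.comp (Bundle.contMDiff_proj _)
  exact h3.prodMk_space h2

theorem contMDiff_globalChartSymm :
    ContMDiff 𝓘(ℝ, EuclideanSpace ℝ (Fin n) × EuclideanSpace ℝ (Fin n)) (𝓡 n).tangent ∞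
      (globalChartSymm D) := by
  have h1 : ContMDiff (𝓡 n).tangent (𝓡 n).tangent ∞ (tangentMap (𝓡 n) (𝓡 n) D.symm) :=
    D.symm.contMDiff.contMDiff_tangentMap (by simp)
  have h2 : ContMDiff 𝓘(ℝ, EuclideanSpace ℝ (Fin n) × EuclideanSpace ℝ (Fin n)) (𝓡 n).tangent ∞
      (fun z : EuclideanSpace ℝ (Fin n) × EuclideanSpace ℝ (Fin n) =>
        (⟨z.1, z.2⟩ : TangentBundle (𝓡 n) (EuclideanSpace ℝ (Fin n)))) := by
    intro z
    refine Bundle.contMDiffAt_totalSpace.2 ⟨?_, ?_⟩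
    · exact contDiff_fst.contMDiff.contMDiffAt
    · convert! (contDiff_snd.contMDiff (𝕜 := ℝ) (n := ∞)).contMDiffAt with z
      simp
      rfl
  exact h1.comp h2

theorem mfderiv_symm_comp (p : M) (w : TangentSpace (𝓡 n) p) :
    mfderiv (𝓡 n) (𝓡 n) D.symm (D p) (mfderiv (𝓡 n) (𝓡 n) D p w) = w := by
  have h1 := mfderiv_comp p (D.symm.contMDiff.mdifferentiableAt (x := D p) (by simp))
    (D.contMDiff.mdifferentiableAt (x := p) (by simp))
  have h2 : D.symm ∘ D = id := by ext x; simp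
  rw [h2, mfderiv_id] at h1
  exact (DFunLike.congr_fun h1 w).symm

theorem mfderiv_comp_symm (x w : EuclideanSpace ℝ (Fin n)) :
    mfderiv (𝓡 n) (𝓡 n) D (D.symm x) (mfderiv (𝓡 n) (𝓡 n) D.symm x w) = w := by
  have h1 := mfderiv_comp x (D.contMDiff.mdifferentiableAt (x := D.symm x) (by simp))
    (D.symm.contMDiff.mdifferentiableAt (x := x) (by simp))
  have h2 : D ∘ D.symm = id := by ext1 x; simp
  rw [h2, mfderiv_id] at h1
  exact (DFunLike.congr_fun h1 w).symm

theorem globalChart_symm (z : EuclideanSpace ℝ (Fin n) × EuclideanSpace ℝ (Fin n)) :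
    globalChart D (globalChartSymm D z) = z :=
  Prod.ext (D.apply_symm_apply z.1) (mfderiv_comp_symm D z.1 z.2)

theorem globalChartSymm_globalChart (v : TangentBundle (𝓡 n) M) :
    globalChartSymm D (globalChart D v) = v := by
  obtain ⟨p, y⟩ := v
  have h1 : ∀ q, q = p → ∀ u : TangentSpace (𝓡 n) q, HEq u y →
      (⟨q, u⟩ : TangentBundle (𝓡 n) M) = ⟨p, y⟩ := by
    rintro q rfl u hu; rw [eq_of_heq hu]
  refine h1 _ (D.symm_apply_apply p) _ ?_
  exact heq_of_eq (mfderiv_symm_comp D p y)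

theorem globalChart_injective : Function.Injective (globalChart D) :=
  Function.LeftInverse.injective (globalChartSymm_globalChart D)

theorem globalChart_snd_eq_zero {v : TangentBundle (𝓡 n) M} : (globalChart D v).2 = 0 ↔ v.2 = 0 := by
  constructor
  · intro h
    have h1 := mfderiv_symm_comp D v.proj v.2
    rw [show mfderiv (𝓡 n) (𝓡 n) D v.proj v.2 = 0 from h] at h1
    exact h1.symm.trans (map_zero _)
  · intro h
    exact (congrArg (mfderiv (𝓡 n) (𝓡 n) D v.proj) h).trans (map_zero _)

theorem globalChart_smul (p : M) (c : ℝ) (y : TangentSpace (𝓡 n) p) :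
    globalChart D ⟨p, c • y⟩ = ((globalChart D ⟨p, y⟩).1, c • (globalChart D ⟨p, y⟩).2) :=
  Prod.ext rfl ((mfderiv (𝓡 n) (𝓡 n) D p).map_smul c y)

theorem globalChartSymm_smul (x : EuclideanSpace ℝ (Fin n)) (c : ℝ) (y : EuclideanSpace ℝ (Fin n)) :
    globalChartSymm D (x, c • y) = ⟨D.symm x, c • (globalChartSymm D (x, y)).2⟩ := by
  unfold globalChartSymm
  congr 1
  exact (mfderiv (𝓡 n) (𝓡 n) D.symm x).map_smul c y

theorem isInvertible_mfderiv_globalChart (v : TangentBundle (𝓡 n) M) :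
    (mfderiv (𝓡 n).tangent 𝓘(ℝ, EuclideanSpace ℝ (Fin n) × EuclideanSpace ℝ (Fin n))
      (globalChart D) v).IsInvertible := by
  have hA := (contMDiff_globalChart D).mdifferentiableAt (x := v) (by simp)
  have hB := (contMDiff_globalChartSymm D).mdifferentiableAt (x := globalChart D v) (by simp)
  refine ContinuousLinearMap.IsInvertible.of_inverse (g := mfderiv
    𝓘(ℝ, EuclideanSpace ℝ (Fin n) × EuclideanSpace ℝ (Fin n)) (𝓡 n).tangent (globalChartSymm D)
      (globalChart D v)) ?_ ?_
  · have hA' : MDifferentiableAt (𝓡 n).tangent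
        𝓘(ℝ, EuclideanSpace ℝ (Fin n) × EuclideanSpace ℝ (Fin n)) (globalChart D)
        (globalChartSymm D (globalChart D v)) := by rwa [globalChartSymm_globalChart]
    have h1 := mfderiv_comp (globalChart D v) hA' hB
    have h2 : globalChart D ∘ globalChartSymm D = id := by ext1 x; simp [globalChart_symm]
    rw [h2, mfderiv_id, globalChartSymm_globalChart] at h1
    exact h1.symm
  · have h1 := mfderiv_comp v hB hA
    have h2 : globalChartSymm D ∘ globalChart D = id := by
      ext1 x; exact globalChartSymm_globalChart D x
    rw [h2, mfderiv_id] at h1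
    exact h1.symm

end GlobalChart

/-! ### From preferred charts to global coordinates -/

section ChartExpression

variable {n : ℕ} {M : Type*} [TopologicalSpace M]
  [ChartedSpace (EuclideanSpace ℝ (Fin n)) M] [IsManifold (𝓡 n) ∞ M]
  (D : M ≃ₘ⟮𝓡 n, 𝓡 n⟯ EuclideanSpace ℝ (Fin n))

/-- The change of coordinates from the preferred chart around `p` to the global one. -/
noncomputable def chartChange (p : M) : EuclideanSpace ℝ (Fin n) → EuclideanSpace ℝ (Fin n) :=
  D ∘ (extChartAt (𝓡 n) p).symm

theorem contDiffOn_chartChange (p : M) :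
    ContDiffOn ℝ ∞ (chartChange D p) (extChartAt (𝓡 n) p).target := by
  rw [← contMDiffOn_iff_contDiffOn]
  exact D.contMDiff.comp_contMDiffOn (contMDiffOn_extChartAt_symm p)

/-- Charts of `TM` come from trivializations; recognizing their inverses as tangent maps turns the
changes of coordinates into `flatTangentMap`. -/
theorem extChartAt_tangent_symm (v : TangentBundle (𝓡 n) M)
    {z : EuclideanSpace ℝ (Fin n) × EuclideanSpace ℝ (Fin n)}
    (hz : z.1 ∈ (extChartAt (𝓡 n) v.proj).target) :
    (extChartAt (𝓡 n).tangent v).symm z = ⟨(extChartAt (𝓡 n) v.proj).symm z.1,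
      mfderiv (𝓡 n) (𝓡 n) (extChartAt (𝓡 n) v.proj).symm z.1 z.2⟩ := by
  have hs : (extChartAt (𝓡 n) v.proj).symm z.1 ∈ (chartAt (EuclideanSpace ℝ (Fin n)) v.proj).source := by
    rw [← extChartAt_source (𝓡 n)]
    exact (extChartAt (𝓡 n) v.proj).map_target hz
  have h1 : (extChartAt (𝓡 n).tangent v).symm z =
      (trivializationAt (EuclideanSpace ℝ (Fin n)) (TangentSpace (𝓡 n)) v.proj).toPartialEquiv.symm
        ((extChartAt (𝓡 n) v.proj).symm z.1, z.2) := by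
    rw [FiberBundle.extChartAt]; rfl
  have h2 := TangentBundle.symmL_trivializationAt (I := 𝓡 n) hs
  have h3 : mfderivWithin 𝓘(ℝ, EuclideanSpace ℝ (Fin n)) (𝓡 n) (extChartAt (𝓡 n) v.proj).symm
      (range (𝓡 n)) (extChartAt (𝓡 n) v.proj ((extChartAt (𝓡 n) v.proj).symm z.1)) =
      mfderiv (𝓡 n) (𝓡 n) (extChartAt (𝓡 n) v.proj).symm z.1 := by
    rw [(extChartAt (𝓡 n) v.proj).right_inv hz, (𝓡 n).range_eq_univ, mfderivWithin_univ]
  rw [h1]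
  have hb : (extChartAt (𝓡 n) v.proj).symm z.1 ∈ (trivializationAt (EuclideanSpace ℝ (Fin n))
      (TangentSpace (𝓡 n)) v.proj).baseSet := hs
  have h4 := (trivializationAt (EuclideanSpace ℝ (Fin n)) (TangentSpace (𝓡 n))
    v.proj).mk_symm hb z.2
  have h5 := (trivializationAt (EuclideanSpace ℝ (Fin n)) (TangentSpace (𝓡 n))
    v.proj).symmL_apply (R := ℝ) hb z.2
  refine h4.symm.trans ?_
  rw [← h5]
  congr 1
  exact (congrArg (fun T : EuclideanSpace ℝ (Fin n) →L[ℝ] EuclideanSpace ℝ (Fin n) => T z.2)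
    (h2.trans h3) :)

theorem mdifferentiableAt_extChartAt_symm_of_mem (p : M) {x : EuclideanSpace ℝ (Fin n)}
    (hx : x ∈ (extChartAt (𝓡 n) p).target) :
    MDifferentiableAt (𝓡 n) (𝓡 n) (extChartAt (𝓡 n) p).symm x :=
  ((contMDiffOn_extChartAt_symm (n := ∞) p).contMDiffAt
    ((isOpen_extChartAt_target p).mem_nhds hx)).mdifferentiableAt (by simp)

theorem fderiv_chartChange (p : M) {x : EuclideanSpace ℝ (Fin n)}
    (hx : x ∈ (extChartAt (𝓡 n) p).target) (w : EuclideanSpace ℝ (Fin n)) :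
    fderiv ℝ (chartChange D p) x w = mfderiv (𝓡 n) (𝓡 n) D ((extChartAt (𝓡 n) p).symm x)
      (mfderiv (𝓡 n) (𝓡 n) (extChartAt (𝓡 n) p).symm x w) := by
  have h1 := mfderiv_comp x (D.contMDiff.mdifferentiableAt
    (x := (extChartAt (𝓡 n) p).symm x) (by simp)) (mdifferentiableAt_extChartAt_symm_of_mem p hx)
  have h2 := mfderiv_eq_fderiv (𝕜 := ℝ) (f := chartChange D p) (x := x)
  exact (congrArg (fun T : EuclideanSpace ℝ (Fin n) →L[ℝ] EuclideanSpace ℝ (Fin n) => T w)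
    (h2.symm.trans h1) :)

theorem globalChart_extChartAt_symm (v : TangentBundle (𝓡 n) M)
    {z : EuclideanSpace ℝ (Fin n) × EuclideanSpace ℝ (Fin n)}
    (hz : z.1 ∈ (extChartAt (𝓡 n) v.proj).target) :
    globalChart D ((extChartAt (𝓡 n).tangent v).symm z) =
      flatTangentMap (chartChange D v.proj) z := by
  rw [extChartAt_tangent_symm v hz]
  exact Prod.ext rfl (fderiv_chartChange D v.proj hz z.2).symm

theorem bijective_fderiv_chartChange (p : M) {x : EuclideanSpace ℝ (Fin n)}
    (hx : x ∈ (extChartAt (𝓡 n) p).target) :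
    Function.Bijective (fderiv ℝ (chartChange D p) x) := by
  have hinj : Function.Injective (fderiv ℝ (chartChange D p) x) := by
    rw [injective_iff_map_eq_zero]
    intro w hw
    rw [fderiv_chartChange D p hx] at hw
    have h1 := mfderiv_symm_comp D _ (mfderiv (𝓡 n) (𝓡 n) (extChartAt (𝓡 n) p).symm x w)
    have h0 : mfderiv (𝓡 n) (𝓡 n) (extChartAt (𝓡 n) p).symm x w = 0 :=
      h1.symm.trans ((congrArg _ hw).trans (map_zero _))
    have hmd : MDifferentiableAt (𝓡 n) (𝓡 n) (extChartAt (𝓡 n) p) ((extChartAt (𝓡 n) p).symm x) :=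
      mdifferentiableAt_extChartAt (by
        rw [← extChartAt_source (𝓡 n)]; exact (extChartAt (𝓡 n) p).map_target hx)
    have h2 := mfderiv_comp x hmd (mdifferentiableAt_extChartAt_symm_of_mem p hx)
    have h3 : extChartAt (𝓡 n) p ∘ (extChartAt (𝓡 n) p).symm =ᶠ[𝓝 x] id := by
      filter_upwards [(isOpen_extChartAt_target p).mem_nhds hx] with y hy
      exact (extChartAt (𝓡 n) p).right_inv hy
    rw [h3.mfderiv_eq, mfderiv_id] at h2
    have h4 : w = mfderiv (𝓡 n) (𝓡 n) (extChartAt (𝓡 n) p) ((extChartAt (𝓡 n) p).symm x)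
      (mfderiv (𝓡 n) (𝓡 n) (extChartAt (𝓡 n) p).symm x w) := DFunLike.congr_fun h2 w
    exact h4.trans ((congrArg _ h0).trans (map_zero _))
  exact ⟨hinj, (LinearMap.injective_iff_surjective
    (f := (fderiv ℝ (chartChange D p) x).toLinearMap)).1 hinj⟩

theorem extChartAt_tangent_self_fst (v : TangentBundle (𝓡 n) M) :
    (extChartAt (𝓡 n).tangent v v).1 = extChartAt (𝓡 n) v.proj v.proj := by
  rw [FiberBundle.extChartAt]; rfl

theorem extChartAt_tangent_self_fst_mem (v : TangentBundle (𝓡 n) M) :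
    (extChartAt (𝓡 n).tangent v v).1 ∈ (extChartAt (𝓡 n) v.proj).target := by
  rw [extChartAt_tangent_self_fst]
  exact mem_extChartAt_target v.proj

theorem flatTangentMap_extChartAt_self (v : TangentBundle (𝓡 n) M) :
    flatTangentMap (chartChange D v.proj) (extChartAt (𝓡 n).tangent v v) = globalChart D v := by
  rw [← globalChart_extChartAt_symm D v (extChartAt_tangent_self_fst_mem v)]
  congr 1
  exact (extChartAt (𝓡 n).tangent v).left_inv (mem_extChartAt_source v)

/-- Components at `v` refer to the preferred chart around `v`, so the derivative is that of the
coordinate change from this chart. -/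
theorem mfderiv_globalChart (v : TangentBundle (𝓡 n) M) (u : TangentSpace (𝓡 n).tangent v) :
    mfderiv (𝓡 n).tangent 𝓘(ℝ, EuclideanSpace ℝ (Fin n) × EuclideanSpace ℝ (Fin n))
      (globalChart D) v u = fderiv ℝ (flatTangentMap (chartChange D v.proj))
        (extChartAt (𝓡 n).tangent v v) (FinslerFunction.bundleComponents v u) := by
  have h1 := ((contMDiff_globalChart D).mdifferentiableAt (x := v) (by simp)).mfderiv
  have h2 : fderivWithin ℝ (writtenInExtChartAt (𝓡 n).tangent
      𝓘(ℝ, EuclideanSpace ℝ (Fin n) × EuclideanSpace ℝ (Fin n)) v (globalChart D))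
      (range (𝓡 n).tangent) (extChartAt (𝓡 n).tangent v v) =
      fderiv ℝ (flatTangentMap (chartChange D v.proj)) (extChartAt (𝓡 n).tangent v v) := by
    rw [ModelWithCorners.range_eq_univ, fderivWithin_univ]
    refine Filter.EventuallyEq.fderiv_eq ?_
    have h3 : ∀ᶠ z : EuclideanSpace ℝ (Fin n) × EuclideanSpace ℝ (Fin n) in
        𝓝 (extChartAt (𝓡 n).tangent v v), z.1 ∈ (extChartAt (𝓡 n) v.proj).target :=
      continuous_fst.continuousAt.eventually_mem
        ((isOpen_extChartAt_target v.proj).mem_nhds (extChartAt_tangent_self_fst_mem v))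
    filter_upwards [h3] with z hz
    exact globalChart_extChartAt_symm D v hz
  exact (congrArg (fun T : EuclideanSpace ℝ (Fin n) × EuclideanSpace ℝ (Fin n) →L[ℝ]
    EuclideanSpace ℝ (Fin n) × EuclideanSpace ℝ (Fin n) => T u) (h1.trans h2) :)

end ChartExpression

/-! ### The Finsler function and its connection in global coordinates -/

theorem halfSqHessian_comp {V V' : Type*} [AddCommGroup V] [Module ℝ V] [AddCommGroup V']
    [Module ℝ V'] (f : V' → ℝ) (A : V →ₗ[ℝ] V') (y u v : V) :
    halfSqHessian (fun y => f (A y)) y u v = halfSqHessian f (A y) (A u) (A v) := by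
  simp [halfSqHessian]

theorem contDiffOn_flatTangentMap {E : Type*} [NormedAddCommGroup E] [NormedSpace ℝ E] {W : Set E}
    (hW : IsOpen W) {θ : E → E} (hθ : ContDiffOn ℝ ∞ θ W) :
    ContDiffOn ℝ ∞ (flatTangentMap θ) {z | z.1 ∈ W} :=
  (hθ.comp contDiffOn_fst fun _ hz => hz).prodMk
    (((hθ.fderiv_of_isOpen (m := ∞) hW (by simp)).comp contDiffOn_fst fun _ hz => hz).clm_apply
      contDiffOn_snd)

theorem IsLocalFinsler.comp_flatTangentMap {n : ℕ} {W : Set (EuclideanSpace ℝ (Fin n))}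
    {L L' : EuclideanSpace ℝ (Fin n) × EuclideanSpace ℝ (Fin n) → ℝ} (h : IsLocalFinsler univ L)
    (hW : IsOpen W) {θ : EuclideanSpace ℝ (Fin n) → EuclideanSpace ℝ (Fin n)}
    (hθ : ContDiffOn ℝ ∞ θ W) (hinj : ∀ x ∈ W, Function.Injective (fderiv ℝ θ x))
    (he : ∀ z, z.1 ∈ W → L' z = L (flatTangentMap θ z)) : IsLocalFinsler W L' := by
  have hne : ∀ x ∈ W, ∀ y, y ≠ 0 → fderiv ℝ θ x y ≠ 0 := fun x hx y hy h0 =>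
    hy (hinj x hx (h0.trans (map_zero _).symm))
  have hmem : ∀ z ∈ nonzeroVectorsOver W, flatTangentMap θ z ∈ nonzeroVectorsOver univ :=
    fun z hz => ⟨mem_univ _, hne _ hz.1 _ hz.2⟩
  refine ⟨hW, ?_, fun z hz c hc => ?_, fun z hz u hu => ?_⟩
  · exact (h.smooth.comp ((contDiffOn_flatTangentMap hW hθ).mono fun z hz => hz.1) hmem).congr
      fun z hz => he z hz.1
  · rw [he (z.1, c • z.2) hz.1, he z hz.1, ← h.homogeneous _ (hmem z hz) c hc]
    simp [flatTangentMap]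
  · have h1 : (fun y => L' (z.1, y)) = fun y => L (θ z.1, (fderiv ℝ θ z.1).toLinearMap y) := by
      ext y; exact he (z.1, y) hz.1
    rw [h1, halfSqHessian_comp (fun y => L (θ z.1, y))]
    exact h.posDef _ (hmem z hz) _ (hne _ hz.1 _ hu)

namespace FinslerFunction

variable {n : ℕ} {M : Type*} [TopologicalSpace M]
  [ChartedSpace (EuclideanSpace ℝ (Fin n)) M] [IsManifold (𝓡 n) ∞ M]
  (F : FinslerFunction n M) (D : M ≃ₘ⟮𝓡 n, 𝓡 n⟯ EuclideanSpace ℝ (Fin n))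

/-- The Finsler function in global coordinates. -/
noncomputable def globalExpr (z : EuclideanSpace ℝ (Fin n) × EuclideanSpace ℝ (Fin n)) : ℝ :=
  F.toFun (globalChartSymm D z)

theorem globalExpr_globalChart (v : TangentBundle (𝓡 n) M) :
    F.globalExpr D (globalChart D v) = F.toFun v := by
  rw [globalExpr, globalChartSymm_globalChart]

theorem globalChartSymm_snd_ne_zero {z : EuclideanSpace ℝ (Fin n) × EuclideanSpace ℝ (Fin n)}
    (hz : z.2 ≠ 0) : (globalChartSymm D z).2 ≠ 0 := by
  intro h
  rw [← globalChart_snd_eq_zero D, globalChart_symm] at h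
  exact hz h

theorem isLocalFinsler_globalExpr : IsLocalFinsler univ (F.globalExpr D) where
  isOpen := isOpen_univ
  smooth := by
    rw [← contMDiffOn_iff_contDiffOn]
    exact F.smooth'.comp (contMDiff_globalChartSymm D).contMDiffOn
      fun z hz => globalChartSymm_snd_ne_zero D hz.2
  homogeneous z hz c hc := by
    rw [globalExpr, globalChartSymm_smul]
    exact F.homogeneous' _ _ c hc
  posDef z hz u hu := by
    have h1 := halfSqHessian_comp
      (fun y : TangentSpace (𝓡 n) (D.symm z.1) => F.toFun ⟨D.symm z.1, y⟩)
      (mfderiv (𝓡 n) (𝓡 n) D.symm z.1).toLinearMap z.2 u u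
    have h2 := F.posDef' (D.symm z.1) (mfderiv (𝓡 n) (𝓡 n) D.symm z.1 z.2)
      (mfderiv (𝓡 n) (𝓡 n) D.symm z.1 u) (globalChartSymm_snd_ne_zero D (z := z) hz.2)
      (globalChartSymm_snd_ne_zero D (z := (z.1, u)) hu)
    exact lt_of_lt_of_eq h2 h1.symm

theorem localExpr_eq (v : TangentBundle (𝓡 n) M)
    {z : EuclideanSpace ℝ (Fin n) × EuclideanSpace ℝ (Fin n)}
    (hz : z.1 ∈ (extChartAt (𝓡 n) v.proj).target) :
    F.localExpr v z = F.globalExpr D (flatTangentMap (chartChange D v.proj) z) := by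
  rw [← globalChart_extChartAt_symm D v hz, globalExpr_globalChart]; rfl

include D in
theorem isLocalFinsler_localExpr (v : TangentBundle (𝓡 n) M) :
    IsLocalFinsler (extChartAt (𝓡 n) v.proj).target (F.localExpr v) :=
  (F.isLocalFinsler_globalExpr D).comp_flatTangentMap (isOpen_extChartAt_target v.proj)
    (contDiffOn_chartChange D v.proj) (fun _ hx => (bijective_fderiv_chartChange D v.proj hx).1)
    fun _ hz => F.localExpr_eq D v hz

theorem mfderiv_eq_fderiv_chartChange (p : M) (w : TangentSpace (𝓡 n) p) :
    mfderiv (𝓡 n) (𝓡 n) D p w =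
      fderiv ℝ (chartChange D p) (extChartAt (𝓡 n) p p) (baseComponents p w) := by
  have h1 := (D.contMDiff.mdifferentiableAt (x := p) (by simp)).mfderiv
  have h2 : fderivWithin ℝ (writtenInExtChartAt (𝓡 n) (𝓡 n) p D)
      (range (𝓡 n)) (extChartAt (𝓡 n) p p) =
      fderiv ℝ (chartChange D p) (extChartAt (𝓡 n) p p) := by
    rw [ModelWithCorners.range_eq_univ, fderivWithin_univ]
    rfl
  exact (congrArg (fun T : EuclideanSpace ℝ (Fin n) →L[ℝ] EuclideanSpace ℝ (Fin n) => T w)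
    (h1.trans h2) :)

/-- The coefficients of the horizontal distribution in global coordinates. -/
noncomputable def globalConnection :
    EuclideanSpace ℝ (Fin n) × EuclideanSpace ℝ (Fin n) →
      EuclideanSpace ℝ (Fin n) →L[ℝ] EuclideanSpace ℝ (Fin n) :=
  finslerConnection (F.globalExpr D)

theorem isHomogeneousConnection_globalConnection :
    IsHomogeneousConnection (F.globalConnection D) :=
  (F.isLocalFinsler_globalExpr D).isHomogeneousConnection

/-- The definition of `horizontalLift` uses a different chart at each `v`. The transformation law of
sprays shows that all these choices describe one distribution, given in global coordinates by a
single connection. -/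
theorem mfderiv_globalChart_horizontalLift {v : TangentBundle (𝓡 n) M} (hv : v.2 ≠ 0)
    (w : TangentSpace (𝓡 n) v.proj) :
    mfderiv (𝓡 n).tangent 𝓘(ℝ, EuclideanSpace ℝ (Fin n) × EuclideanSpace ℝ (Fin n))
      (globalChart D) v (F.horizontalLift v w) =
      IsHomogeneousConnection.constantLift (F.globalConnection D)
        (mfderiv (𝓡 n) (𝓡 n) D v.proj w) (globalChart D v) := by
  have hL := F.isLocalFinsler_localExpr D v
  have hL' := F.isLocalFinsler_globalExpr D
  have hz : extChartAt (𝓡 n).tangent v v ∈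
      nonzeroVectorsOver (extChartAt (𝓡 n) v.proj).target := by
    refine ⟨extChartAt_tangent_self_fst_mem v, fun h0 => hv ?_⟩
    rw [← globalChart_snd_eq_zero D, ← flatTangentMap_extChartAt_self, flatTangentMap, h0, map_zero]
  have h1 : bundleComponents v (F.horizontalLift v w) = (baseComponents v.proj w,
      -fderiv ℝ (geodesicSpray (F.localExpr v)) (extChartAt (𝓡 n).tangent v v)
        (0, baseComponents v.proj w)) := by
    rw [← hL.sum_connectionCoeff hz]
    rfl
  rw [mfderiv_globalChart, h1, fderiv_flatTangentMap_horizontal hL.isEnergy hL'.isEnergy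
    (contDiffOn_chartChange D v.proj) (mapsTo_univ _ _)
    (fun x hx => bijective_fderiv_chartChange D v.proj hx)
    (fun z hz => by rw [energy, energy, F.localExpr_eq D v hz.1])
    hL.isSpray_geodesicSpray hL'.isSpray_geodesicSpray hz, extChartAt_tangent_self_fst,
    ← mfderiv_eq_fderiv_chartChange, flatTangentMap_extChartAt_self]
  exact Prod.ext rfl (congrArg Neg.neg
    (finslerConnection_apply ((globalChart_snd_eq_zero D).not.2 hv) _).symm)

end FinslerFunction

/-! ### Vector fields on the tangent bundle in global coordinates -/

namespace FinslerFunction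

open Filter IsHomogeneousConnection VectorField

variable {n : ℕ} {M : Type*} [TopologicalSpace M]
  [ChartedSpace (EuclideanSpace ℝ (Fin n)) M] [IsManifold (𝓡 n) ∞ M]
  (F : FinslerFunction n M) (D : M ≃ₘ⟮𝓡 n, 𝓡 n⟯ EuclideanSpace ℝ (Fin n))

/-- The vector field `V'` on `TM` is the expression in global coordinates, at `v`, of `V`. -/
def IsGlobalExprAt (V : EuclideanSpace ℝ (Fin n) × EuclideanSpace ℝ (Fin n) →
    EuclideanSpace ℝ (Fin n) × EuclideanSpace ℝ (Fin n)) (v : TangentBundle (𝓡 n) M)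
    (u : TangentSpace (𝓡 n).tangent v) : Prop :=
  mfderiv (𝓡 n).tangent 𝓘(ℝ, EuclideanSpace ℝ (Fin n) × EuclideanSpace ℝ (Fin n))
    (globalChart D) v u = V (globalChart D v)

variable {D}

variable (D) in
/-- The vector field on `TM` with the expression `V` in global coordinates. -/
noncomputable def pullbackField (V : EuclideanSpace ℝ (Fin n) × EuclideanSpace ℝ (Fin n) →
    EuclideanSpace ℝ (Fin n) × EuclideanSpace ℝ (Fin n)) (v : TangentBundle (𝓡 n) M) :
    TangentSpace (𝓡 n).tangent v :=
  mpullback (𝓡 n).tangent 𝓘(ℝ, EuclideanSpace ℝ (Fin n) × EuclideanSpace ℝ (Fin n))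
    (globalChart D) V v

theorem IsGlobalExprAt.eq_pullbackField
    {V : EuclideanSpace ℝ (Fin n) × EuclideanSpace ℝ (Fin n) →
      EuclideanSpace ℝ (Fin n) × EuclideanSpace ℝ (Fin n)} {v : TangentBundle (𝓡 n) M}
    {u : TangentSpace (𝓡 n).tangent v} (h : IsGlobalExprAt D V v u) : u = pullbackField D V v :=
  ((isInvertible_mfderiv_globalChart D v).inverse_apply_eq.2 h.symm).symm

theorem isGlobalExprAt_pullbackField (V : EuclideanSpace ℝ (Fin n) × EuclideanSpace ℝ (Fin n) →
    EuclideanSpace ℝ (Fin n) × EuclideanSpace ℝ (Fin n)) (v : TangentBundle (𝓡 n) M) :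
    IsGlobalExprAt D V v (pullbackField D V v) :=
  ((isInvertible_mfderiv_globalChart D v).inverse_apply_eq.1 rfl).symm

theorem contMDiffAt_pullbackField {V : EuclideanSpace ℝ (Fin n) × EuclideanSpace ℝ (Fin n) →
    EuclideanSpace ℝ (Fin n) × EuclideanSpace ℝ (Fin n)} {v : TangentBundle (𝓡 n) M}
    (hV : ContDiffAt ℝ ∞ V (globalChart D v)) :
    ContMDiffAt (𝓡 n).tangent (𝓡 n).tangent.tangent ∞ (fun v =>
      (⟨v, pullbackField D V v⟩ : TangentBundle (𝓡 n).tangent (TangentBundle (𝓡 n) M))) v := by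
  have h1 : IsManifold (𝓡 n).tangent ∞ (TangentBundle (𝓡 n) M) := inferInstance
  have h2 : IsManifold (𝓡 n).tangent 1 (TangentBundle (𝓡 n) M) :=
    IsManifold.of_le (n := ∞) (by simp)
  exact ContMDiffAt.mpullback_vectorField_preimage (n := ∞)
    (contMDiffAt_vectorSpace_iff_contDiffAt.2 hV) (contMDiff_globalChart D).contMDiffAt
    (isInvertible_mfderiv_globalChart D v) (by simp)

/-- Naturality of the bracket under pullback. The hypotheses are required near `v`, since the
bracket depends on germs. -/
theorem IsGlobalExprAt.mlieBracket {V W : EuclideanSpace ℝ (Fin n) × EuclideanSpace ℝ (Fin n) →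
    EuclideanSpace ℝ (Fin n) × EuclideanSpace ℝ (Fin n)}
    {V' W' : ∀ v : TangentBundle (𝓡 n) M, TangentSpace (𝓡 n).tangent v}
    {v : TangentBundle (𝓡 n) M} (hV : ∀ᶠ u in 𝓝 v, IsGlobalExprAt D V u (V' u))
    (hW : ∀ᶠ u in 𝓝 v, IsGlobalExprAt D W u (W' u))
    (hVd : ContDiffAt ℝ 1 V (globalChart D v)) (hWd : ContDiffAt ℝ 1 W (globalChart D v)) :
    IsGlobalExprAt D (lieBracket ℝ V W) v
      (VectorField.mlieBracket (𝓡 n).tangent V' W' v) := by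
  have hV' : V' =ᶠ[𝓝 v] pullbackField D V := by
    filter_upwards [hV] with u hu using hu.eq_pullbackField
  have hW' : W' =ᶠ[𝓝 v] pullbackField D W := by
    filter_upwards [hW] with u hu using hu.eq_pullbackField
  have h1 : IsManifold (𝓡 n).tangent ∞ (TangentBundle (𝓡 n) M) := inferInstance
  have h2 : IsManifold (𝓡 n).tangent (minSmoothness ℝ 2) (TangentBundle (𝓡 n) M) :=
    IsManifold.of_le (n := ∞) (by simpa using ENat.LEInfty.out)
  rw [hV'.mlieBracket_vectorField_eq hW']
  have h3 := mpullback_mlieBracket (n := ∞) (I := (𝓡 n).tangent)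
    ((contMDiffAt_vectorSpace_iff_contDiffAt.2 hVd).mdifferentiableAt one_ne_zero)
    ((contMDiffAt_vectorSpace_iff_contDiffAt.2 hWd).mdifferentiableAt one_ne_zero)
    (contMDiff_globalChart D).contMDiffAt (by simpa using ENat.LEInfty.out)
  have h4 : VectorField.mlieBracket 𝓘(ℝ, EuclideanSpace ℝ (Fin n) × EuclideanSpace ℝ (Fin n)) V W =
      lieBracket ℝ V W :=
    (mlieBracketWithin_univ.symm.trans mlieBracketWithin_eq_lieBracketWithin).trans
      lieBracketWithin_univ
  have h5 : pullbackField D (lieBracket ℝ V W) v = VectorField.mlieBracket (𝓡 n).tangent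
      (pullbackField D V) (pullbackField D W) v := by
    rw [← h4]
    exact h3
  rw [← h5]
  exact isGlobalExprAt_pullbackField _ v

/-! ### Horizontal fields and homogeneous extensions -/

variable (D) in
/-- The vector field `X` on `M` in global coordinates. -/
noncomputable def globalField (X : ∀ x : M, TangentSpace (𝓡 n) x) (x : EuclideanSpace ℝ (Fin n)) :
    EuclideanSpace ℝ (Fin n) :=
  mfderiv (𝓡 n) (𝓡 n) D (D.symm x) (X (D.symm x))

theorem globalField_apply (X : ∀ x : M, TangentSpace (𝓡 n) x) (p : M) :
    globalField D X (D p) = mfderiv (𝓡 n) (𝓡 n) D p (X p) :=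
  congrArg (fun q => (mfderiv (𝓡 n) (𝓡 n) D q (X q) : EuclideanSpace ℝ (Fin n)))
    (D.symm_apply_apply p)

theorem contDiff_globalField {X : ∀ x : M, TangentSpace (𝓡 n) x} (hX : IsSmoothField X) :
    ContDiff ℝ ∞ (globalField D X) := by
  rw [← contMDiff_iff_contDiff]
  have h1 : ContMDiff (𝓡 n).tangent (𝓡 n).tangent ∞ (tangentMap (𝓡 n) (𝓡 n) D) :=
    D.contMDiff.contMDiff_tangentMap (by simp)
  exact (contMDiff_snd_tangentBundle_modelSpace (EuclideanSpace ℝ (Fin n)) (𝓡 n)).comp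
    (h1.comp (hX.comp D.symm.contMDiff))

theorem isGlobalExprAt_horizontalField (X : ∀ x : M, TangentSpace (𝓡 n) x)
    {v : TangentBundle (𝓡 n) M} (hv : v.2 ≠ 0) :
    IsGlobalExprAt D (flatLift (F.globalConnection D) (globalField D X)) v
      (F.horizontalField X v) := by
  refine (F.mfderiv_globalChart_horizontalLift D hv (X v.proj)).trans ?_
  have h1 : globalField D X (globalChart D v).1 = mfderiv (𝓡 n) (𝓡 n) D v.proj (X v.proj) :=
    globalField_apply X v.proj
  rw [flatLift, h1]
  rfl

include D in
theorem eventually_snd_ne_zero {v : TangentBundle (𝓡 n) M} (hv : v.2 ≠ 0) :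
    ∀ᶠ u in 𝓝 v, u.2 ≠ 0 := by
  have h1 := (contMDiff_globalChart D).continuous.continuousAt.eventually_mem
    (isOpen_nonzeroVectors.mem_nhds ((globalChart_snd_eq_zero D).not.2 hv :
      globalChart D v ∈ nonzeroVectors (EuclideanSpace ℝ (Fin n))))
  filter_upwards [h1] with u hu using (globalChart_snd_eq_zero D).not.1 hu

theorem snd_ne_zero_of_ne_zero {v : TangentBundle (𝓡 n) M} (hv : F.toFun v ≠ 0) : v.2 ≠ 0 := by
  intro h0
  obtain ⟨p, y⟩ := v
  have h1 := F.homogeneous' p y 2 two_pos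
  have h2 : y = 0 := h0
  rw [h2, smul_zero] at h1
  rw [h2] at hv
  exact hv (by linarith)

theorem snd_ne_zero (v : F.indicatrixBundle) : v.1.2 ≠ 0 :=
  F.snd_ne_zero_of_ne_zero (by rw [show F.toFun v = 1 from v.2]; exact one_ne_zero)

theorem globalChart_mem (v : F.indicatrixBundle) :
    globalChart D v ∈ nonzeroVectors (EuclideanSpace ℝ (Fin n)) :=
  (globalChart_snd_eq_zero D).not.2 (F.snd_ne_zero v)

/-- A vertical field that is homogeneous of degree one is invariant under dilations, hence
determined on `F > 0` by its values on the indicatrix bundle. -/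
theorem isGlobalExprAt_homogeneousExtension {ζ : EuclideanSpace ℝ (Fin n) ×
    EuclideanSpace ℝ (Fin n) → EuclideanSpace ℝ (Fin n) × EuclideanSpace ℝ (Fin n)}
    (hζ : ∀ z ∈ nonzeroVectors (EuclideanSpace ℝ (Fin n)), ∀ c : ℝ, 0 < c →
      (ζ z).1 = 0 ∧ ζ (z.1, c • z.2) = (0, c • (ζ z).2)) {ξ : F.FieldAlong}
    (hξ : ∀ v : F.indicatrixBundle, IsGlobalExprAt D ζ v (ξ v)) {v : TangentBundle (𝓡 n) M}
    (hv : 0 < F.toFun v) : IsGlobalExprAt D ζ v (F.homogeneousExtension ξ v) := by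
  obtain ⟨p, y⟩ := v
  set c := F.toFun ⟨p, y⟩ with hc
  have h1 : F.toFun ⟨p, c⁻¹ • y⟩ = 1 := by
    rw [F.homogeneous' p y _ (inv_pos.2 hv), ← hc, inv_mul_cancel₀ hv.ne']
  have h2 : F.homogeneousExtension ξ ⟨p, y⟩ = (bundleComponents ⟨p, y⟩).symm
      ((bundleComponents _ (ξ ⟨⟨p, c⁻¹ • y⟩, h1⟩)).1,
        c • (bundleComponents _ (ξ ⟨⟨p, c⁻¹ • y⟩, h1⟩)).2) := dif_pos h1
  set u : F.indicatrixBundle := ⟨⟨p, c⁻¹ • y⟩, h1⟩ with hu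
  have hext : ∀ y, (extChartAt (𝓡 n).tangent (⟨p, y⟩ : TangentBundle (𝓡 n) M) ⟨p, y⟩).1 =
      extChartAt (𝓡 n) p p := fun y => extChartAt_tangent_self_fst _
  have hmem : extChartAt (𝓡 n) p p ∈ (extChartAt (𝓡 n) p).target := mem_extChartAt_target p
  -- On vertical vectors the derivative of the coordinate change does not depend on `y`: the
  -- second-derivative term `q` vanishes with the base component `a`.
  have hT : ∀ (y : TangentSpace (𝓡 n) p) (a b : EuclideanSpace ℝ (Fin n)),
      ∃ q : EuclideanSpace ℝ (Fin n),
        (a = 0 → q = 0) ∧ fderiv ℝ (flatTangentMap (chartChange D p))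
        (extChartAt (𝓡 n).tangent (⟨p, y⟩ : TangentBundle (𝓡 n) M) ⟨p, y⟩) (a, b) =
        (fderiv ℝ (chartChange D p) (extChartAt (𝓡 n) p p) a,
          q + fderiv ℝ (chartChange D p) (extChartAt (𝓡 n) p p) b) := by
    intro y a b
    obtain ⟨T, hT, hTe⟩ := hasFDerivAt_flatTangentMap (isOpen_extChartAt_target p)
      (contDiffOn_chartChange D p)
      (z := extChartAt (𝓡 n).tangent (⟨p, y⟩ : TangentBundle (𝓡 n) M) ⟨p, y⟩)
      (by rw [hext]; exact hmem)
    refine ⟨_, ?_, by rw [hT.fderiv, hTe, hext]⟩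
    rintro rfl
    simp
  have h3 := hξ u
  rw [IsGlobalExprAt, mfderiv_globalChart] at h3
  obtain ⟨q, hq, hqe⟩ := hT (c⁻¹ • y) (bundleComponents _ (ξ u)).1 (bundleComponents _ (ξ u)).2
  have h4 := hqe.symm.trans h3
  have h5 := hζ _ (F.globalChart_mem (D := D) u) c hv
  have h6 : (bundleComponents _ (ξ u)).1 = 0 := by
    refine (bijective_fderiv_chartChange D p hmem).1 ?_
    rw [map_zero]
    exact (congrArg Prod.fst h4).trans h5.1
  rw [hq h6, h6, map_zero, zero_add] at h4
  have h7 : globalChart D ⟨p, y⟩ = ((globalChart D u).1, c • (globalChart D u).2) := by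
    rw [← globalChart_smul D p c (c⁻¹ • y), smul_inv_smul₀ hv.ne']
  rw [IsGlobalExprAt, h2, mfderiv_globalChart, h7, h5.2, ← h4, ContinuousLinearEquiv.apply_symm_apply]
  obtain ⟨q', hq', hqe'⟩ := hT y (bundleComponents _ (ξ u)).1 (c • (bundleComponents _ (ξ u)).2)
  refine hqe'.trans ?_
  rw [hq' h6, h6, map_zero, zero_add, map_smul]

end FinslerFunction

/-! ### Closure properties on the indicatrix bundle -/

namespace FinslerFunction

open Filter IsHomogeneousConnection VectorField

variable {n : ℕ} {M : Type*} [TopologicalSpace M]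
  [ChartedSpace (EuclideanSpace ℝ (Fin n)) M] [IsManifold (𝓡 n) ∞ M]
  (F : FinslerFunction n M) {D : M ≃ₘ⟮𝓡 n, 𝓡 n⟯ EuclideanSpace ℝ (Fin n)}

theorem contDiffOn_globalExpr : ContDiffOn ℝ ∞ (F.globalExpr D)
    (nonzeroVectors (EuclideanSpace ℝ (Fin n))) := by
  rw [← nonzeroVectorsOver_univ]
  exact (F.isLocalFinsler_globalExpr D).smooth

theorem differentiableOn_globalExpr : DifferentiableOn ℝ (F.globalExpr D)
    (nonzeroVectors (EuclideanSpace ℝ (Fin n))) :=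
  F.contDiffOn_globalExpr.differentiableOn (by simp)

theorem fderiv_globalExpr_horizontal :
    ∀ z ∈ nonzeroVectors (EuclideanSpace ℝ (Fin n)), ∀ w,
      fderiv ℝ (F.globalExpr D) z (w, -F.globalConnection D z w) = 0 :=
  fun z hz w => (F.isLocalFinsler_globalExpr D).fderiv_horizontal
    (show z ∈ nonzeroVectorsOver univ from ⟨mem_univ _, hz⟩) w

theorem mfderiv_toFun {v : TangentBundle (𝓡 n) M} (hv : v.2 ≠ 0)
    (u : TangentSpace (𝓡 n).tangent v) :
    mfderiv (𝓡 n).tangent 𝓘(ℝ, ℝ) F.toFun v u = fderiv ℝ (F.globalExpr D) (globalChart D v)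
      (mfderiv (𝓡 n).tangent 𝓘(ℝ, EuclideanSpace ℝ (Fin n) × EuclideanSpace ℝ (Fin n))
        (globalChart D) v u) := by
  have h1 : F.toFun = F.globalExpr D ∘ globalChart D := by
    ext v; exact (F.globalExpr_globalChart D v).symm
  have h2 : MDifferentiableAt 𝓘(ℝ, EuclideanSpace ℝ (Fin n) × EuclideanSpace ℝ (Fin n)) 𝓘(ℝ, ℝ)
      (F.globalExpr D) (globalChart D v) :=
    (F.differentiableOn_globalExpr.differentiableAt (isOpen_nonzeroVectors.mem_nhds
      ((globalChart_snd_eq_zero D).not.2 hv))).mdifferentiableAt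
  have h3 := mfderiv_comp v h2 ((contMDiff_globalChart D).mdifferentiableAt (x := v) (by simp))
  rw [← h1, mfderiv_eq_fderiv] at h3
  exact DFunLike.congr_fun h3 u

theorem mfderiv_globalChart_fst (v : TangentBundle (𝓡 n) M) (u : TangentSpace (𝓡 n).tangent v) :
    mfderiv (𝓡 n) (𝓡 n) D v.proj
      (mfderiv (𝓡 n).tangent (𝓡 n) (fun u : TangentBundle (𝓡 n) M => u.proj) v u) =
      Prod.fst (α := EuclideanSpace ℝ (Fin n)) (β := EuclideanSpace ℝ (Fin n))
        (mfderiv (𝓡 n).tangent 𝓘(ℝ, EuclideanSpace ℝ (Fin n) × EuclideanSpace ℝ (Fin n))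
          (globalChart D) v u) := by
  have h1 : MDifferentiableAt (𝓡 n).tangent (𝓡 n) (fun u : TangentBundle (𝓡 n) M => u.proj) v :=
    (Bundle.contMDiff_proj (n := ∞) (TangentSpace (𝓡 n) : M → Type _)).mdifferentiableAt (by simp)
  have h2 := mfderiv_comp v (D.contMDiff.mdifferentiableAt (x := v.proj) (by simp)) h1
  have h3 : MDifferentiableAt 𝓘(ℝ, EuclideanSpace ℝ (Fin n) × EuclideanSpace ℝ (Fin n)) (𝓡 n)
      (ContinuousLinearMap.fst ℝ (EuclideanSpace ℝ (Fin n)) (EuclideanSpace ℝ (Fin n)))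
      (globalChart D v) :=
    (ContinuousLinearMap.differentiableAt _).mdifferentiableAt
  have h4 := mfderiv_comp v h3 ((contMDiff_globalChart D).mdifferentiableAt (x := v) (by simp))
  rw [mfderiv_eq_fderiv, ContinuousLinearMap.fderiv] at h4
  exact DFunLike.congr_fun (h2.symm.trans h4) u

theorem IsGlobalExprAt.verticalPart {v : TangentBundle (𝓡 n) M} (hv : v.2 ≠ 0)
    {V : EuclideanSpace ℝ (Fin n) × EuclideanSpace ℝ (Fin n) →
      EuclideanSpace ℝ (Fin n) × EuclideanSpace ℝ (Fin n)} {u : TangentSpace (𝓡 n).tangent v}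
    (h : IsGlobalExprAt D V v u) :
    IsGlobalExprAt D (fun z => V z - constantLift (F.globalConnection D) (V z).1 z) v
      (F.verticalPart v u) := by
  have h1 := F.mfderiv_globalChart_horizontalLift D hv
    (mfderiv (𝓡 n).tangent (𝓡 n) (fun u : TangentBundle (𝓡 n) M => u.proj) v u)
  have h2 := mfderiv_globalChart_fst (D := D) v u
  rw [IsGlobalExprAt] at h
  rw [h] at h2
  rw [h2] at h1
  exact (map_sub _ _ _).trans (congrArg₂ (fun a b : EuclideanSpace ℝ (Fin n) ×
    EuclideanSpace ℝ (Fin n) => a - b) h h1)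

variable {Hol : EuclideanSpace ℝ (Fin n) → (EuclideanSpace ℝ (Fin n) → EuclideanSpace ℝ (Fin n)) →
  Prop} (hH : IsHolonomySystem (F.globalConnection D) Hol)

include hH in
/-- The vector fields on the indicatrix bundle that are leading terms of families of fibred
holonomy transformations. -/
def holonomyFields : Submodule ℝ F.FieldAlong where
  carrier := {ξ | ∃ ζ, IsHolonomyField (F.globalExpr D) Hol ζ ∧
    ∀ v : F.indicatrixBundle, IsGlobalExprAt D ζ v (ξ v)}
  zero_mem' := ⟨_, IsHolonomyField.zero hH, fun v => map_zero _⟩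
  add_mem' := by
    rintro ξ ξ' ⟨ζ, hζ, h⟩ ⟨ζ', hζ', h'⟩
    exact ⟨_, hζ.add hH hζ', fun v => (map_add _ _ _).trans (congrArg₂ (fun a b :
      EuclideanSpace ℝ (Fin n) × EuclideanSpace ℝ (Fin n) => a + b) (h v) (h' v))⟩
  smul_mem' := by
    rintro c ξ ⟨ζ, hζ, h⟩
    exact ⟨_, hζ.smul hH c, fun v => (map_smul _ _ _).trans (congrArg (fun a :
      EuclideanSpace ℝ (Fin n) × EuclideanSpace ℝ (Fin n) => c • a) (h v))⟩

theorem _root_.IsHolonomyField.contDiffAt {L : EuclideanSpace ℝ (Fin n) ×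
    EuclideanSpace ℝ (Fin n) → ℝ} {ζ : EuclideanSpace ℝ (Fin n) × EuclideanSpace ℝ (Fin n) →
      EuclideanSpace ℝ (Fin n) × EuclideanSpace ℝ (Fin n)} (h : IsHolonomyField L Hol ζ)
    {z : EuclideanSpace ℝ (Fin n) × EuclideanSpace ℝ (Fin n)}
    (hz : z ∈ nonzeroVectors (EuclideanSpace ℝ (Fin n))) : ContDiffAt ℝ ∞ ζ z :=
  h.contDiffOn.contDiffAt (isOpen_nonzeroVectors.mem_nhds hz)

theorem eventually_isGlobalExprAt_homogeneousExtension
    {ζ : EuclideanSpace ℝ (Fin n) × EuclideanSpace ℝ (Fin n) →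
      EuclideanSpace ℝ (Fin n) × EuclideanSpace ℝ (Fin n)}
    (hζ : IsHolonomyField (F.globalExpr D) Hol ζ) {ξ : F.FieldAlong}
    (hξ : ∀ v : F.indicatrixBundle, IsGlobalExprAt D ζ v (ξ v)) (v : F.indicatrixBundle) :
    ∀ᶠ u in 𝓝 v.1, IsGlobalExprAt D ζ u (F.homogeneousExtension ξ u) := by
  have h1 : F.toFun v.1 = 1 := v.2
  have h2 : ∀ᶠ u in 𝓝 v.1, 0 < F.toFun u :=
    F.continuous'.continuousAt.eventually_mem (Ioi_mem_nhds (by rw [h1]; exact one_pos))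
  filter_upwards [h2] with u hu
  exact F.isGlobalExprAt_homogeneousExtension
    (fun z hz c hc => ⟨hζ.fst_eq_zero hz, hζ.apply_smul hz hc⟩) hξ hu

theorem eventually_isGlobalExprAt_horizontalField (X : ∀ x : M, TangentSpace (𝓡 n) x)
    (v : F.indicatrixBundle) : ∀ᶠ u in 𝓝 v.1,
      IsGlobalExprAt D (flatLift (F.globalConnection D) (globalField D X)) u
        (F.horizontalField X u) := by
  filter_upwards [eventually_snd_ne_zero (D := D) (F.snd_ne_zero v)] with u hu
  exact F.isGlobalExprAt_horizontalField X hu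

theorem contDiffAt_flatLift_globalField {X : ∀ x : M, TangentSpace (𝓡 n) x} (hX : IsSmoothField X)
    (v : F.indicatrixBundle) :
    ContDiffAt ℝ 1 (flatLift (F.globalConnection D) (globalField D X)) (globalChart D v.1) :=
  ((contDiffOn_flatLift (F.isHomogeneousConnection_globalConnection D)
    (contDiff_globalField hX)).contDiffAt
      (isOpen_nonzeroVectors.mem_nhds (F.globalChart_mem v))).of_le (by simp)

/-- The closure properties of holonomy fields on `ℝⁿ × ℝⁿ` are carried over by naturality of the
bracket; tangency to the indicatrix bundle holds because the families preserve the Finsler function.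
-/
theorem isBerwaldClosed_holonomyFields : F.IsBerwaldClosed (F.holonomyFields hH) where
  le_vectorFields := by
    rintro ξ ⟨ζ, hζ, hξ⟩
    refine ⟨⟨pullbackField D ζ, fun v hv => ?_, fun v => (hξ v).eq_pullbackField.symm⟩, fun v => ?_⟩
    · exact (contMDiffAt_pullbackField (hζ.contDiffAt
        (F.globalChart_mem ⟨v, hv⟩))).contMDiffWithinAt
    · rw [F.mfderiv_toFun (D := D) (F.snd_ne_zero v), show _ = _ from hξ v]
      exact hζ.fderiv_eq_zero (F.globalChart_mem v) F.differentiableOn_globalExpr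
  bracket_mem := by
    rintro ξ ⟨ζ, hζ, hξ⟩ ξ' ⟨ζ', hζ', hξ'⟩
    refine ⟨_, hζ.lieBracket hH hζ', fun v => ?_⟩
    exact IsGlobalExprAt.mlieBracket (F.eventually_isGlobalExprAt_homogeneousExtension hζ hξ v)
      (F.eventually_isGlobalExprAt_homogeneousExtension hζ' hξ' v)
      ((hζ.contDiffAt (F.globalChart_mem v)).of_le (by simp))
      ((hζ'.contDiffAt (F.globalChart_mem v)).of_le (by simp))
  curvature_mem := by
    intro X Y hX hY
    have hN := F.isHomogeneousConnection_globalConnection D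
    have hX' := contDiff_globalField (D := D) hX
    have hY' := contDiff_globalField (D := D) hY
    refine ⟨_, IsHolonomyField.curvature hH hN F.differentiableOn_globalExpr
      F.fderiv_globalExpr_horizontal hX' hY', fun v => ?_⟩
    have h1 := IsGlobalExprAt.mlieBracket (F.eventually_isGlobalExprAt_horizontalField (D := D) X v)
      (F.eventually_isGlobalExprAt_horizontalField Y v) (F.contDiffAt_flatLift_globalField hX v)
      (F.contDiffAt_flatLift_globalField hY v)
    refine (h1.verticalPart F (F.snd_ne_zero v)).trans ?_
    have hz := F.globalChart_mem (D := D) v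
    -- The brackets of the varying and of the frozen fields differ by a horizontal vector, which the
    -- vertical projection removes.
    obtain ⟨c, hc⟩ := lieBracket_flatLift hN (hX'.differentiable (by simp))
      (hY'.differentiable (by simp)) hz
    simp only [hc]
    rw [Prod.fst_add, lieBracket_constantLift_fst hN hz, zero_add, constantLift, add_sub_cancel_right]
  berwald_mem := by
    rintro ξ ⟨ζ, hζ, hξ⟩ X hX
    have hN := F.isHomogeneousConnection_globalConnection D
    have hX' := contDiff_globalField (D := D) hX
    refine ⟨_, IsHolonomyField.berwald hH hN F.differentiableOn_globalExpr
      F.fderiv_globalExpr_horizontal hζ hX', fun v => ?_⟩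
    have h1 := IsGlobalExprAt.mlieBracket (F.eventually_isGlobalExprAt_horizontalField (D := D) X v)
      (F.eventually_isGlobalExprAt_homogeneousExtension hζ hξ v)
      (F.contDiffAt_flatLift_globalField hX v)
      ((hζ.contDiffAt (F.globalChart_mem v)).of_le (by simp))
    have hz := F.globalChart_mem (D := D) v
    exact h1.trans (lieBracket_flatLift_vertical hN (hX'.differentiable (by simp)) hz
      (hζ.fst_eq_zero hz))

end FinslerFunction

/-! ### Holonomy groups in global coordinates and tangency -/

namespace FinslerFunction

open Filter IsHomogeneousConnection VectorField

variable {n : ℕ} {M : Type*} [TopologicalSpace M]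
  [ChartedSpace (EuclideanSpace ℝ (Fin n)) M] [IsManifold (𝓡 n) ∞ M]
  (F : FinslerFunction n M) {D : M ≃ₘ⟮𝓡 n, 𝓡 n⟯ EuclideanSpace ℝ (Fin n)}

theorem mfderiv_globalChart_symm (v : TangentBundle (𝓡 n) M)
    (u : TangentSpace (𝓡 n).tangent v) :
    mfderiv 𝓘(ℝ, EuclideanSpace ℝ (Fin n) × EuclideanSpace ℝ (Fin n)) (𝓡 n).tangent
      (globalChartSymm D) (globalChart D v)
      (mfderiv (𝓡 n).tangent 𝓘(ℝ, EuclideanSpace ℝ (Fin n) × EuclideanSpace ℝ (Fin n))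
        (globalChart D) v u) = u := by
  have hA := (contMDiff_globalChart D).mdifferentiableAt (x := v) (by simp)
  have hB := (contMDiff_globalChartSymm D).mdifferentiableAt (x := globalChart D v) (by simp)
  have h1 := mfderiv_comp v hB hA
  have h2 : globalChartSymm D ∘ globalChart D = id := by
    ext1 x; exact globalChartSymm_globalChart D x
  rw [h2, mfderiv_id] at h1
  exact (DFunLike.congr_fun h1 u).symm

theorem mfderiv_globalChartSymm_comp (z u : EuclideanSpace ℝ (Fin n) × EuclideanSpace ℝ (Fin n)) :
    mfderiv (𝓡 n).tangent 𝓘(ℝ, EuclideanSpace ℝ (Fin n) × EuclideanSpace ℝ (Fin n))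
      (globalChart D) (globalChartSymm D z)
      (mfderiv 𝓘(ℝ, EuclideanSpace ℝ (Fin n) × EuclideanSpace ℝ (Fin n)) (𝓡 n).tangent
        (globalChartSymm D) z u) = u := by
  have hA := (contMDiff_globalChart D).mdifferentiableAt (x := globalChartSymm D z) (by simp)
  have hB := (contMDiff_globalChartSymm D).mdifferentiableAt (x := z) (by simp)
  have h1 := mfderiv_comp z hA hB
  have h2 : globalChart D ∘ globalChartSymm D = id := by
    ext1 x; exact globalChart_symm D x
  rw [h2, mfderiv_id] at h1
  exact (DFunLike.congr_fun h1 u).symm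

/-! ### Parallel translation along segments -/

theorem isParallel_transport (x w : EuclideanSpace ℝ (Fin n)) {y : EuclideanSpace ℝ (Fin n)}
    (hy : y ≠ 0) : F.IsParallel fun t : ℝ =>
      globalChartSymm D (x + t • w, transport (F.globalConnection D) (t • w) x y) := by
  intro t ht
  have hN := F.isHomogeneousConnection_globalConnection D
  set γ : ℝ → EuclideanSpace ℝ (Fin n) × EuclideanSpace ℝ (Fin n) :=
    fun t => (x + t • w, transport (F.globalConnection D) (t • w) x y) with hγ
  have h1 : HasDerivAt γ (w, -F.globalConnection D (γ t) w) t := by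
    have : HasDerivAt (fun t : ℝ => x + t • w) w t := by
      simpa using ((hasDerivAt_id t).smul_const w).const_add x
    exact this.prodMk (hN.hasDerivAt_transport w x hy t)
  set v' : TangentSpace (𝓡 n).tangent (globalChartSymm D (γ t)) :=
    mfderiv 𝓘(ℝ, EuclideanSpace ℝ (Fin n) × EuclideanSpace ℝ (Fin n)) (𝓡 n).tangent
      (globalChartSymm D) (γ t) (w, -F.globalConnection D (γ t) w) with hv'
  have h2 : HasMFDerivAt 𝓘(ℝ, ℝ) (𝓡 n).tangent (fun t => globalChartSymm D (γ t)) t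
      ((1 : ℝ →L[ℝ] ℝ).smulRight v') := by
    have hB := (contMDiff_globalChartSymm D).mdifferentiableAt (x := γ t) (by simp)
    have h3 := hB.hasMFDerivAt.comp t h1.hasFDerivAt.hasMFDerivAt
    refine h3.congr_mfderiv ?_
    refine ContinuousLinearMap.ext_ring ?_
    exact (congrArg (mfderiv 𝓘(ℝ, EuclideanSpace ℝ (Fin n) × EuclideanSpace ℝ (Fin n)) (𝓡 n).tangent
      (globalChartSymm D) (γ t)) (one_smul ℝ _)).trans (one_smul ℝ v').symm
  have h5 : mfderivWithin 𝓘(ℝ, ℝ) (𝓡 n) (fun s => (globalChartSymm D (γ s)).proj) (Icc 0 1) t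
      (1 : ℝ) = mfderiv (𝓡 n).tangent (𝓡 n) (fun u : TangentBundle (𝓡 n) M => u.proj)
        (globalChartSymm D (γ t)) v' := by
    have hp : MDifferentiableAt (𝓡 n).tangent (𝓡 n) (fun u : TangentBundle (𝓡 n) M => u.proj)
        (globalChartSymm D (γ t)) :=
      (Bundle.contMDiff_proj (n := ∞) (TangentSpace (𝓡 n) : M → Type _)).mdifferentiableAt (by simp)
    have h3 := (hp.hasMFDerivAt.comp t h2).hasMFDerivWithinAt (s := Icc 0 1)
    have h4 := h3.mfderivWithin ((uniqueDiffOn_Icc_zero_one t ht).uniqueMDiffWithinAt)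
    refine (DFunLike.congr_fun h4 (1 : ℝ)).trans ?_
    exact congrArg (mfderiv (𝓡 n).tangent (𝓡 n) (fun u : TangentBundle (𝓡 n) M => u.proj)
      (globalChartSymm D (γ t))) (one_smul ℝ v')
  refine h2.hasMFDerivWithinAt.congr_mfderiv ?_
  -- Both vectors are compared after the invertible derivative of the global chart, where each is
  -- the horizontal lift of `w`.
  have h6 : v' = F.horizontalLift (globalChartSymm D (γ t)) (mfderivWithin 𝓘(ℝ, ℝ) (𝓡 n)
      (fun s => (globalChartSymm D (γ s)).proj) (Icc 0 1) t (1 : ℝ)) := by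
    refine (isInvertible_mfderiv_globalChart D (globalChartSymm D (γ t))).injective ?_
    have h7 := mfderiv_globalChartSymm_comp (D := D) (γ t) (w, -F.globalConnection D (γ t) w)
    have hne : (globalChartSymm D (γ t)).2 ≠ 0 :=
      globalChartSymm_snd_ne_zero D (hN.transport_ne_zero _ _ hy)
    have h8 := mfderiv_globalChart_fst (D := D) (globalChartSymm D (γ t)) v'
    have h9 := F.mfderiv_globalChart_horizontalLift D hne (mfderivWithin 𝓘(ℝ, ℝ) (𝓡 n)
      (fun s => (globalChartSymm D (γ s)).proj) (Icc 0 1) t (1 : ℝ))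
    refine h7.trans (Eq.trans ?_ h9.symm)
    rw [globalChart_symm]
    have h10 : mfderiv (𝓡 n) (𝓡 n) D (globalChartSymm D (γ t)).proj (mfderivWithin 𝓘(ℝ, ℝ) (𝓡 n)
      (fun s => (globalChartSymm D (γ s)).proj) (Icc 0 1) t (1 : ℝ)) = w :=
      (congrArg _ h5).trans (h8.trans (congrArg Prod.fst h7))
    exact (congrArg (fun w => constantLift (F.globalConnection D) w (γ t)) h10).symm
  exact congrArg (fun u => (1 : ℝ →L[ℝ] ℝ).smulRight u) h6

variable (D) in
/-- The parallel translation along a segment in global coordinates. -/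
noncomputable def segmentMap (x x' : EuclideanSpace ℝ (Fin n)) (y : F.indicatrix (D.symm x)) :
    TangentSpace (𝓡 n) (D.symm x') :=
  (globalChartSymm D (x', transport (F.globalConnection D) (x' - x) x
    (globalChart D ⟨D.symm x, y.1⟩).2)).2

theorem globalChart_indicatrix_ne_zero {p : M} (y : F.indicatrix p) :
    (globalChart D ⟨p, y.1⟩).2 ≠ 0 :=
  F.globalChart_mem ⟨⟨p, y.1⟩, y.2⟩

theorem globalChart_indicatrix (x : EuclideanSpace ℝ (Fin n)) (y : F.indicatrix (D.symm x)) :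
    globalChart D ⟨D.symm x, y.1⟩ = (x, (globalChart D ⟨D.symm x, y.1⟩).2) :=
  Prod.ext (D.apply_symm_apply x) rfl

theorem globalExpr_indicatrix (x : EuclideanSpace ℝ (Fin n)) (y : F.indicatrix (D.symm x)) :
    F.globalExpr D (x, (globalChart D ⟨D.symm x, y.1⟩).2) = 1 := by
  rw [← globalChart_indicatrix, globalExpr_globalChart]
  exact y.2

theorem globalChart_segmentMap (x x' : EuclideanSpace ℝ (Fin n)) (y : F.indicatrix (D.symm x)) :
    globalChart D ⟨D.symm x', F.segmentMap D x x' y⟩ = (x', transport (F.globalConnection D)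
      (x' - x) x (globalChart D ⟨D.symm x, y.1⟩).2) :=
  globalChart_symm D (x', transport (F.globalConnection D) (x' - x) x
    (globalChart D ⟨D.symm x, y.1⟩).2)

theorem segmentMap_mem (x x' : EuclideanSpace ℝ (Fin n)) (y : F.indicatrix (D.symm x)) :
    F.segmentMap D x x' y ∈ F.indicatrix (D.symm x') := by
  have hN := F.isHomogeneousConnection_globalConnection D
  have h1 := hN.apply_transport F.differentiableOn_globalExpr F.fderiv_globalExpr_horizontal
    (x' - x) x (F.globalChart_indicatrix_ne_zero (D := D) y)
  rw [add_sub_cancel, globalExpr_indicatrix] at h1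
  exact h1

theorem eq_of_globalChart_eq {p : M} {y y' : TangentSpace (𝓡 n) p}
    (h : globalChart D ⟨p, y⟩ = globalChart D ⟨p, y'⟩) : y = y' := by
  have := globalChart_injective D h
  simpa using this

theorem segmentMap_segmentMap (x x' : EuclideanSpace ℝ (Fin n)) (y : F.indicatrix (D.symm x)) :
    F.segmentMap D x' x ⟨F.segmentMap D x x' y, F.segmentMap_mem x x' y⟩ = y.1 := by
  have hN := F.isHomogeneousConnection_globalConnection D
  refine eq_of_globalChart_eq (D := D) ?_
  have h1 := hN.transport_neg (x' - x) x (F.globalChart_indicatrix_ne_zero (D := D) y)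
  rw [add_sub_cancel, neg_sub] at h1
  rw [globalChart_segmentMap, globalChart_segmentMap, h1, ← globalChart_indicatrix]

variable (D) in
/-- The parallel translation along a segment in global coordinates, as a bijection between
indicatrices. -/
noncomputable def segmentTranslation (x x' : EuclideanSpace ℝ (Fin n)) :
    F.indicatrix (D.symm x) ≃ F.indicatrix (D.symm x') where
  toFun y := ⟨F.segmentMap D x x' y, F.segmentMap_mem x x' y⟩
  invFun y := ⟨F.segmentMap D x' x y, F.segmentMap_mem x' x y⟩
  left_inv y := Subtype.ext (F.segmentMap_segmentMap x x' y)
  right_inv y := Subtype.ext (F.segmentMap_segmentMap x' x y)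

theorem isArcTranslation_segmentTranslation (r : ℕ∞) (x x' : EuclideanSpace ℝ (Fin n)) :
    F.IsArcTranslation r (D.symm x) (D.symm x') (F.segmentTranslation D x x') := by
  have hN := F.isHomogeneousConnection_globalConnection D
  refine ⟨fun t => D.symm (x + t • (x' - x)), ?_, by simp, by simp, fun y => ?_⟩
  · have h1 : ContDiff ℝ ∞ fun t : ℝ => x + t • (x' - x) :=
      contDiff_const.add (contDiff_id.smul contDiff_const)
    exact ((D.symm.contMDiff.comp h1.contMDiff).of_le (by exact_mod_cast le_top)).contMDiffOn
  · have hy := F.globalChart_indicatrix_ne_zero (D := D) y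
    refine ⟨_, fun t _ => ?_, F.isParallel_transport (D := D) x (x' - x) hy, ?_, ?_⟩
    · rfl
    · rw [zero_smul, add_zero, hN.transport_zero _ hy, ← globalChart_indicatrix,
        globalChartSymm_globalChart]
    · rw [one_smul, add_sub_cancel, ← globalChart_segmentMap, globalChartSymm_globalChart]
      rfl

/-- Curves are built by prepending arcs, whereas loops are closed up by a last arc. -/
theorem IsParallelTranslation.append {r : ℕ∞} {p q s : M} {σ : F.indicatrix p ≃ F.indicatrix q}
    {τ : F.indicatrix q ≃ F.indicatrix s} (h : F.IsParallelTranslation r p q σ)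
    (h' : F.IsArcTranslation r q s τ) : F.IsParallelTranslation r p s (σ.trans τ) := by
  induction h with
  | refl p =>
    rw [Equiv.refl_trans, ← Equiv.trans_refl τ]
    exact .cons h' (.refl s)
  | cons h1 _ ih =>
    rw [Equiv.trans_assoc]
    exact .cons h1 (ih h')

/-! ### The holonomy system -/

variable (D) in
/-- `T` is the expression in global coordinates of an element of the holonomy group at `x`. -/
def IsHolonomyExpr (r : ℕ∞) (x : EuclideanSpace ℝ (Fin n))
    (T : EuclideanSpace ℝ (Fin n) → EuclideanSpace ℝ (Fin n)) : Prop :=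
  ∃ φ ∈ F.holonomyGroup r (D.symm x), ∀ y : F.indicatrix (D.symm x),
    globalChart D ⟨D.symm x, (φ y).1⟩ = (x, T (globalChart D ⟨D.symm x, y.1⟩).2)

/-- Conjugation is a group homomorphism, so generators suffice; a loop at `q` preceded by an arc
from `p` and followed by the return arc is a loop at `p`. -/
theorem conj_mem_holonomyGroup {r : ℕ∞} {p q : M} {τ : F.indicatrix p ≃ F.indicatrix q}
    (hτ : F.IsArcTranslation r p q τ) (hτ' : F.IsArcTranslation r q p τ.symm)
    {φ : Equiv.Perm (F.indicatrix q)} (hφ : φ ∈ F.holonomyGroup r q) :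
    (τ.trans φ).trans τ.symm ∈ F.holonomyGroup r p := by
  have h1 : F.holonomyGroup r q ≤
      (F.holonomyGroup r p).comap τ.symm.permCongrHom.toMonoidHom := by
    rw [holonomyGroup, Subgroup.closure_le]
    intro σ hσ
    refine Subgroup.subset_closure ?_
    have h2 : F.IsParallelTranslation r p p ((τ.trans σ).trans τ.symm) :=
      (IsParallelTranslation.cons hτ hσ).append F hτ'
    exact h2
  exact h1 hφ

theorem isHolonomySystem (r : ℕ∞) :
    IsHolonomySystem (F.globalConnection D) (F.IsHolonomyExpr D r) where
  refl x := ⟨1, one_mem _, fun y => F.globalChart_indicatrix x y⟩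
  congr := by
    rintro x T T' ⟨φ, hφ, h⟩ he
    exact ⟨φ, hφ, fun y => by rw [h, he _ (F.globalChart_indicatrix_ne_zero y)]⟩
  comp := by
    rintro x T T' ⟨φ, hφ, h⟩ ⟨φ', hφ', h'⟩
    refine ⟨φ * φ', mul_mem hφ hφ', fun y => ?_⟩
    rw [Equiv.Perm.mul_apply, h, h']
  inverse := by
    rintro x T T' ⟨φ, hφ, h⟩ he
    refine ⟨φ⁻¹, inv_mem hφ, fun y => ?_⟩
    have h1 := h (φ⁻¹ y)
    have h2 : φ (φ⁻¹ y) = y := φ.apply_symm_apply y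
    rw [h2] at h1
    rw [h1, he _ (F.globalChart_indicatrix_ne_zero _)]
    exact F.globalChart_indicatrix x _
  parallelogram x a b := by
    refine ⟨(((F.segmentTranslation D x (x + a)).trans (F.segmentTranslation D _ (x + a + b))).trans
      (F.segmentTranslation D _ (x + b))).trans (F.segmentTranslation D _ x),
      Subgroup.subset_closure (((((IsParallelTranslation.refl (F := F) (r := r) _).append F
        (F.isArcTranslation_segmentTranslation r x (x + a))).append F
        (F.isArcTranslation_segmentTranslation r (x + a) (x + a + b))).append F
        (F.isArcTranslation_segmentTranslation r (x + a + b) (x + b))).append F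
        (F.isArcTranslation_segmentTranslation r (x + b) x)), fun y => ?_⟩
    have e1 : x + a - x = a := by abel
    have e2 : x + a + b - (x + a) = b := by abel
    have e3 : x + b - (x + a + b) = -a := by abel
    have e4 : x - (x + b) = -b := by abel
    simp only [Equiv.trans_apply, segmentTranslation, Equiv.coe_fn_mk, globalChart_segmentMap, e1,
      e2, e3, e4]
  conj := by
    rintro x a T ⟨φ, hφ, h⟩
    refine ⟨_, F.conj_mem_holonomyGroup (F.isArcTranslation_segmentTranslation r x (x + a))
      (F.isArcTranslation_segmentTranslation r (x + a) x) hφ, fun y => ?_⟩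
    have e1 : x + a - x = a := by abel
    have e2 : x - (x + a) = -a := by abel
    have h1 := h (F.segmentTranslation D x (x + a) y)
    have h2 := F.globalChart_segmentMap (D := D) x (x + a) y
    have h3 := F.globalChart_segmentMap (D := D) (x + a) x (φ (F.segmentTranslation D x (x + a) y))
    rw [h1, e2] at h3
    rw [e1] at h2
    refine h3.trans ?_
    have h4 : globalChart D ⟨D.symm (x + a), (F.segmentTranslation D x (x + a) y).1⟩ = _ := h2
    rw [h4]

/-! ### Tangency -/

/-- The reparametrized family is conjugated by the global chart. Each of its members is some `Φ s`
or `Ψ s`, hence a smooth fibred holonomy transformation, although the dependence on `t` is only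
`C¹`. -/
theorem isTangentField_of_isHolonomyField (r : ℕ∞)
    {ζ : EuclideanSpace ℝ (Fin n) × EuclideanSpace ℝ (Fin n) →
      EuclideanSpace ℝ (Fin n) × EuclideanSpace ℝ (Fin n)}
    (hζ : IsHolonomyField (F.globalExpr D) (F.IsHolonomyExpr D r) ζ) {ξ : F.FieldAlong}
    (hξ : ∀ v : F.indicatrixBundle, IsGlobalExprAt D ζ v (ξ v)) :
    F.IsTangentField (F.fibredHolonomyGroup r) ξ := by
  have hH := F.isHolonomySystem (D := D) r
  obtain ⟨k, Φ, Ψ, hF, hfib⟩ := hζ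
  have hfib' := IsHolonomyField.inverse_family hH hF hfib
  -- a general transformation
  have key : ∀ T T' : EuclideanSpace ℝ (Fin n) × EuclideanSpace ℝ (Fin n) →
      EuclideanSpace ℝ (Fin n) × EuclideanSpace ℝ (Fin n),
      IsFibredHolonomy (F.globalExpr D) (F.IsHolonomyExpr D r) T →
      IsFibredHolonomy (F.globalExpr D) (F.IsHolonomyExpr D r) T' →
      ContDiffOn ℝ ∞ T (nonzeroVectors _) → ContDiffOn ℝ ∞ T' (nonzeroVectors _) →
      (∀ z ∈ nonzeroVectors (EuclideanSpace ℝ (Fin n)), T' (T z) = z) →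
      (∀ z ∈ nonzeroVectors (EuclideanSpace ℝ (Fin n)), T (T' z) = z) →
      ∃ φ ∈ F.fibredHolonomyGroup r, ∀ v : F.indicatrixBundle,
        (φ v : TangentBundle (𝓡 n) M) = globalChartSymm D (T (globalChart D v)) := by
    intro T T' hT hT' hs hs' hl hr
    have hmem : ∀ T, IsFibredHolonomy (F.globalExpr D) (F.IsHolonomyExpr D r) T →
        ∀ v : F.indicatrixBundle, globalChartSymm D (T (globalChart D v)) ∈ F.indicatrixBundle := by
      intro T hT v
      have h1 := hT.apply_eq _ (F.globalChart_mem (D := D) v)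
      rw [globalExpr_globalChart] at h1
      exact h1.trans v.2
    have hsm : ∀ T : EuclideanSpace ℝ (Fin n) × EuclideanSpace ℝ (Fin n) →
        EuclideanSpace ℝ (Fin n) × EuclideanSpace ℝ (Fin n),
        ContDiffOn ℝ ∞ T (nonzeroVectors _) → ContMDiffOn (𝓡 n).tangent (𝓡 n).tangent ∞
        (fun v => globalChartSymm D (T (globalChart D v))) F.indicatrixBundle := by
      intro T hs
      exact (contMDiff_globalChartSymm D).comp_contMDiffOn (hs.contMDiffOn.comp
        (contMDiff_globalChart D).contMDiffOn fun v hv => F.globalChart_mem ⟨v, hv⟩)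
    refine ⟨⟨fun v => ⟨_, hmem T hT v⟩, fun v => ⟨_, hmem T' hT' v⟩, fun v => Subtype.ext ?_,
      fun v => Subtype.ext ?_⟩, ⟨⟨⟨_, hsm T hs, fun v => rfl⟩, ⟨_, hsm T' hs', fun v => rfl⟩⟩,
        fun p => ?_⟩, fun v => rfl⟩
    · dsimp only
      rw [globalChart_symm, hl _ (F.globalChart_mem v), globalChartSymm_globalChart]
    · dsimp only
      rw [globalChart_symm, hr _ (F.globalChart_mem v), globalChartSymm_globalChart]
    · obtain ⟨x, rfl⟩ : ∃ x, D.symm x = p := ⟨D p, D.symm_apply_apply p⟩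
      obtain ⟨φ, hφ, h⟩ := hT.holonomy x
      refine ⟨φ, hφ, fun y => ?_⟩
      have h1 : globalChart D ⟨D.symm x, (φ y).1⟩ =
        (x, (T (x, (globalChart D ⟨D.symm x, y.1⟩).2)).2) := h y
      rw [← F.globalChart_indicatrix x y] at h1
      have h2 : (T (globalChart D ⟨D.symm x, y.1⟩)).1 = x :=
        (hT.fst _ (F.globalChart_mem (D := D) ⟨⟨D.symm x, y.1⟩, y.2⟩)).trans (D.apply_symm_apply x)
      have h3 : globalChart D ⟨D.symm x, (φ y).1⟩ = T (globalChart D ⟨D.symm x, y.1⟩) :=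
        h1.trans (Prod.ext h2.symm rfl)
      change globalChartSymm D (T (globalChart D ⟨D.symm x, y.1⟩)) = _
      rw [← h3, globalChartSymm_globalChart]
  have hsz : ∀ {Φ Ψ : ℝ → EuclideanSpace ℝ (Fin n) × EuclideanSpace ℝ (Fin n) →
      EuclideanSpace ℝ (Fin n) × EuclideanSpace ℝ (Fin n)} {ζ},
      LocalFamily (nonzeroVectors _) k ζ Φ Ψ → ∀ s, ContDiffOn ℝ ∞ (Φ s) (nonzeroVectors _) :=
    fun hF s => hF.smooth.comp (contDiffOn_const.prodMk contDiffOn_id) fun z hz => ⟨mem_univ s, hz⟩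
  have hR : ∀ t, ∃ φ ∈ F.fibredHolonomyGroup r, ∀ v : F.indicatrixBundle,
      (φ v : TangentBundle (𝓡 n) M) =
        globalChartSymm D (rootFamily k Φ Ψ t (globalChart D v)) := by
    intro t
    unfold rootFamily
    split_ifs
    · exact key _ _ (hfib _) (hfib' _) (hsz hF _) (hsz (hF.inv isOpen_nonzeroVectors) _)
        (hF.left_inv _) (hF.right_inv _)
    · exact key _ _ (hfib' _) (hfib _) (hsz (hF.inv isOpen_nonzeroVectors) _) (hsz hF _)
        (hF.right_inv _) (hF.left_inv _)
  choose φ hφ hφe using hR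
  -- The families exist for all `t`, so any `ε` would serve.
  refine ⟨1, one_pos, φ, fun t _ => hφ t,
    ⟨fun p => globalChartSymm D (rootFamily k Φ Ψ p.1 (globalChart D p.2)), ?_,
      fun t _ v => (hφe t v).symm⟩, ?_, fun v => ?_⟩
  · have h1 := (hF.contDiffOn_rootFamily isOpen_nonzeroVectors).contMDiffOn
    have h2 : ContMDiff (𝓘(ℝ, ℝ).prod (𝓡 n).tangent)
        𝓘(ℝ, ℝ × EuclideanSpace ℝ (Fin n) × EuclideanSpace ℝ (Fin n)) 1
        (fun p : ℝ × TangentBundle (𝓡 n) M => (p.1, globalChart D p.2)) :=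
      contMDiff_fst.prodMk_space (((contMDiff_globalChart D).of_le (by simp)).comp contMDiff_snd)
    exact ((contMDiff_globalChartSymm D).of_le (by simp)).comp_contMDiffOn
      (h1.comp h2.contMDiffOn fun p hp => ⟨mem_univ _, F.globalChart_mem ⟨p.2, hp.2⟩⟩)
  · ext1 v
    refine Subtype.ext ?_
    rw [hφe]
    simp [rootFamily, absRoot_zero hF.pos, hF.zero (F.globalChart_mem v),
      globalChartSymm_globalChart]
  · have hv := F.globalChart_mem (D := D) v
    have h1 := hF.hasDerivAt_rootFamily isOpen_nonzeroVectors hv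
    have h0 : rootFamily k Φ Ψ 0 (globalChart D v) = globalChart D v := by
      simp [rootFamily, absRoot_zero hF.pos, hF.zero hv]
    have hB := (contMDiff_globalChartSymm D).mdifferentiableAt
      (x := rootFamily k Φ Ψ 0 (globalChart D v)) (by simp)
    have h3 := hB.hasMFDerivAt.comp (0 : ℝ) h1.hasFDerivAt.hasMFDerivAt
    have h4 : (fun t : ℝ => (φ t v : TangentBundle (𝓡 n) M)) =
        fun t => globalChartSymm D (rootFamily k Φ Ψ t (globalChart D v)) := by
      ext1 t; exact hφe t v
    rw [h4]
    refine h3.congr_mfderiv ?_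
    refine ContinuousLinearMap.ext_ring ?_
    have h5 : ∀ z, z = globalChart D v → mfderiv 𝓘(ℝ, EuclideanSpace ℝ (Fin n) ×
        EuclideanSpace ℝ (Fin n)) (𝓡 n).tangent (globalChartSymm D) z (ζ (globalChart D v)) =
          ξ v := by
      rintro _ rfl
      rw [← show _ = ζ (globalChart D v) from hξ v]
      exact mfderiv_globalChart_symm v.1 (ξ v)
    exact (congrArg (mfderiv 𝓘(ℝ, EuclideanSpace ℝ (Fin n) × EuclideanSpace ℝ (Fin n))
      (𝓡 n).tangent (globalChartSymm D) _) (one_smul ℝ _)).trans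
      ((h5 _ h0).trans (one_smul ℝ (ξ v)).symm)

end FinslerFunction

theorem mainTheorem3 {n : ℕ} {M : Type*} [TopologicalSpace M]
    [ChartedSpace (EuclideanSpace ℝ (Fin n)) M] [IsManifold (𝓡 n) ∞ M]
    (hM : Nonempty (M ≃ₘ⟮𝓡 n, 𝓡 n⟯ EuclideanSpace ℝ (Fin n)))
    (F : FinslerFunction n M) (r : ℕ∞) (hr : 1 ≤ r) :
    F.IsTangentAlgebra (F.fibredHolonomyGroup r) F.fibredHolonomyAlgebra := by
  obtain ⟨D⟩ := hM
  intro ξ hξ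
  have hH := F.isHolonomySystem (D := D) r
  -- Minimality of the fibred holonomy algebra.
  have h1 : F.fibredHolonomyAlgebra ≤ F.holonomyFields hH :=
    sInf_le (F.isBerwaldClosed_holonomyFields hH)
  obtain ⟨ζ, hζ, h⟩ := h1 hξ
  exact F.isTangentField_of_isHolonomyField r hζ h
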